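/- Let $\Bbbk$ be a finite field with $s$ elements, let $q$ satisfy $q^2=s$, and let $K$ be a field of characteristic $0$ containing $q$ (for instance $K=\mathbb{Q}(q)$). Write $[x,y]_c:=xy-c\,yx$. \emph{Disk algebras.} Let $D$ be a disk with three marked boundary intervals and boundary arcs $E_1,E_2,E_3$ (indices in $\mathbb{Z}/3$), with boundary paths $\alpha_i:E_i\to E_{i+1}$ of degree $h(i)$, where $h(1)+h(2)+h(3)=1$. Its Fukaya category over $\Bbbk$ is the $A_\infty$-category with objects $E_i$, morphisms spanned by the identities and the $\alpha_i$, and operations $\mu_2(b,a)=(-1)^{|a|}a\cdot b$ (concatenation, so $\mu_2(\alpha_{i+1},\alpha_i)=0$), $\mu_3(\alpha_{i+2},\alpha_{i+1},\alpha_i)=1_{E_i}$, all others being zero. Let $\mathcal{T}$ be its derived category (the homotopy category of twisted complexes). The twisted derived Hall algebra of $\mathcal{T}$ over $K$ has the isomorphism classes of objects as a basis and product $X*Y=q^{\langle Y,X\rangle}\sum_L F^L_{X,Y}L$, where $\langle\cdot,\cdot\rangle$ is the Euler form and $$F^L_{X,Y}=\frac{|\mathrm{Hom}(X,L)_Y|}{|\mathrm{Aut}(X)|}\cdot\frac{\prod_{n>0}|\mathrm{Ext}^{-n}(X,L)|^{(-1)^n}}{\prod_{n>0}|\mathrm{Ext}^{-n}(X,X)|^{(-1)^n}},$$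 $\mathrm{Hom}(X,L)_Y$ being the set of morphisms $X\to L$ with cone isomorphic to $Y$. The disk algebra $\mathbf{f}(D)$ is the subalgebra, with respect to the opposite product $x\cdot y:=y*x$, generated by the suspensions $\sigma^\ell E_i:=E_i[-\ell]$, $\ell\in\mathbb{Z}$. \emph{The annulus.} Let $m,n\ge 1$. The annulus $K_{m,n}$ has $m$ marked intervals on one boundary component and $n$ on the other. Its full standard arc system is $$\mathbf{A}=\{S,T\}\sqcup\{P_1,\ldots,P_{m-1}\}\sqcup\{Q_1,\ldots,Q_{n-1}\}\sqcup\{E_1,\ldots,E_m\}\sqcup\{F_1,\ldots,F_n\},$$ with $P_0=Q_0=S$ and $P_m=Q_n=T$; the $E_i$, $F_j$ are the boundary arcs. It cuts $K_{m,n}$ into the triangles $C_j$ with sides $(P_j,P_{j+1},E_{j+1})$ for $0\le j<m$ and $D_i$ with sides $(Q_i,Q_{i+1},F_{i+1})$ for $0\le i<n$; the sides are listed in the cyclic order in which the boundary paths run, and the standard foliation data is $h=(0,0,1)$ on each triangle. The naive algebra $\mathbf{n}(K_{m,n},\mathbf{A})$ is the quotient of the free product over $K$ of the disk algebras of these $m+n$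 triangles by the relations $\sigma^\ell E=\sigma^\ell F$ for all $\ell$, whenever sides $E$, $F$ of distinct triangles are the same arc of $\mathbf{A}$, and $[\sigma^sE,\sigma^tF]_1=0$ for all $s,t\in\mathbb{Z}$, whenever sides $E$, $F$ of distinct triangles have no end points in a common marked interval of $K_{m,n}$. \emph{Claim.} Consider the $K$-algebra with generators $X_\ell$ for $X\in\mathbf{A}$, $\ell\in\mathbb{Z}$, and the following relations, for all $\ell,s,t\in\mathbb{Z}$. \begin{enumerate} \item For each triangle $C_j$, $D_i$ with sides $(X^1,X^2,X^3)$ in the order above, $h=(0,0,1)$, and all $i\in\mathbb{Z}/3$: (R1) $[X^i_{\ell},X^i_{k+\ell}]_{q^{2(-1)^k}}=\delta_{k,1}\frac{q^{-1}}{q^2-1}$ for $k\ge1$; (R2) $[X^{i+1}_{k+\ell},X^i_{h(i)+\ell}]_{q^{(-1)^{k+1}}}=\delta_{k,1}X^{i+2}_{1-h(i+1)+\ell}$ for $k\ge 1$, and $[X^{i+1}_{k+\ell},X^i_{h(i)+\ell}]_{q^{(-1)^{k}}}=0$ for $k<1$. \item Commutativity of distant arcs: $[X_s,Y_t]_1=0$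 for the following pairs $(X,Y)$: (a) $(S,E_k)$ and $(T,E_k)$ for $1<k<m$; $(S,F_k)$ and $(T,F_k)$ for $1<k<n$; (b) for $1\le i<m$: $(P_i,E_k)$ with $1\le k\le m$, $k\ne i,i+1$; $(P_i,F_k)$ with $1\le k\le n$, $k\neq 1,n$; for $1\le i<n$: $(Q_i,F_k)$ with $1\le k\le n$, $k\ne i,i+1$; $(Q_i,E_k)$ with $1\le k\le m$, $k\ne 1,m$; and $(P_i,Q_k)$ for $1\le i<m$, $1\le k<n$; (c) $(E_i,E_j)$ with $j\ne i-1,i,i+1$ in $\mathbb{Z}/m$; $(F_i,F_j)$ with $j\neq i-1,i,i+1$ in $\mathbb{Z}/n$; and $(E_i,F_j)$ for all $1\le i\le m$, $1\le j\le n$. \end{enumerate} Then $X_\ell\mapsto-\sigma^\ell X$ extends to an isomorphism of $K$-algebras from this algebra onto $\mathbf{n}(K_{m,n},\mathbf{A})$. -/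

import Mathlib

open scoped Matrix

noncomputable section

namespace FukayaHall

/-! ### The Fukaya category of a disk with three marked intervals

The boundary arcs are `E₀, E₁, E₂` (indices in `Fin 3`, i.e. cyclic), the nontrivial boundary paths
are `αᵢ : Eᵢ → Eᵢ₊₁`, and the foliation data `h` satisfies `h i = |αᵢ|`. Each space
`hom(Eᵢ, Eⱼ)` is spanned by at most one boundary path: the trivial one if `j = i`, and `αᵢ` if
`j = i + 1`; it is zero if `j = i + 2`. -/

/-- There is a boundary path from `Eᵢ` to `Eⱼ`. -/
def IsPath (i j : Fin 3) : Prop := j = i ∨ j = i + 1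

instance (i j : Fin 3) : Decidable (IsPath i j) := by unfold IsPath; infer_instance

/-- The degree of the boundary path from `Eᵢ` to `Eⱼ` (meaningful if `IsPath i j`). -/
def pathDeg (h : Fin 3 → ℤ) (i j : Fin 3) : ℤ := if j = i then 0 else h i

/-- Structure constant of `μ₂(b, a) = (-1)^{|a|} a·b` for the paths `a : Eᵢ → Eⱼ` and
`b : Eⱼ → Eₗ`. Two nontrivial paths lie in different marked intervals and cannot be concatenated. -/
def fukMu2 (h : Fin 3 → ℤ) (i j l : Fin 3) : ℤ :=
  if (j = i ∧ IsPath j l) ∨ (l = j ∧ IsPath i j) then (pathDeg h i j).negOnePow else 0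

/-- Structure constant of `μ₃`: the disk sequence `αᵢ, αᵢ₊₁, αᵢ₊₂` is sent to the trivial path at
`Eᵢ`; all other values of `μ₃` (and all `μ₁`, `μₙ` with `n ≥ 4`) vanish. -/
def fukMu3 (i j l r : Fin 3) : ℤ := if j = i + 1 ∧ l = j + 1 ∧ r = l + 1 then 1 else 0

/-! ### Twisted complexes -/

/-- A finite direct sum of shifted arcs `⨁ₓ E_{arc x}[shift x]`. -/
structure ShiftedSum where
  size : ℕ
  arc : Fin size → Fin 3
  shift : Fin size → ℤ

/-- Morphisms between sums of shifted arcs: the entry `f x y` is the coefficient of the boundary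
path from `arc x` to `arc y`. -/
abbrev Mor (k : Type*) (P Q : ShiftedSum) := Matrix (Fin P.size) (Fin Q.size) k

section
variable {k : Type*} [Field k] (h : Fin 3 → ℤ)

/-- The morphisms of degree `d`, using `hom^d(E[s], E'[t]) = hom^{d+t-s}(E, E')`. -/
def homDeg (P Q : ShiftedSum) (d : ℤ) : Submodule k (Mor k P Q) where
  carrier := {f | ∀ x y, f x y ≠ 0 →
    IsPath (P.arc x) (Q.arc y) ∧ pathDeg h (P.arc x) (Q.arc y) = d + Q.shift y - P.shift x}
  zero_mem' := fun x y hxy => absurd rfl hxy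
  add_mem' := fun {f g} hf hg x y hxy => by
    by_cases hfx : f x y = 0
    · by_cases hgx : g x y = 0
      · exact absurd (by simp [hfx, hgx]) hxy
      · exact hg x y hgx
    · exact hf x y hfx
  smul_mem' := fun c f hf x y hxy => hf x y (fun h0 => hxy (by simp [h0]))

/-- `(-1)^n` as an element of `k`. -/
def sgn (k : Type*) [Field k] (n : ℤ) : k := ((n.negOnePow : ℤ) : k)

/-- The operation `μ₂` on the additive enlargement. For elements `φ₁ ⊗ a₁`, `φ₂ ⊗ a₂` with `φᵢ` a
map of shifted lines it is `(-1)^{|φ₁|(|a₂|-1)} φ₂φ₁ ⊗ μ₂(a₂, a₁)`. -/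
def mu2 {P Q R : ShiftedSum} (g : Mor k Q R) (f : Mor k P Q) : Mor k P R := fun x z =>
  ∑ y, (fukMu2 h (P.arc x) (Q.arc y) (R.arc z) : k) *
    sgn k ((P.shift x - Q.shift y) * (pathDeg h (Q.arc y) (R.arc z) - 1)) * (g y z * f x y)

/-- The operation `μ₃` on the additive enlargement, with the sign
`(-1)^{|φ₁|(|a₂|-1) + |φ₁|(|a₃|-1) + |φ₂|(|a₃|-1)}`. -/
def mu3 {P Q R T : ShiftedSum} (e : Mor k R T) (g : Mor k Q R) (f : Mor k P Q) : Mor k P T :=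
  fun x w => ∑ y, ∑ z, (fukMu3 (P.arc x) (Q.arc y) (R.arc z) (T.arc w) : k) *
    sgn k ((P.shift x - Q.shift y) * (pathDeg h (Q.arc y) (R.arc z) - 1)
      + (P.shift x - Q.shift y) * (pathDeg h (R.arc z) (T.arc w) - 1)
      + (Q.shift y - R.shift z) * (pathDeg h (R.arc z) (T.arc w) - 1)) * (e z w * (g y z * f x y))

end

/-- (One-sided) twisted complexes over the Fukaya category of the disk: `δ` has degree one, is
strictly triangular, and satisfies the Maurer-Cartan equation `μ₂(δ, δ) + μ₃(δ, δ, δ) = 0`. -/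
structure Tw (k : Type*) [Field k] (h : Fin 3 → ℤ) extends ShiftedSum where
  δ : Mor k toShiftedSum toShiftedSum
  δ_deg : δ ∈ homDeg h toShiftedSum toShiftedSum 1
  δ_tri : ∀ x y, δ x y ≠ 0 → x < y
  mc : mu2 h δ δ + mu3 h δ δ δ = 0

namespace Tw

variable {k : Type*} [Field k] {h : Fin 3 → ℤ}

/-- The differential on the morphism complex from `X` to `Y`. -/
def d (X Y : Tw k h) :
    Mor k X.toShiftedSum Y.toShiftedSum →ₗ[k] Mor k X.toShiftedSum Y.toShiftedSum where
  toFun f := mu2 h Y.δ f + mu2 h f X.δ + mu3 h Y.δ Y.δ f + mu3 h Y.δ f X.δ + mu3 h f X.δ X.δ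
  map_add' f g := by
    ext x z
    simp only [mu2, mu3, Matrix.add_apply, mul_add, add_mul, Finset.sum_add_distrib]
    abel
  map_smul' c f := by
    ext x z
    simp only [mu2, mu3, Matrix.add_apply, Matrix.smul_apply, smul_eq_mul, RingHom.id_apply,
      mul_add, Finset.mul_sum]
    congr 1
    · congr 1
      · congr 1
        · congr 1 <;> exact Finset.sum_congr rfl fun _ _ => by ring
        · exact Finset.sum_congr rfl fun _ _ => Finset.sum_congr rfl fun _ _ => by ring
      · exact Finset.sum_congr rfl fun _ _ => Finset.sum_congr rfl fun _ _ => by ring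
    · exact Finset.sum_congr rfl fun _ _ => Finset.sum_congr rfl fun _ _ => by ring

/-- The composition `μ₂` of twisted complexes. -/
def comp {X Y Z : Tw k h} (g : Mor k Y.toShiftedSum Z.toShiftedSum)
    (f : Mor k X.toShiftedSum Y.toShiftedSum) : Mor k X.toShiftedSum Z.toShiftedSum :=
  mu2 h g f + mu3 h Z.δ g f + mu3 h g Y.δ f + mu3 h g f X.δ

/-- Closed morphisms of degree `n`. -/
def cocycles (X Y : Tw k h) (n : ℤ) : Submodule k (Mor k X.toShiftedSum Y.toShiftedSum) :=
  homDeg h X.toShiftedSum Y.toShiftedSum n ⊓ LinearMap.ker (d X Y)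

/-- Exact morphisms of degree `n`. -/
def coboundaries (X Y : Tw k h) (n : ℤ) : Submodule k (Mor k X.toShiftedSum Y.toShiftedSum) :=
  (homDeg h X.toShiftedSum Y.toShiftedSum (n - 1)).map (d X Y)

/-- `Extⁿ(X, Y)`, the `n`-th cohomology of the morphism complex. -/
abbrev Ext (X Y : Tw k h) (n : ℤ) : Type _ :=
  cocycles X Y n ⧸ (coboundaries X Y n).submoduleOf (cocycles X Y n)

/-- The class in `Hom(X, Y) = Ext⁰(X, Y)` of a closed morphism of degree zero. -/
def cls {X Y : Tw k h} (f : cocycles X Y 0) : Ext X Y 0 := Submodule.Quotient.mk f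

/-- The class of `f` is invertible in the homotopy category. -/
def IsInvertible {X Y : Tw k h} (f : cocycles X Y 0) : Prop :=
  ∃ g : cocycles Y X 0,
    comp (X := X) (Y := Y) (Z := X) g.1 f.1 - 1 ∈ coboundaries X X 0 ∧
    comp (X := Y) (Y := X) (Z := Y) f.1 g.1 - 1 ∈ coboundaries Y Y 0

/-- Isomorphism in the homotopy category of twisted complexes. -/
def Iso (X Y : Tw k h) : Prop := ∃ f : cocycles X Y 0, IsInvertible f

/-- `Aut(X) ⊆ Hom(X, X)`. -/
def aut (X : Tw k h) : Set (Ext X X 0) := {ξ | ∃ f : cocycles X X 0, cls f = ξ ∧ IsInvertible f}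

/-- `C` is (up to the order of its summands) the mapping cone of `f : X → Y`: its underlying sum is
`X[1] ⊕ Y`, and its differential consists of those of `X` and `Y` and of `f`, where the sign
identifies morphisms `X → Y` of degree `0` with morphisms `X[1] → Y` of degree `1`. -/
def IsCone {X Y : Tw k h} (f : cocycles X Y 0) (C : Tw k h) : Prop :=
  ∃ e : Fin X.size ⊕ Fin Y.size ≃ Fin C.size,
    (∀ x, C.arc (e (Sum.inl x)) = X.arc x ∧ C.shift (e (Sum.inl x)) = X.shift x + 1) ∧
    (∀ y, C.arc (e (Sum.inr y)) = Y.arc y ∧ C.shift (e (Sum.inr y)) = Y.shift y) ∧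
    Matrix.submatrix C.δ e e =
      Matrix.fromBlocks X.δ (Matrix.of fun x y => sgn k (Y.shift y) * f.1 x y) 0 Y.δ

/-- `Hom(X, L)_Y`: the morphisms `X → L` whose cone is isomorphic to `Y`. -/
def homWithCone (X L Y : Tw k h) : Set (Ext X L 0) :=
  {ξ | ∃ f : cocycles X L 0, cls f = ξ ∧ ∃ C : Tw k h, IsCone f C ∧ Iso C Y}

/-- The Euler form `⟨X, Y⟩ = ∑ₙ (-1)ⁿ dim Extⁿ(X, Y)`. -/
def euler (X Y : Tw k h) : ℤ :=
  ∑ᶠ n : ℤ, (n.negOnePow : ℤ) * (Module.finrank k (Ext X Y n) : ℤ)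

/-- `∏_{n > 0} |Ext^{-n}(X, Y)|^{(-1)ⁿ}`. -/
def negExtProd (X Y : Tw k h) : ℚ :=
  ∏ᶠ n : ℕ, (Nat.card (Ext X Y (-((n : ℤ) + 1))) : ℚ) ^ ((((n : ℤ) + 1).negOnePow : ℤˣ) : ℤ)

/-- Toën's structure constants `F^L_{X,Y}`. -/
def toen (X Y L : Tw k h) : ℚ :=
  (Nat.card (homWithCone X L Y) : ℚ) / (Nat.card (aut X) : ℚ) *
    (negExtProd X L / negExtProd X X)

/-- The zero object. -/
def zero (k : Type*) [Field k] (h : Fin 3 → ℤ) : Tw k h where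
  size := 0
  arc := Fin.elim0
  shift := Fin.elim0
  δ := 0
  δ_deg := Submodule.zero_mem _
  δ_tri := fun x => x.elim0
  mc := by ext x; exact x.elim0

/-- The suspension `σ^l Eᵢ = Eᵢ[-l]` of the arc `Eᵢ`. -/
def suspArc (k : Type*) [Field k] (h : Fin 3 → ℤ) (i : Fin 3) (l : ℤ) : Tw k h where
  size := 1
  arc := fun _ => i
  shift := fun _ => -l
  δ := 0
  δ_deg := Submodule.zero_mem _
  δ_tri := fun _ _ hxy => absurd rfl hxy
  mc := by ext x y; simp [mu2, mu3]

end Tw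

/-! ### The derived Hall algebra and the composition subalgebra of the disk -/

section Hall

variable {K : Type*} [Field K]

/-- Isomorphism classes of objects. -/
def IsoClass (k : Type*) [Field k] (h : Fin 3 → ℤ) : Type _ := Quot (Tw.Iso (k := k) (h := h))

/-- The vector space underlying the derived Hall algebra. -/
abbrev Hall (k : Type*) [Field k] (K : Type*) [Field K] (h : Fin 3 → ℤ) := IsoClass k h →₀ K

variable (k : Type*) [Field k] (q : K) (h : Fin 3 → ℤ)

/-- The twisted product `X * Y = q^{⟨Y, X⟩} ∑_L F^L_{X,Y} L` of two isomorphism classes. -/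
def hallMulBasis (X Y : IsoClass k h) : Hall k K h :=
  q ^ (Tw.euler Y.out X.out) • ∑ᶠ L : IsoClass k h,
    Finsupp.single L ((Tw.toen X.out Y.out L.out : ℚ) : K)

/-- The product of the twisted derived Hall algebra, extended bilinearly. -/
def hallMul : Hall k K h →ₗ[K] Hall k K h →ₗ[K] Hall k K h :=
  Finsupp.linearCombination K fun X => Finsupp.linearCombination K (hallMulBasis k q h X)

/-- The canonical map `κ` from the free algebra on the suspensions of arcs to the Hall algebra
with its opposite multiplication (`xy` is sent to `[y] * [x]`, so that the left factor of a product
is the quotient object and the right factor the subobject): the word `x₁ x₂ ⋯ xᵣ` is sent to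
`[xᵣ] * (⋯ * ([x₂] * ([x₁] * 1)))`, where `1` is the class of the zero object. -/
def kappa (w : FreeAlgebra K (Fin 3 × ℤ)) : Hall k K h :=
  (MulOpposite.unop (FreeAlgebra.lift K (fun a : Fin 3 × ℤ => MulOpposite.op
      (hallMul k q h (Finsupp.single (Quot.mk _ (Tw.suspArc k h a.1 a.2)) 1) :
        Module.End K (Hall k K h))) w))
    (Finsupp.single (Quot.mk _ (Tw.zero k h)) 1)

/-- The composition subalgebra `f(D², A₃)`: the image of `κ`, as the quotient of the free algebra
by the kernel of `κ`. -/
abbrev DiskAlg : Type _ := RingQuot fun a b : FreeAlgebra K (Fin 3 × ℤ) =>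
  kappa k q h a = kappa k q h b

/-- The element `E_{i,l} = σ^l Eᵢ` of the composition subalgebra of the disk. -/
def diskArc (i : Fin 3) (l : ℤ) : DiskAlg k q h :=
  RingQuot.mkAlgHom K (fun a b : FreeAlgebra K (Fin 3 × ℤ) => kappa k q h a = kappa k q h b)
    (FreeAlgebra.ι K (i, l))

end Hall

/-! ### Triangulated marked surfaces and their naive algebras -/

/-- A graded marked surface with a full arc system cutting it into triangles, encoded by its
trivalent ribbon graph with foliation data: `V` is the set of triangles, `A` the set of arcs,
`arc v 0, arc v 1, arc v 2` are the sides of `v` in the cyclic order given by the orientation, and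
`fol v i` is the degree of the boundary path in `v` from its side `i` to its side `i + 1`. Each arc
is a side of one triangle (boundary arc) or occurs twice as a side (internal arc). -/
structure TriSurface (V A : Type*) where
  arc : V → Fin 3 → A
  arc_surj : ∀ a, ∃ v i, arc v i = a
  arc_fiber : ∀ a, {p : V × Fin 3 | arc p.1 p.2 = a}.encard ≤ 2
  fol : V → Fin 3 → ℤ
  fol_sum : ∀ v, ∑ i, fol v i = 1

namespace TriSurface

variable {V A : Type*} (S : TriSurface V A)

/-- The marked interval of the triangle `v` between its sides `i` and `i + 1` is denoted `(v, i)`.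
Gluing the side `i` of `v` to the side `j` of `w`, with opposite orientations, joins `(v, i)` to
`(w, j - 1)` (and, exchanging the roles, `(w, j)` to `(v, i - 1)`). -/
def Joined (c c' : V × Fin 3) : Prop :=
  ∃ v i w j, (v, i) ≠ (w, j) ∧ S.arc v i = S.arc w j ∧ c = (v, i) ∧ c' = (w, j - 1)

/-- Two marked intervals of triangles lie in the same marked interval of the surface. -/
def SameInterval : V × Fin 3 → V × Fin 3 → Prop := Relation.EqvGen S.Joined

/-- Side `i` of `v` and side `j` of `w` have end points in a common marked interval. -/
def ShareInterval (v : V) (i : Fin 3) (w : V) (j : Fin 3) : Prop :=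
  S.SameInterval (v, i) (w, j) ∨ S.SameInterval (v, i) (w, j - 1) ∨
    S.SameInterval (v, i - 1) (w, j) ∨ S.SameInterval (v, i - 1) (w, j - 1)

variable [DecidableEq V] (k : Type*) [Field k] {K : Type*} [Field K] (q : K)

/-- The free product of the composition subalgebras of the triangles. -/
abbrev DiskProduct : Type _ := LinearAlgebra.FreeProduct K fun v : V => DiskAlg k q (S.fol v)

/-- The suspended side `σ^l E` of the triangle `v` in the free product. -/
def prodArc (v : V) (i : Fin 3) (l : ℤ) : S.DiskProduct k q :=
  LinearAlgebra.FreeProduct.ι K (fun v : V => DiskAlg k q (S.fol v)) v (diskArc k q (S.fol v) i l)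

/-- The gluing and far-commutativity relations. -/
inductive NaiveRel : S.DiskProduct k q → S.DiskProduct k q → Prop
  | glue (v w : V) (i j : Fin 3) (l : ℤ) (hvw : v ≠ w) (harc : S.arc v i = S.arc w j) :
      NaiveRel (S.prodArc k q v i l) (S.prodArc k q w j l)
  | far (v w : V) (i j : Fin 3) (s t : ℤ) (hvw : v ≠ w) (hfar : ¬ S.ShareInterval v i w j) :
      NaiveRel (S.prodArc k q v i s * S.prodArc k q w j t)
        (S.prodArc k q w j t * S.prodArc k q v i s)

/-- The naive algebra of a triangulated marked surface. -/
abbrev Naive : Type _ := RingQuot (S.NaiveRel k q)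

/-- The suspended side `σ^l E` of the triangle `v` in the naive algebra. -/
def naiveArc (v : V) (i : Fin 3) (l : ℤ) : S.Naive k q :=
  RingQuot.mkAlgHom K (S.NaiveRel k q) (S.prodArc k q v i l)

end TriSurface

/-! ### The annulus `K_{m,n}` -/

/-- The full standard arc system of the annulus. -/
inductive AnnArc (m n : ℕ)
  | S : AnnArc m n
  | T : AnnArc m n
  | P (i : ℕ) (hi : 1 ≤ i ∧ i < m) : AnnArc m n
  | Q (i : ℕ) (hi : 1 ≤ i ∧ i < n) : AnnArc m n
  | E (i : ℕ) (hi : 1 ≤ i ∧ i ≤ m) : AnnArc m n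
  | F (i : ℕ) (hi : 1 ≤ i ∧ i ≤ n) : AnnArc m n

namespace AnnArc

/-- The arcs `P₀ = S, P₁, …, Pₘ₋₁, Pₘ = T`. -/
def P' (m n i : ℕ) : AnnArc m n :=
  if h0 : i = 0 then S else if hi : i < m then P i ⟨Nat.one_le_iff_ne_zero.2 h0, hi⟩ else T

/-- The arcs `Q₀ = S, Q₁, …, Qₙ₋₁, Qₙ = T`. -/
def Q' (m n i : ℕ) : AnnArc m n :=
  if h0 : i = 0 then S else if hi : i < n then Q i ⟨Nat.one_le_iff_ne_zero.2 h0, hi⟩ else T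

end AnnArc

/-- The sides of the triangles `C_j = (P_j, P_{j+1}, E_{j+1})` (for `0 ≤ j < m`) and
`D_i = (Q_i, Q_{i+1}, F_{i+1})` (for `0 ≤ i < n`) of the annulus. -/
def annSide (m n : ℕ) : Fin m ⊕ Fin n → Fin 3 → AnnArc m n
  | Sum.inl j => ![AnnArc.P' m n j, AnnArc.P' m n (j + 1), AnnArc.E (j + 1) ⟨by omega, by omega⟩]
  | Sum.inr i => ![AnnArc.Q' m n i, AnnArc.Q' m n (i + 1), AnnArc.F (i + 1) ⟨by omega, by omega⟩]

/-- The standard foliation data of a triangle: `1` at the boundary arc and `0` at the other sides. -/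
def stdFol : Fin 3 → ℤ := ![0, 0, 1]

theorem annSide_fiber (m n : ℕ) (hm : 1 ≤ m) (hn : 1 ≤ n) (a : AnnArc m n) :
    ∃ x y : (Fin m ⊕ Fin n) × Fin 3, ∀ v i, annSide m n v i = a →
      (v, i) = x ∨ (v, i) = y := by
  have aux : ∀ x y : (Fin m ⊕ Fin n) × Fin 3,
      (∀ j : Fin m, (AnnArc.P' m n j = a → (Sum.inl j, 0) = x ∨ (Sum.inl j, 0) = y) ∧
        (AnnArc.P' m n (j + 1) = a → (Sum.inl j, 1) = x ∨ (Sum.inl j, 1) = y) ∧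
        (AnnArc.E (j + 1) ⟨by omega, by omega⟩ = a → (Sum.inl j, 2) = x ∨ (Sum.inl j, 2) = y)) →
      (∀ j : Fin n, (AnnArc.Q' m n j = a → (Sum.inr j, 0) = x ∨ (Sum.inr j, 0) = y) ∧
        (AnnArc.Q' m n (j + 1) = a → (Sum.inr j, 1) = x ∨ (Sum.inr j, 1) = y) ∧
        (AnnArc.F (j + 1) ⟨by omega, by omega⟩ = a → (Sum.inr j, 2) = x ∨ (Sum.inr j, 2) = y)) →
      ∃ x y : (Fin m ⊕ Fin n) × Fin 3, ∀ v i, annSide m n v i = a →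
        (v, i) = x ∨ (v, i) = y := by
    intro x y h1 h2
    refine ⟨x, y, ?_⟩
    rintro (j | j) i hi
    · fin_cases i
      · exact (h1 j).1 hi
      · exact (h1 j).2.1 hi
      · exact (h1 j).2.2 hi
    · fin_cases i
      · exact (h2 j).1 hi
      · exact (h2 j).2.1 hi
      · exact (h2 j).2.2 hi
  rcases a with _ | _ | ⟨i, hi⟩ | ⟨i, hi⟩ | ⟨i, hi⟩ | ⟨i, hi⟩
  · refine aux (Sum.inl ⟨0, hm⟩, 0) (Sum.inr ⟨0, hn⟩, 0) ?_ ?_ <;> rintro ⟨j, hj⟩ <;>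
      refine ⟨?_, ?_, ?_⟩ <;> simp only [AnnArc.P', AnnArc.Q'] <;> grind
  · refine aux (Sum.inl ⟨m - 1, by omega⟩, 1) (Sum.inr ⟨n - 1, by omega⟩, 1) ?_ ?_ <;>
      rintro ⟨j, hj⟩ <;> refine ⟨?_, ?_, ?_⟩ <;> simp only [AnnArc.P', AnnArc.Q'] <;> grind
  · refine aux (Sum.inl ⟨i, hi.2⟩, 0) (Sum.inl ⟨i - 1, by omega⟩, 1) ?_ ?_ <;>
      rintro ⟨j, hj⟩ <;> refine ⟨?_, ?_, ?_⟩ <;> simp only [AnnArc.P', AnnArc.Q'] <;> grind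
  · refine aux (Sum.inr ⟨i, hi.2⟩, 0) (Sum.inr ⟨i - 1, by omega⟩, 1) ?_ ?_ <;>
      rintro ⟨j, hj⟩ <;> refine ⟨?_, ?_, ?_⟩ <;> simp only [AnnArc.P', AnnArc.Q'] <;> grind
  · refine aux (Sum.inl ⟨i - 1, by omega⟩, 2) (Sum.inl ⟨i - 1, by omega⟩, 2) ?_ ?_ <;>
      rintro ⟨j, hj⟩ <;> refine ⟨?_, ?_, ?_⟩ <;> simp only [AnnArc.P', AnnArc.Q'] <;> grind
  · refine aux (Sum.inr ⟨i - 1, by omega⟩, 2) (Sum.inr ⟨i - 1, by omega⟩, 2) ?_ ?_ <;>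
      rintro ⟨j, hj⟩ <;> refine ⟨?_, ?_, ?_⟩ <;> simp only [AnnArc.P', AnnArc.Q'] <;> grind

/-- The annulus `K_{m,n}` with its full standard arc system and its standard foliation data. -/
def annulus (m n : ℕ) (hm : 1 ≤ m) (hn : 1 ≤ n) : TriSurface (Fin m ⊕ Fin n) (AnnArc m n) where
  arc := annSide m n
  arc_surj := by
    rintro (_ | _ | ⟨i, hi⟩ | ⟨i, hi⟩ | ⟨i, hi⟩ | ⟨i, hi⟩)
    · exact ⟨Sum.inl ⟨0, hm⟩, 0, by simp [annSide, AnnArc.P']⟩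
    · exact ⟨Sum.inl ⟨m - 1, by omega⟩, 1, by
        simp [annSide, AnnArc.P', Nat.sub_add_cancel hm]; omega⟩
    · exact ⟨Sum.inl ⟨i, hi.2⟩, 0, by
        simp [annSide, AnnArc.P', hi.2, Nat.one_le_iff_ne_zero.1 hi.1]⟩
    · exact ⟨Sum.inr ⟨i, hi.2⟩, 0, by
        simp [annSide, AnnArc.Q', hi.2, Nat.one_le_iff_ne_zero.1 hi.1]⟩
    · exact ⟨Sum.inl ⟨i - 1, by omega⟩, 2, by simp [annSide, Nat.sub_add_cancel hi.1]⟩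
    · exact ⟨Sum.inr ⟨i - 1, by omega⟩, 2, by simp [annSide, Nat.sub_add_cancel hi.1]⟩
  arc_fiber := fun a => by
    obtain ⟨x, y, hxy⟩ := annSide_fiber m n hm hn a
    exact (Set.encard_le_encard (t := {x, y}) fun p hp => hxy p.1 p.2 hp).trans
      (Set.encard_insert_le _ _ |>.trans (by rw [Set.encard_singleton]; norm_num))
  fol := fun _ => stdFol
  fol_sum := fun _ => by simp [stdFol, Fin.sum_univ_three]

section Presentation

variable {K : Type*} [Field K]

/-- The `c`-commutator `[x, y]_c = xy - c yx`. -/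
def qBracket {B : Type*} [Ring B] [Algebra K B] (c : K) (x y : B) : B := x * y - c • (y * x)

variable (q : K) (m n : ℕ)

/-- The generator `σ^l X`. -/
def arcGen (X : AnnArc m n) (l : ℤ) : FreeAlgebra K (AnnArc m n × ℤ) := FreeAlgebra.ι K (X, l)

/-- The relations of the explicit presentation. -/
inductive AnnRel : FreeAlgebra K (AnnArc m n × ℤ) → FreeAlgebra K (AnnArc m n × ℤ) → Prop
  -- (R1) for the sides of each triangle, and its suspensions
  | selfExt (v : Fin m ⊕ Fin n) (i : Fin 3) (k l : ℤ) (hk : 1 ≤ k) :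
      AnnRel (qBracket (q ^ (2 * (k.negOnePow : ℤ)))
          (arcGen m n (annSide m n v i) l) (arcGen m n (annSide m n v i) (k + l)))
        (if k = 1 then algebraMap K _ (q⁻¹ / (q ^ 2 - 1)) else 0)
  -- (R2) for consecutive sides of each triangle, and its suspensions
  | adjPos (v : Fin m ⊕ Fin n) (i : Fin 3) (k l : ℤ) (hk : 1 ≤ k) :
      AnnRel (qBracket (q ^ ((k + 1).negOnePow : ℤ))
          (arcGen m n (annSide m n v (i + 1)) (k + l))
          (arcGen m n (annSide m n v i) (stdFol i + l)))
        (if k = 1 then arcGen m n (annSide m n v (i + 2)) (1 - stdFol (i + 1) + l) else 0)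
  | adjNonpos (v : Fin m ⊕ Fin n) (i : Fin 3) (k l : ℤ) (hk : k < 1) :
      AnnRel (qBracket (q ^ (k.negOnePow : ℤ))
          (arcGen m n (annSide m n v (i + 1)) (k + l))
          (arcGen m n (annSide m n v i) (stdFol i + l))) 0
  -- commutativity: `S` and `T` arcs
  | SE (k : ℕ) (hk) (s t : ℤ) (h : 1 < k ∧ k < m) :
      AnnRel (qBracket (1 : K) (arcGen m n AnnArc.S s) (arcGen m n (AnnArc.E k hk) t)) 0
  | TE (k : ℕ) (hk) (s t : ℤ) (h : 1 < k ∧ k < m) :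
      AnnRel (qBracket (1 : K) (arcGen m n AnnArc.T s) (arcGen m n (AnnArc.E k hk) t)) 0
  | SF (k : ℕ) (hk) (s t : ℤ) (h : 1 < k ∧ k < n) :
      AnnRel (qBracket (1 : K) (arcGen m n AnnArc.S s) (arcGen m n (AnnArc.F k hk) t)) 0
  | TF (k : ℕ) (hk) (s t : ℤ) (h : 1 < k ∧ k < n) :
      AnnRel (qBracket (1 : K) (arcGen m n AnnArc.T s) (arcGen m n (AnnArc.F k hk) t)) 0
  -- commutativity: `P` and `Q` arcs
  | PE (i k : ℕ) (hi hk) (s t : ℤ) (h : k ≠ i ∧ k ≠ i + 1) :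
      AnnRel (qBracket (1 : K) (arcGen m n (AnnArc.P i hi) s) (arcGen m n (AnnArc.E k hk) t)) 0
  | PF (i k : ℕ) (hi hk) (s t : ℤ) (h : k ≠ 1 ∧ k ≠ n) :
      AnnRel (qBracket (1 : K) (arcGen m n (AnnArc.P i hi) s) (arcGen m n (AnnArc.F k hk) t)) 0
  | QF (i k : ℕ) (hi hk) (s t : ℤ) (h : k ≠ i ∧ k ≠ i + 1) :
      AnnRel (qBracket (1 : K) (arcGen m n (AnnArc.Q i hi) s) (arcGen m n (AnnArc.F k hk) t)) 0
  | QE (i k : ℕ) (hi hk) (s t : ℤ) (h : k ≠ 1 ∧ k ≠ m) :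
      AnnRel (qBracket (1 : K) (arcGen m n (AnnArc.Q i hi) s) (arcGen m n (AnnArc.E k hk) t)) 0
  | PQ (i k : ℕ) (hi hk) (s t : ℤ) :
      AnnRel (qBracket (1 : K) (arcGen m n (AnnArc.P i hi) s) (arcGen m n (AnnArc.Q k hk) t)) 0
  -- commutativity: boundary arcs
  | EE (i j : ℕ) (hi hj) (s t : ℤ)
      (h : (j : ZMod m) ≠ i - 1 ∧ (j : ZMod m) ≠ i ∧ (j : ZMod m) ≠ i + 1) :
      AnnRel (qBracket (1 : K) (arcGen m n (AnnArc.E i hi) s) (arcGen m n (AnnArc.E j hj) t)) 0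
  | FF (i j : ℕ) (hi hj) (s t : ℤ)
      (h : (j : ZMod n) ≠ i - 1 ∧ (j : ZMod n) ≠ i ∧ (j : ZMod n) ≠ i + 1) :
      AnnRel (qBracket (1 : K) (arcGen m n (AnnArc.F i hi) s) (arcGen m n (AnnArc.F j hj) t)) 0
  | EF (i j : ℕ) (hi hj) (s t : ℤ) :
      AnnRel (qBracket (1 : K) (arcGen m n (AnnArc.E i hi) s) (arcGen m n (AnnArc.F j hj) t)) 0

/-- The algebra given by the explicit presentation. -/
abbrev AnnPres : Type _ := RingQuot (AnnRel q m n)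

/-- The image of the generator `σ^l X` in the presented algebra. -/
def presArc (X : AnnArc m n) (l : ℤ) : AnnPres q m n :=
  RingQuot.mkAlgHom K (AnnRel q m n) (arcGen m n X l)

end Presentation

end FukayaHall

end

/-! # The naive algebra of the annulus: proof of the presentation -/

noncomputable section

namespace FukayaHall

/-! ### Signs -/

/-! The substance is a presentation of the algebra of one disk; the annulus then follows formally.

Give the shifted arc `Eᵢ[s]` the number `3s + i`. For `h = (0, 0, 1)` there is then a degree zero
morphism `E_j → E_{j+1}` for every integer `j`, one has `E_{j+3} ≅ E_j[1]`, and three consecutive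
arcs form an exact triangle: two consecutive morphisms compose to zero, while `μ₃` of three of them
is a nonzero multiple of an identity. Let `b_j` be the rank of `Hom(E_j, L) → Hom(E_{j-1}, L)`.
Exactness gives `dim Hom(E_j, L) = b_j + b_{j+1}`, and `L` is isomorphic to the sum of the arcs
`E_j` with multiplicities `b_j` (`Tw.iso_std`). So the Hall algebra has the finitely supported
functions `ℤ → ℕ` as a basis.

The cone of `ξ : E_j → L` is determined by whether `ξ` and its restriction to `E_{j-1}` vanish
(`Tw.IsCone.multFinsupp_eq`). This gives all structure constants with an arc as left factor
(`Tw.toen_eq`). After rescaling the basis by quantum factorials, left multiplication by `E_j`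
becomes a sum `arcAct` of three weighted translations: one adds `E_j`, one replaces `E_{j+2}` by
`E_{j+1}`, one removes `E_{j+3}` (`hallMap_mulBasis`).

In the opposite algebra these operators obey the rules `IsArcFamily`: two arcs commute up to a power
of `q`, with a linear correction at distance two and a scalar one at distance three. The rules
rewrite every word as a combination of increasing words. Increasing words applied to the class of
the zero object give nonzero multiples of distinct basis vectors. Hence the rules are a complete set
of relations for the disk algebra (`lift_eq_zero_of_apply_eq_zero`, `diskLift`). After the change of
sign `X ↦ -X`, which only affects the linear correction, they are exactly (R1) and (R2)
(`triangleRel_iff`).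

For the annulus, each corner of a triangle is labelled by the marked interval containing it, and
joined corners are exactly those with equal labels. Being distant therefore depends only on the two
arcs and means that their sets `AnnArc.ends` are disjoint (`not_shareInterval_iff`). Going through
the pairs of arcs recovers the list (a)–(c) (`commute_presArc`). Both algebras thus have the same
universal property, and the two induced homomorphisms are mutually inverse. -/

/-- The sign of a parity. -/
def parSign (n : ZMod 2) : ℤ := if n = 0 then 1 else -1

theorem parSign_add (a b : ZMod 2) : parSign (a + b) = parSign a * parSign b := by
  revert a b; decide

theorem negOnePow_eq_parSign (n : ℤ) : ((n.negOnePow : ℤˣ) : ℤ) = parSign (n : ZMod 2) := by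
  rcases Int.even_or_odd n with hn | hn
  · rw [Int.negOnePow_even n hn]
    have : (n : ZMod 2) = 0 := (ZMod.intCast_zmod_eq_zero_iff_dvd n 2).2 (by exact_mod_cast hn.two_dvd)
    simp [parSign, this]
  · rw [Int.negOnePow_odd n hn]
    obtain ⟨m, rfl⟩ := hn
    have : ((2 * m + 1 : ℤ) : ZMod 2) = 1 := by
      push_cast
      rw [show (2 : ZMod 2) = 0 from rfl]; simp
    simp [parSign, this]

section
variable {k : Type*} [Field k]

theorem sgn_eq_parSign (n : ℤ) : sgn k n = ((parSign (n : ZMod 2) : ℤ) : k) := by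
  rw [sgn, negOnePow_eq_parSign]

@[simp] theorem sgn_zero : sgn k 0 = 1 := by simp [sgn]

@[simp] theorem sgn_one : sgn k 1 = -1 := by simp [sgn]

theorem sgn_add (a b : ℤ) : sgn k (a + b) = sgn k a * sgn k b := by
  simp [sgn, Int.negOnePow_add]

theorem sgn_mul_self (a : ℤ) : sgn k a * sgn k a = 1 := by
  rw [← sgn_add, sgn, Int.negOnePow_even _ (Even.add_self a)]; simp

theorem sgn_ne_zero (a : ℤ) : sgn k a ≠ 0 := fun h => by
  have := sgn_mul_self (k := k) a
  simp [h] at this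

theorem sgn_mul_sgn_mul (a : ℤ) (x : k) : sgn k a * (sgn k a * x) = x := by
  rw [← mul_assoc, sgn_mul_self, one_mul]

end

/-- The parity of the degree of a boundary path. -/
def pathPar (i j : Fin 3) : ZMod 2 := if j = i then 0 else if i = 2 then 1 else 0

theorem pathDeg_cast (i j : Fin 3) : ((pathDeg stdFol i j : ℤ) : ZMod 2) = pathPar i j := by
  fin_cases i <;> fin_cases j <;> simp [pathDeg, pathPar, stdFol]

/-- The structure constant of `μ₂` for the standard foliation data, in computable form. -/
def stdMu2 (i j l : Fin 3) : ℤ :=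
  if (j = i ∧ IsPath j l) ∨ (l = j ∧ IsPath i j) then parSign (pathPar i j) else 0

theorem fukMu2_std (i j l : Fin 3) : fukMu2 stdFol i j l = stdMu2 i j l := by
  unfold fukMu2 stdMu2
  split_ifs
  · rw [negOnePow_eq_parSign, pathDeg_cast]
  · rfl

/-- The coefficient of `μ₂` on the additive enlargement. -/
def coefTwo (i j l : Fin 3) (si sj : ZMod 2) : ℤ :=
  stdMu2 i j l * parSign ((si - sj) * (pathPar j l - 1))

/-- The coefficient of `μ₃` on the additive enlargement. -/
def coefThree (i j l r : Fin 3) (si sj sl : ZMod 2) : ℤ :=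
  fukMu3 i j l r * parSign ((si - sj) * (pathPar j l - 1) + (si - sj) * (pathPar l r - 1)
    + (sj - sl) * (pathPar l r - 1))

/-- All signs depend only on the arcs and on the parities of the shifts, so each `A_∞`-relation
reduces to finitely many integer identities, checked by enumeration. -/
theorem coefTwo_assoc : ∀ (x y z w : Fin 3) (sx sy sz : ZMod 2),
    coefTwo x y w sx sy * coefTwo y z w sy sz =
      parSign (pathPar x y + sx - sy) * (coefTwo x z w sx sz * coefTwo x y z sx sy) := by
  decide

/-- An inner `μ₃` produces a trivial path, and `μ₃` vanishes when one of its inputs is trivial. So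
all three nestings of `μ₃` in `μ₃` are zero. -/
theorem coefThree_comp_left : ∀ (x y z w u v : Fin 3) (sx sy sz sw su : ZMod 2),
    coefThree x y z v sx sy sz * coefThree z w u v sz sw su = 0 := by
  intro x y z w u v sx sy sz sw su
  have : fukMu3 x y z v * fukMu3 z w u v = 0 := by revert x y z w u v; decide
  rw [coefThree, coefThree, mul_mul_mul_comm, this, zero_mul]

theorem coefThree_comp_mid : ∀ (x y z w u v : Fin 3) (sx sy sz sw su : ZMod 2),
    coefThree x y u v sx sy su * coefThree y z w u sy sz sw = 0 := by
  intro x y z w u v sx sy sz sw su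
  have : fukMu3 x y u v * fukMu3 y z w u = 0 := by revert x y z w u v; decide
  rw [coefThree, coefThree, mul_mul_mul_comm, this, zero_mul]

theorem coefThree_comp_right : ∀ (x y z w u v : Fin 3) (sx sy sz sw su : ZMod 2),
    coefThree x w u v sx sw su * coefThree x y z w sx sy sz = 0 := by
  intro x y z w u v sx sy sz sw su
  have : fukMu3 x w u v * fukMu3 x y z w = 0 := by revert x y z w u v; decide
  rw [coefThree, coefThree, mul_mul_mul_comm, this, zero_mul]

-- The relation with four inputs, the only one in which `μ₂` and `μ₃` interact.
set_option maxRecDepth 100000 in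
set_option maxHeartbeats 4000000 in
theorem coef_mixed : ∀ (x y z w v : Fin 3) (sx sy sz sw : ZMod 2),
    parSign (pathPar x y + sx - sy - 1) * (coefTwo x y v sx sy * coefThree y z w v sy sz sw)
    + coefTwo x w v sx sw * coefThree x y z w sx sy sz
    + parSign (pathPar x y + sx - sy + (pathPar y z + sy - sz)) *
      (coefThree x y z v sx sy sz * coefTwo z w v sz sw)
    + parSign (pathPar x y + sx - sy - 1) * (coefThree x y w v sx sy sw * coefTwo y z w sy sz)
    + coefThree x z w v sx sz sw * coefTwo x y z sx sy = 0 := by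
  decide

/-! ### The operations `μ₂` and `μ₃` on the additive enlargement. -/

section Operations
variable {k : Type*} [Field k] {P Q R T U W : ShiftedSum}

theorem mu2_std_apply (g : Mor k Q R) (f : Mor k P Q) (x z) :
    mu2 stdFol g f x z = ∑ y, ((coefTwo (P.arc x) (Q.arc y) (R.arc z) (P.shift x) (Q.shift y) : ℤ) : k)
      * (g y z * f x y) := by
  simp only [mu2, coefTwo, sgn_eq_parSign, fukMu2_std]
  push_cast
  simp only [pathDeg_cast]

theorem mu3_std_apply (e : Mor k R T) (g : Mor k Q R) (f : Mor k P Q) (x w) :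
    mu3 stdFol e g f x w = ∑ y, ∑ z,
      ((coefThree (P.arc x) (Q.arc y) (R.arc z) (T.arc w) (P.shift x) (Q.shift y) (R.shift z) : ℤ) : k)
      * (e z w * (g y z * f x y)) := by
  simp only [mu3, coefThree, sgn_eq_parSign]
  push_cast
  simp only [pathDeg_cast]

/-! #### Multilinearity -/

variable (h : Fin 3 → ℤ)

theorem mu2_add_left (g g' : Mor k Q R) (f : Mor k P Q) :
    mu2 h (g + g') f = mu2 h g f + mu2 h g' f := by
  ext x z; simp only [mu2, Matrix.add_apply, mul_add, add_mul, Finset.sum_add_distrib]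

theorem mu2_add_right (g : Mor k Q R) (f f' : Mor k P Q) :
    mu2 h g (f + f') = mu2 h g f + mu2 h g f' := by
  ext x z; simp only [mu2, Matrix.add_apply, mul_add, Finset.sum_add_distrib]

theorem mu2_smul_left (c : k) (g : Mor k Q R) (f : Mor k P Q) :
    mu2 h (c • g) f = c • mu2 h g f := by
  ext x z
  simp only [mu2, Matrix.smul_apply, smul_eq_mul, Finset.mul_sum]
  exact Finset.sum_congr rfl fun _ _ => by ring

theorem mu2_smul_right (c : k) (g : Mor k Q R) (f : Mor k P Q) :
    mu2 h g (c • f) = c • mu2 h g f := by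
  ext x z
  simp only [mu2, Matrix.smul_apply, smul_eq_mul, Finset.mul_sum]
  exact Finset.sum_congr rfl fun _ _ => by ring

theorem mu3_add_left (e e' : Mor k R T) (g : Mor k Q R) (f : Mor k P Q) :
    mu3 h (e + e') g f = mu3 h e g f + mu3 h e' g f := by
  ext x z; simp only [mu3, Matrix.add_apply, mul_add, add_mul, Finset.sum_add_distrib]

theorem mu3_add_mid (e : Mor k R T) (g g' : Mor k Q R) (f : Mor k P Q) :
    mu3 h e (g + g') f = mu3 h e g f + mu3 h e g' f := by
  ext x z; simp only [mu3, Matrix.add_apply, mul_add, add_mul, Finset.sum_add_distrib]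

theorem mu3_add_right (e : Mor k R T) (g : Mor k Q R) (f f' : Mor k P Q) :
    mu3 h e g (f + f') = mu3 h e g f + mu3 h e g f' := by
  ext x z; simp only [mu3, Matrix.add_apply, mul_add, Finset.sum_add_distrib]

theorem mu3_smul_left (c : k) (e : Mor k R T) (g : Mor k Q R) (f : Mor k P Q) :
    mu3 h (c • e) g f = c • mu3 h e g f := by
  ext x z
  simp only [mu3, Matrix.smul_apply, smul_eq_mul, Finset.mul_sum]
  exact Finset.sum_congr rfl fun _ _ => Finset.sum_congr rfl fun _ _ => by ring

theorem mu3_smul_mid (c : k) (e : Mor k R T) (g : Mor k Q R) (f : Mor k P Q) :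
    mu3 h e (c • g) f = c • mu3 h e g f := by
  ext x z
  simp only [mu3, Matrix.smul_apply, smul_eq_mul, Finset.mul_sum]
  exact Finset.sum_congr rfl fun _ _ => Finset.sum_congr rfl fun _ _ => by ring

theorem mu3_smul_right (c : k) (e : Mor k R T) (g : Mor k Q R) (f : Mor k P Q) :
    mu3 h e g (c • f) = c • mu3 h e g f := by
  ext x z
  simp only [mu3, Matrix.smul_apply, smul_eq_mul, Finset.mul_sum]
  exact Finset.sum_congr rfl fun _ _ => Finset.sum_congr rfl fun _ _ => by ring

@[simp] theorem mu2_zero_left (f : Mor k P Q) : mu2 h (0 : Mor k Q R) f = 0 := by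
  ext x z; simp [mu2]

@[simp] theorem mu2_zero_right (g : Mor k Q R) : mu2 h g (0 : Mor k P Q) = 0 := by
  ext x z; simp [mu2]

@[simp] theorem mu3_zero_left (g : Mor k Q R) (f : Mor k P Q) :
    mu3 h (0 : Mor k R T) g f = 0 := by ext x z; simp [mu3]

@[simp] theorem mu3_zero_mid (e : Mor k R T) (f : Mor k P Q) :
    mu3 h e (0 : Mor k Q R) f = 0 := by ext x z; simp [mu3]

@[simp] theorem mu3_zero_right (e : Mor k R T) (g : Mor k Q R) :
    mu3 h e g (0 : Mor k P Q) = 0 := by ext x z; simp [mu3]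

variable {h}

/-! #### The `A_∞`-relations -/

/-- A single nonzero entry determines the degree, so the sign of a homogeneous morphism can be
computed at that entry. -/
theorem sgn_of_mem_homDeg {f : Mor k P Q} {n : ℤ} (hf : f ∈ homDeg stdFol P Q n) {x y}
    (hxy : f x y ≠ 0) :
    sgn k n = ((parSign (pathPar (P.arc x) (Q.arc y) + P.shift x - Q.shift y) : ℤ) : k) := by
  have h2 : n = pathDeg stdFol (P.arc x) (Q.arc y) + P.shift x - Q.shift y := by
    have := (hf x y hxy).2; omega
  rw [sgn_eq_parSign, h2]
  push_cast
  rw [pathDeg_cast]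

theorem mu2_mu2 {c : Mor k R T} {b : Mor k Q R} {a : Mor k P Q} {n : ℤ}
    (ha : a ∈ homDeg stdFol P Q n) :
    mu2 stdFol (mu2 stdFol c b) a = sgn k n • mu2 stdFol c (mu2 stdFol b a) := by
  ext x w
  simp only [mu2_std_apply, Matrix.smul_apply, smul_eq_mul, Finset.mul_sum, Finset.sum_mul]
  rw [Finset.sum_comm]
  refine Finset.sum_congr rfl fun z _ => Finset.sum_congr rfl fun y _ => ?_
  by_cases hxy : a x y = 0
  · simp [hxy]
  · rw [sgn_of_mem_homDeg ha hxy]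
    have := coefTwo_assoc (P.arc x) (Q.arc y) (R.arc z) (T.arc w) (P.shift x) (Q.shift y)
      (R.shift z)
    have := congrArg (Int.cast : ℤ → k) this
    push_cast at this
    linear_combination (c z w * b y z * a x y) * this

theorem mu3_mu3_left (e : Mor k U W) (d : Mor k T U) (c : Mor k R T) (b : Mor k Q R)
    (a : Mor k P Q) : mu3 stdFol (mu3 stdFol e d c) b a = 0 := by
  ext x v
  simp only [mu3_std_apply, Matrix.zero_apply, Finset.mul_sum, Finset.sum_mul]
  refine Finset.sum_eq_zero fun y _ => Finset.sum_eq_zero fun z _ => Finset.sum_eq_zero fun w _ =>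
    Finset.sum_eq_zero fun u _ => ?_
  have := coefThree_comp_left (P.arc x) (Q.arc y) (R.arc z) (T.arc w) (U.arc u) (W.arc v)
    (P.shift x) (Q.shift y) (R.shift z) (T.shift w) (U.shift u)
  have := congrArg (Int.cast : ℤ → k) this
  push_cast at this
  linear_combination (e u v * d w u * c z w * b y z * a x y) * this

theorem mu3_mu3_mid (e : Mor k U W) (d : Mor k T U) (c : Mor k R T) (b : Mor k Q R)
    (a : Mor k P Q) : mu3 stdFol e (mu3 stdFol d c b) a = 0 := by
  ext x v
  simp only [mu3_std_apply, Matrix.zero_apply, Finset.mul_sum, Finset.sum_mul]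
  refine Finset.sum_eq_zero fun y _ => Finset.sum_eq_zero fun u _ => Finset.sum_eq_zero fun z _ =>
    Finset.sum_eq_zero fun w _ => ?_
  have := coefThree_comp_mid (P.arc x) (Q.arc y) (R.arc z) (T.arc w) (U.arc u) (W.arc v)
    (P.shift x) (Q.shift y) (R.shift z) (T.shift w) (U.shift u)
  have := congrArg (Int.cast : ℤ → k) this
  push_cast at this
  linear_combination (e u v * d w u * c z w * b y z * a x y) * this

theorem mu3_mu3_right (e : Mor k U W) (d : Mor k T U) (c : Mor k R T) (b : Mor k Q R)
    (a : Mor k P Q) : mu3 stdFol e d (mu3 stdFol c b a) = 0 := by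
  ext x v
  simp only [mu3_std_apply, Matrix.zero_apply, Finset.mul_sum]
  refine Finset.sum_eq_zero fun w _ => Finset.sum_eq_zero fun u _ => Finset.sum_eq_zero fun y _ =>
    Finset.sum_eq_zero fun z _ => ?_
  have := coefThree_comp_right (P.arc x) (Q.arc y) (R.arc z) (T.arc w) (U.arc u) (W.arc v)
    (P.shift x) (Q.shift y) (R.shift z) (T.shift w) (U.shift u)
  have := congrArg (Int.cast : ℤ → k) this
  push_cast at this
  linear_combination (e u v * d w u * c z w * b y z * a x y) * this

/-- Each of the five composites is rewritten as a sum over the same intermediate summands `y`, `z`,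
`w`; the relation then holds term by term by `coef_mixed`. -/
theorem mu2_mu3_relation {d : Mor k T U} {c : Mor k R T} {b : Mor k Q R} {a : Mor k P Q} {n m : ℤ}
    (ha : a ∈ homDeg stdFol P Q n) (hb : b ∈ homDeg stdFol Q R m) :
    - (sgn k n • mu2 stdFol (mu3 stdFol d c b) a) + mu2 stdFol d (mu3 stdFol c b a)
    + (sgn k n * sgn k m) • mu3 stdFol (mu2 stdFol d c) b a
    - sgn k n • mu3 stdFol d (mu2 stdFol c b) a + mu3 stdFol d c (mu2 stdFol b a) = 0 := by
  ext x v
  have e1 : mu2 stdFol (mu3 stdFol d c b) a x v = ∑ y, ∑ z, ∑ w,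
      ((coefTwo (P.arc x) (Q.arc y) (U.arc v) (P.shift x) (Q.shift y) : ℤ) : k) *
      ((coefThree (Q.arc y) (R.arc z) (T.arc w) (U.arc v) (Q.shift y) (R.shift z) (T.shift w) : ℤ) : k)
        * (d w v * c z w * b y z * a x y) := by
    simp only [mu2_std_apply, mu3_std_apply, Finset.mul_sum, Finset.sum_mul]
    exact Finset.sum_congr rfl fun y _ => Finset.sum_congr rfl fun z _ =>
      Finset.sum_congr rfl fun w _ => by ring
  have e2 : mu2 stdFol d (mu3 stdFol c b a) x v = ∑ y, ∑ z, ∑ w,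
      ((coefTwo (P.arc x) (T.arc w) (U.arc v) (P.shift x) (T.shift w) : ℤ) : k) *
      ((coefThree (P.arc x) (Q.arc y) (R.arc z) (T.arc w) (P.shift x) (Q.shift y) (R.shift z) : ℤ) : k)
        * (d w v * c z w * b y z * a x y) := by
    simp only [mu2_std_apply, mu3_std_apply, Finset.mul_sum]
    rw [Finset.sum_comm]
    refine Finset.sum_congr rfl fun y _ => ?_
    rw [Finset.sum_comm]
    exact Finset.sum_congr rfl fun z _ => Finset.sum_congr rfl fun w _ => by ring
  have e3 : mu3 stdFol (mu2 stdFol d c) b a x v = ∑ y, ∑ z, ∑ w,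
      ((coefThree (P.arc x) (Q.arc y) (R.arc z) (U.arc v) (P.shift x) (Q.shift y) (R.shift z) : ℤ) : k)
      * ((coefTwo (R.arc z) (T.arc w) (U.arc v) (R.shift z) (T.shift w) : ℤ) : k)
        * (d w v * c z w * b y z * a x y) := by
    simp only [mu2_std_apply, mu3_std_apply, Finset.mul_sum, Finset.sum_mul]
    exact Finset.sum_congr rfl fun y _ => Finset.sum_congr rfl fun z _ =>
      Finset.sum_congr rfl fun w _ => by ring
  have e4 : mu3 stdFol d (mu2 stdFol c b) a x v = ∑ y, ∑ z, ∑ w,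
      ((coefThree (P.arc x) (Q.arc y) (T.arc w) (U.arc v) (P.shift x) (Q.shift y) (T.shift w) : ℤ) : k)
      * ((coefTwo (Q.arc y) (R.arc z) (T.arc w) (Q.shift y) (R.shift z) : ℤ) : k)
        * (d w v * c z w * b y z * a x y) := by
    simp only [mu2_std_apply, mu3_std_apply, Finset.mul_sum, Finset.sum_mul]
    refine Finset.sum_congr rfl fun y _ => ?_
    rw [Finset.sum_comm]
    exact Finset.sum_congr rfl fun z _ => Finset.sum_congr rfl fun w _ => by ring
  have e5 : mu3 stdFol d c (mu2 stdFol b a) x v = ∑ y, ∑ z, ∑ w,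
      ((coefThree (P.arc x) (R.arc z) (T.arc w) (U.arc v) (P.shift x) (R.shift z) (T.shift w) : ℤ) : k)
      * ((coefTwo (P.arc x) (Q.arc y) (R.arc z) (P.shift x) (Q.shift y) : ℤ) : k)
        * (d w v * c z w * b y z * a x y) := by
    simp only [mu2_std_apply, mu3_std_apply, Finset.mul_sum]
    calc _ = ∑ z, ∑ y, ∑ w, _ := Finset.sum_congr rfl fun z _ => Finset.sum_comm
      _ = _ := by
        rw [Finset.sum_comm]
        exact Finset.sum_congr rfl fun y _ => Finset.sum_congr rfl fun z _ =>
          Finset.sum_congr rfl fun w _ => by ring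
  simp only [Matrix.add_apply, Matrix.sub_apply, Matrix.neg_apply, Matrix.smul_apply, smul_eq_mul,
    Matrix.zero_apply, e1, e2, e3, e4, e5, Finset.mul_sum, ← Finset.sum_neg_distrib,
    ← Finset.sum_add_distrib, ← Finset.sum_sub_distrib]
  refine Finset.sum_eq_zero fun y _ => Finset.sum_eq_zero fun z _ => Finset.sum_eq_zero fun w _ => ?_
  by_cases hxy : a x y = 0
  · simp [hxy]
  by_cases hyz : b y z = 0
  · simp [hyz]
  rw [sgn_of_mem_homDeg ha hxy, sgn_of_mem_homDeg hb hyz]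
  have := coef_mixed (P.arc x) (Q.arc y) (R.arc z) (T.arc w) (U.arc v) (P.shift x) (Q.shift y)
    (R.shift z) (T.shift w)
  -- The signs of `a` and `b` are separated, and the sign of the reduced degree of `a` becomes minus
  -- the sign of its degree.
  rw [parSign_add _ (pathPar _ _ + _ - _), sub_eq_add_neg _ (1 : ZMod 2), parSign_add,
    show parSign (-1) = -1 from rfl] at this
  have := congrArg (Int.cast : ℤ → k) this
  push_cast at this
  linear_combination (d w v * c z w * b y z * a x y) * this

/-! #### Degrees -/

theorem mu2_mem {g : Mor k Q R} {f : Mor k P Q} {m n : ℤ} (hg : g ∈ homDeg stdFol Q R m)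
    (hf : f ∈ homDeg stdFol P Q n) : mu2 stdFol g f ∈ homDeg stdFol P R (m + n) := by
  intro x z hxz
  obtain ⟨y, -, hy⟩ := Finset.exists_ne_zero_of_sum_ne_zero hxz
  have hgy : g y z ≠ 0 := fun h0 => hy (by simp [h0])
  have hfy : f x y ≠ 0 := fun h0 => hy (by simp [h0])
  have hc : fukMu2 stdFol (P.arc x) (Q.arc y) (R.arc z) ≠ 0 := fun h0 => hy (by simp [h0])
  have key : ∀ i j l : Fin 3, stdMu2 i j l ≠ 0 → IsPath i l ∧
      pathDeg stdFol i l = pathDeg stdFol i j + pathDeg stdFol j l := by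
    intro i j l
    unfold stdMu2
    split_ifs with h1
    · intro _
      rcases h1 with ⟨rfl, h2⟩ | ⟨rfl, h2⟩
      · exact ⟨h2, by simp [pathDeg]⟩
      · exact ⟨h2, by simp [pathDeg]⟩
    · simp
  obtain ⟨h1, h2⟩ := key _ _ _ (by rwa [fukMu2_std] at hc)
  refine ⟨h1, ?_⟩
  have := (hg y z hgy).2
  have := (hf x y hfy).2
  omega

theorem mu3_mem {e : Mor k R T} {g : Mor k Q R} {f : Mor k P Q} {l m n r : ℤ}
    (he : e ∈ homDeg stdFol R T l) (hg : g ∈ homDeg stdFol Q R m)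
    (hf : f ∈ homDeg stdFol P Q n) (hr : r + 1 = l + m + n) :
    mu3 stdFol e g f ∈ homDeg stdFol P T r := by
  intro x w hxw
  obtain ⟨y, -, hy⟩ := Finset.exists_ne_zero_of_sum_ne_zero hxw
  obtain ⟨z, -, hz⟩ := Finset.exists_ne_zero_of_sum_ne_zero hy
  have hez : e z w ≠ 0 := fun h0 => hz (by simp [h0])
  have hgy : g y z ≠ 0 := fun h0 => hz (by simp [h0])
  have hfy : f x y ≠ 0 := fun h0 => hz (by simp [h0])
  have hc : fukMu3 (P.arc x) (Q.arc y) (R.arc z) (T.arc w) ≠ 0 := fun h0 => hz (by simp [h0])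
  have key : ∀ i j l r : Fin 3, fukMu3 i j l r ≠ 0 → IsPath i r ∧ pathDeg stdFol i r + 1 =
      pathDeg stdFol i j + pathDeg stdFol j l + pathDeg stdFol l r := by
    decide
  obtain ⟨h1, h2⟩ := key _ _ _ _ hc
  refine ⟨h1, ?_⟩
  have := (he z w hez).2
  have := (hg y z hgy).2
  have := (hf x y hfy).2
  omega

end Operations

theorem sgn_eq_one_or (k : Type*) [Field k] (n : ℤ) : sgn k n = 1 ∨ sgn k n = -1 := by
  rcases Int.even_or_odd n with hn | hn
  · left; rw [sgn, Int.negOnePow_even n hn]; simp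
  · right; rw [sgn, Int.negOnePow_odd n hn]; simp

/-! ### The differential and the composition of twisted complexes. -/

namespace Tw

variable {k : Type*} [Field k] {X Y Z W V : Tw k stdFol}

/-- Morphisms between the sums of shifted arcs underlying two twisted complexes. -/
abbrev Hom (X Y : Tw k stdFol) := Mor k X.toShiftedSum Y.toShiftedSum

/-- Morphisms of degree `n` between twisted complexes. -/
abbrev homOf (X Y : Tw k stdFol) (n : ℤ) : Submodule k (Hom X Y) :=
  homDeg stdFol X.toShiftedSum Y.toShiftedSum n

/-- The composition of twisted complexes with explicit objects. -/
abbrev cmp (X Y Z : Tw k stdFol) (g : Hom Y Z) (f : Hom X Y) : Hom X Z :=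
  comp (X := X) (Y := Y) (Z := Z) g f

theorem mu2_δ_δ (X : Tw k stdFol) : mu2 stdFol X.δ X.δ = -mu3 stdFol X.δ X.δ X.δ :=
  eq_neg_of_add_eq_zero_left X.mc

theorem d_apply (f : Hom X Y) : d X Y f = mu2 stdFol Y.δ f + mu2 stdFol f X.δ +
    mu3 stdFol Y.δ Y.δ f + mu3 stdFol Y.δ f X.δ + mu3 stdFol f X.δ X.δ := rfl

theorem comp_eq (g : Hom Y Z) (f : Hom X Y) : comp (X := X) (Y := Y) (Z := Z) g f =
    mu2 stdFol g f + mu3 stdFol Z.δ g f + mu3 stdFol g Y.δ f + mu3 stdFol g f X.δ := rfl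

section
variable {P Q R T : ShiftedSum}

theorem mu2_neg_left (g : Mor k Q R) (f : Mor k P Q) :
    mu2 stdFol (-g) f = -mu2 stdFol g f := by
  rw [← neg_one_smul k, mu2_smul_left, neg_one_smul]

theorem mu2_neg_right (g : Mor k Q R) (f : Mor k P Q) :
    mu2 stdFol g (-f) = -mu2 stdFol g f := by
  rw [← neg_one_smul k, mu2_smul_right, neg_one_smul]

theorem mu3_neg_left (e : Mor k R T) (g : Mor k Q R) (f : Mor k P Q) :
    mu3 stdFol (-e) g f = -mu3 stdFol e g f := by
  rw [← neg_one_smul k, mu3_smul_left, neg_one_smul]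

theorem mu3_neg_mid (e : Mor k R T) (g : Mor k Q R) (f : Mor k P Q) :
    mu3 stdFol e (-g) f = -mu3 stdFol e g f := by
  rw [← neg_one_smul k, mu3_smul_mid, neg_one_smul]

theorem mu3_neg_right (e : Mor k R T) (g : Mor k Q R) (f : Mor k P Q) :
    mu3 stdFol e g (-f) = -mu3 stdFol e g f := by
  rw [← neg_one_smul k, mu3_smul_right, neg_one_smul]

end

/-- Sum of the `A_∞`-relations for `f` with copies of `δ` on either side. The Maurer–Cartan equation
replaces `μ₂(δ, δ)` by `-μ₃(δ, δ, δ)`, and nested `μ₃` vanish. -/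
theorem d_d {f : Hom X Y} {n : ℤ} (hf : f ∈ homOf X Y n) : d X Y (d X Y f) = 0 := by
  have a1 := mu2_mu2 (c := Y.δ) (b := Y.δ) hf
  have a2 := mu2_mu2 (c := Y.δ) (b := f) X.δ_deg
  have a3 := mu2_mu2 (c := f) (b := X.δ) X.δ_deg
  have b1 := mu2_mu3_relation (d := Y.δ) (c := Y.δ) hf Y.δ_deg
  have b2 := mu2_mu3_relation (d := Y.δ) (c := Y.δ) X.δ_deg hf
  have b3 := mu2_mu3_relation (d := Y.δ) (c := f) X.δ_deg X.δ_deg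
  have b4 := mu2_mu3_relation (d := f) (c := X.δ) X.δ_deg X.δ_deg
  simp only [d_apply, mu2_add_left, mu2_add_right, mu3_add_left, mu3_add_mid, mu3_add_right,
    mu3_mu3_left, mu3_mu3_mid, mu3_mu3_right, mu2_δ_δ, mu2_neg_left, mu2_neg_right, mu3_neg_left,
    mu3_neg_mid, mu3_neg_right, sgn_one] at *
  rcases sgn_eq_one_or k n with hn | hn <;> rw [hn] at a1 b1 b2
  · linear_combination (norm := module) b1 + b2 + b3 + b4 - a1 + a2 + a3
  · linear_combination (norm := module) b1 + b2 + b3 + b4 + a1 + a2 + a3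

/-- The Leibniz rule, from the relations for `g`, `f` and copies of `δ`. Its signs are those of the
convention `μ₂(b, a) = (-1)^{|a|} a·b`. -/
theorem d_comp {g : Hom Y Z} {f : Hom X Y} {m n : ℤ} (hg : g ∈ homOf Y Z m)
    (hf : f ∈ homOf X Y n) :
    d X Z (cmp X Y Z g f) = sgn k n • cmp X Y Z (d Y Z g) f - cmp X Y Z g (d X Y f) := by
  have a1 := mu2_mu2 (c := Z.δ) (b := g) hf
  have a2 := mu2_mu2 (c := g) (b := Y.δ) hf
  have a3 := mu2_mu2 (c := g) (b := f) X.δ_deg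
  have b1 := mu2_mu3_relation (d := Z.δ) (c := Z.δ) hf hg
  have b2 := mu2_mu3_relation (d := Z.δ) (c := g) hf Y.δ_deg
  have b3 := mu2_mu3_relation (d := Z.δ) (c := g) X.δ_deg hf
  have b4 := mu2_mu3_relation (d := g) (c := Y.δ) hf Y.δ_deg
  have b5 := mu2_mu3_relation (d := g) (c := Y.δ) X.δ_deg hf
  have b6 := mu2_mu3_relation (d := g) (c := f) X.δ_deg X.δ_deg
  simp only [d_apply, comp_eq, mu2_add_left, mu2_add_right, mu3_add_left, mu3_add_mid,
    mu3_add_right, smul_add, mu3_mu3_left, mu3_mu3_mid, mu3_mu3_right, mu2_δ_δ, mu3_neg_left,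
    mu3_neg_mid, mu3_neg_right, sgn_one] at *
  rcases sgn_eq_one_or k n with hn | hn <;> rcases sgn_eq_one_or k m with hm | hm <;>
    rw [hn] at a1 a2 b1 b2 b3 b4 b5 ⊢ <;> rw [hm] at b1
  · linear_combination (norm := module) b1 + b2 + b3 + b4 + b5 + b6 - a1 - a2 + a3
  · linear_combination (norm := module) b1 + b2 + b3 + b4 + b5 + b6 - a1 - a2 + a3
  · linear_combination (norm := module) b1 + b2 + b3 + b4 + b5 + b6 + a1 + a2 + a3
  · linear_combination (norm := module) b1 + b2 + b3 + b4 + b5 + b6 + a1 + a2 + a3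

end Tw

namespace Tw

variable {k : Type*} [Field k] {X Y Z W V : Tw k stdFol}

/-- Since `μₙ = 0` for `n ≥ 4`, the third operation on twisted complexes is `μ₃` itself, with no
insertions of `δ`; it is the homotopy between the two ways of composing. -/
theorem comp_assoc_homotopy {c : Hom Z W} {b : Hom Y Z} {a : Hom X Y} {m n : ℤ}
    (hb : b ∈ homOf Y Z m) (ha : a ∈ homOf X Y n) :
    cmp X Z W c (cmp X Y Z b a) - sgn k n • cmp X Y W (cmp Y Z W c b) a
      + d X W (mu3 stdFol c b a) + mu3 stdFol c b (d X Y a) - sgn k n • mu3 stdFol c (d Y Z b) a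
      + (sgn k n * sgn k m) • mu3 stdFol (d Z W c) b a = 0 := by
  have a1 := mu2_mu2 (c := c) (b := b) ha
  have b1 := mu2_mu3_relation (d := W.δ) (c := c) ha hb
  have b2 := mu2_mu3_relation (d := c) (c := Z.δ) ha hb
  have b3 := mu2_mu3_relation (d := c) (c := b) ha Y.δ_deg
  have b4 := mu2_mu3_relation (d := c) (c := b) X.δ_deg ha
  simp only [d_apply, comp_eq, mu2_add_left, mu2_add_right, mu3_add_left, mu3_add_mid,
    mu3_add_right, smul_add, mu3_mu3_left, mu3_mu3_mid, mu3_mu3_right, sgn_one] at *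
  rcases sgn_eq_one_or k n with hn | hn <;> rcases sgn_eq_one_or k m with hm | hm <;>
    rw [hn] at a1 b1 b2 b3 b4 ⊢ <;> rw [hm] at b1 b2 ⊢
  · linear_combination (norm := module) b1 + b2 + b3 + b4 - a1
  · linear_combination (norm := module) b1 + b2 + b3 + b4 - a1
  · linear_combination (norm := module) b1 + b2 + b3 + b4 + a1
  · linear_combination (norm := module) b1 + b2 + b3 + b4 + a1

/-- The relation for four morphisms has no differential terms because `μ₄ = 0`, so it holds
strictly. It is needed for the exactness of the triangle of arcs. -/
theorem comp_mu3_relation {e : Hom W V} {c : Hom Z W} {b : Hom Y Z} {a : Hom X Y} {m n : ℤ}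
    (hb : b ∈ homOf Y Z m) (ha : a ∈ homOf X Y n) :
    - (sgn k n • cmp X Y V (mu3 stdFol e c b) a) + cmp X W V e (mu3 stdFol c b a)
    + (sgn k n * sgn k m) • mu3 stdFol (cmp Z W V e c) b a
    - sgn k n • mu3 stdFol e (cmp Y Z W c b) a + mu3 stdFol e c (cmp X Y Z b a) = 0 := by
  have b1 := mu2_mu3_relation (d := e) (c := c) ha hb
  simp only [comp_eq, mu3_add_left, mu3_add_mid,
    mu3_add_right, mu3_mu3_left, mu3_mu3_mid, mu3_mu3_right, add_zero]
  exact b1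

/-! ### Bilinearity and degrees -/

theorem comp_add_left (g g' : Hom Y Z) (f : Hom X Y) :
    cmp X Y Z (g + g') f = cmp X Y Z g f + cmp X Y Z g' f := by
  simp only [comp_eq, mu2_add_left, mu3_add_left, mu3_add_mid]; abel

theorem comp_add_right (g : Hom Y Z) (f f' : Hom X Y) :
    cmp X Y Z g (f + f') = cmp X Y Z g f + cmp X Y Z g f' := by
  simp only [comp_eq, mu2_add_right, mu3_add_right, mu3_add_mid]; abel

theorem comp_smul_left (c : k) (g : Hom Y Z) (f : Hom X Y) :
    cmp X Y Z (c • g) f = c • cmp X Y Z g f := by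
  simp only [comp_eq, mu2_smul_left, mu3_smul_left, mu3_smul_mid, smul_add]

theorem comp_smul_right (c : k) (g : Hom Y Z) (f : Hom X Y) :
    cmp X Y Z g (c • f) = c • cmp X Y Z g f := by
  simp only [comp_eq, mu2_smul_right, mu3_smul_right, mu3_smul_mid, smul_add]

/-- Composition with `g` on the left, as a linear map. -/
def postComp (X : Tw k stdFol) (g : Hom Y Z) : Hom X Y →ₗ[k] Hom X Z where
  toFun := cmp X Y Z g
  map_add' := comp_add_right g
  map_smul' c := comp_smul_right c g

/-- Composition with `f` on the right, as a linear map. -/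
def preComp (Z : Tw k stdFol) (f : Hom X Y) : Hom Y Z →ₗ[k] Hom X Z where
  toFun g := cmp X Y Z g f
  map_add' g g' := comp_add_left g g' f
  map_smul' c g := comp_smul_left c g f

@[simp] theorem postComp_apply (g : Hom Y Z) (f : Hom X Y) : postComp X g f = cmp X Y Z g f := rfl

@[simp] theorem comp_zero_left (f : Hom X Y) : cmp X Y Z 0 f = 0 := map_zero (preComp Z f)

@[simp] theorem comp_zero_right (g : Hom Y Z) : cmp X Y Z g 0 = 0 := map_zero (postComp X g)

theorem comp_sub_left (g g' : Hom Y Z) (f : Hom X Y) :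
    cmp X Y Z (g - g') f = cmp X Y Z g f - cmp X Y Z g' f := map_sub (preComp Z f) g g'

theorem comp_sub_right (g : Hom Y Z) (f f' : Hom X Y) :
    cmp X Y Z g (f - f') = cmp X Y Z g f - cmp X Y Z g f' := map_sub (postComp X g) f f'

theorem d_mem {f : Hom X Y} {n r : ℤ} (hf : f ∈ homOf X Y n) (hr : r = n + 1) :
    d X Y f ∈ homOf X Y r := by
  subst hr
  rw [d_apply]
  refine add_mem (add_mem (add_mem (add_mem ?_ ?_) ?_) ?_) ?_
  · rw [add_comm]; exact mu2_mem Y.δ_deg hf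
  · exact mu2_mem hf X.δ_deg
  · exact mu3_mem Y.δ_deg Y.δ_deg hf (by ring)
  · exact mu3_mem Y.δ_deg hf X.δ_deg (by ring)
  · exact mu3_mem hf X.δ_deg X.δ_deg (by ring)

theorem comp_mem {g : Hom Y Z} {f : Hom X Y} {m n r : ℤ} (hg : g ∈ homOf Y Z m)
    (hf : f ∈ homOf X Y n) (hr : r = m + n) : cmp X Y Z g f ∈ homOf X Z r := by
  subst hr
  rw [cmp, comp_eq]
  refine add_mem (add_mem (add_mem ?_ ?_) ?_) ?_
  · exact mu2_mem hg hf
  · exact mu3_mem Z.δ_deg hg hf (by ring)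
  · exact mu3_mem hg Y.δ_deg hf (by ring)
  · exact mu3_mem hg hf X.δ_deg (by ring)

/-! ### Units -/

theorem mu2_one_right {P Q : ShiftedSum} {f : Mor k P Q} {n : ℤ} (hf : f ∈ homDeg stdFol P Q n) :
    mu2 stdFol f (1 : Mor k P P) = f := by
  ext x z
  rw [mu2_std_apply, Finset.sum_eq_single x]
  · by_cases hxz : f x z = 0
    · simp [hxz]
    · have : ∀ i j : Fin 3, IsPath i j → ∀ s : ZMod 2, coefTwo i i j s s = 1 := by decide
      rw [this _ _ (hf x z hxz).1]
      simp
  · intro y _ hy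
    simp [Matrix.one_apply_ne (Ne.symm hy)]
  · simp

/-- With the sign convention for `μ₂`, identities are strict units on the right but units only up to
`(-1)^{|f|}` on the left. -/
theorem mu2_one_left {P Q : ShiftedSum} {f : Mor k P Q} {n : ℤ} (hf : f ∈ homDeg stdFol P Q n) :
    mu2 stdFol (1 : Mor k Q Q) f = sgn k n • f := by
  ext x z
  rw [mu2_std_apply, Finset.sum_eq_single z]
  · by_cases hxz : f x z = 0
    · simp [hxz]
    · have : ∀ i j : Fin 3, IsPath i j → ∀ s t : ZMod 2,
          coefTwo i j j s t = parSign (pathPar i j + s - t) := by decide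
      rw [this _ _ (hf x z hxz).1, Matrix.smul_apply, sgn_of_mem_homDeg hf hxz]
      simp
  · intro y _ hy
    simp [Matrix.one_apply_ne hy]
  · simp

section
variable {P Q R : ShiftedSum}

theorem mu3_one_right (e : Mor k Q R) (g : Mor k P Q) : mu3 stdFol e g (1 : Mor k P P) = 0 := by
  ext x w
  refine Finset.sum_eq_zero fun y _ => Finset.sum_eq_zero fun z _ => ?_
  by_cases hxy : x = y
  · subst hxy; simp [fukMu3]
  · simp [Matrix.one_apply_ne hxy]

theorem mu3_one_mid (e : Mor k Q R) (g : Mor k P Q) : mu3 stdFol e (1 : Mor k Q Q) g = 0 := by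
  ext x w
  refine Finset.sum_eq_zero fun y _ => Finset.sum_eq_zero fun z _ => ?_
  by_cases hxy : y = z
  · subst hxy; simp [fukMu3]
  · simp [Matrix.one_apply_ne hxy]

theorem mu3_one_left (e : Mor k Q R) (g : Mor k P Q) : mu3 stdFol (1 : Mor k R R) e g = 0 := by
  ext x w
  refine Finset.sum_eq_zero fun y _ => Finset.sum_eq_zero fun z _ => ?_
  by_cases hxy : z = w
  · subst hxy; simp [fukMu3]
  · simp [Matrix.one_apply_ne hxy]

end

theorem comp_one_right {f : Hom X Y} {n : ℤ} (hf : f ∈ homOf X Y n) : cmp X X Y f 1 = f := by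
  simp only [comp_eq, mu2_one_right hf, mu3_one_right, mu3_one_mid, add_zero]

theorem comp_one_left {f : Hom X Y} {n : ℤ} (hf : f ∈ homOf X Y n) :
    cmp X Y Y 1 f = sgn k n • f := by
  simp only [comp_eq, mu2_one_left hf, mu3_one_left, mu3_one_mid, add_zero]

theorem one_mem_homDeg (P : ShiftedSum) : (1 : Mor k P P) ∈ homDeg stdFol P P 0 := by
  intro x y hxy
  have : x = y := by by_contra h; exact hxy (Matrix.one_apply_ne h)
  subst this
  exact ⟨Or.inl rfl, by simp [pathDeg]⟩

/-! ### Cocycles and coboundaries -/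

theorem mem_cocycles {f : Hom X Y} {n : ℤ} :
    f ∈ cocycles X Y n ↔ f ∈ homOf X Y n ∧ d X Y f = 0 := Iff.rfl

theorem d_mem_coboundaries {f : Hom X Y} {m n : ℤ} (hf : f ∈ homOf X Y m) (h : n = m + 1) :
    d X Y f ∈ coboundaries X Y n :=
  ⟨f, by rwa [show n - 1 = m by omega], rfl⟩

theorem exists_of_mem_coboundaries {f : Hom X Y} {m n : ℤ} (hf : f ∈ coboundaries X Y n)
    (h : n = m + 1) : ∃ u ∈ homOf X Y m, d X Y u = f := by
  obtain ⟨u, hu, rfl⟩ := hf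
  exact ⟨u, by rwa [show n - 1 = m by omega] at hu, rfl⟩

theorem coboundaries_le_cocycles (X Y : Tw k stdFol) (n : ℤ) :
    coboundaries X Y n ≤ cocycles X Y n := by
  rintro _ ⟨u, hu, rfl⟩
  exact ⟨d_mem hu (by ring), d_d hu⟩

theorem one_mem_cocycles (X : Tw k stdFol) : (1 : Hom X X) ∈ cocycles X X 0 := by
  refine ⟨one_mem_homDeg _, ?_⟩
  change d X X 1 = 0
  rw [d_apply, mu2_one_left X.δ_deg, mu2_one_right X.δ_deg, mu3_one_left,
    mu3_one_mid, mu3_one_right]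
  simp

theorem comp_mem_cocycles {g : Hom Y Z} {f : Hom X Y} {m n r : ℤ} (hg : g ∈ cocycles Y Z m)
    (hf : f ∈ cocycles X Y n) (hr : r = m + n) : cmp X Y Z g f ∈ cocycles X Z r := by
  rw [mem_cocycles] at *
  refine ⟨comp_mem hg.1 hf.1 hr, ?_⟩
  rw [d_comp hg.1 hf.1, hg.2, hf.2]
  rw [comp_zero_left, comp_zero_right]; simp

theorem comp_mem_coboundaries_right {g : Hom Y Z} {f : Hom X Y} {m n r : ℤ}
    (hg : g ∈ cocycles Y Z m) (hf : f ∈ coboundaries X Y n) (hr : r = m + n) :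
    cmp X Y Z g f ∈ coboundaries X Z r := by
  obtain ⟨u, hu, rfl⟩ := hf
  rw [mem_cocycles] at hg
  have h1 := d_comp hg.1 hu
  rw [hg.2, comp_zero_left, smul_zero, zero_sub] at h1
  rw [← neg_eq_iff_eq_neg.2 h1]
  exact neg_mem (d_mem_coboundaries (comp_mem hg.1 hu rfl) (by omega))

theorem comp_mem_coboundaries_left {g : Hom Y Z} {f : Hom X Y} {m n r : ℤ}
    (hg : g ∈ coboundaries Y Z m) (hf : f ∈ cocycles X Y n) (hr : r = m + n) :
    cmp X Y Z g f ∈ coboundaries X Z r := by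
  obtain ⟨u, hu, rfl⟩ := hg
  rw [mem_cocycles] at hf
  have h1 := d_comp hu hf.1
  rw [hf.2, comp_zero_right, sub_zero] at h1
  have h2 : cmp X Y Z (d Y Z u) f = sgn k n • d X Z (cmp X Y Z u f) := by
    rw [h1, smul_smul, sgn_mul_self, one_smul]
  rw [h2]
  exact Submodule.smul_mem _ _ (d_mem_coboundaries (comp_mem hu hf.1 rfl) (by omega))

theorem comp_assoc_mem {c : Hom Z W} {b : Hom Y Z} {a : Hom X Y} {l m n r : ℤ}
    (hc : c ∈ cocycles Z W l) (hb : b ∈ cocycles Y Z m) (ha : a ∈ cocycles X Y n)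
    (hr : r = l + m + n) :
    cmp X Z W c (cmp X Y Z b a) - sgn k n • cmp X Y W (cmp Y Z W c b) a ∈ coboundaries X W r := by
  rw [mem_cocycles] at ha hb hc
  have := comp_assoc_homotopy (c := c) hb.1 ha.1
  rw [ha.2, hb.2, hc.2, mu3_zero_left, mu3_zero_mid, mu3_zero_right] at this
  simp only [smul_zero, add_zero, sub_zero] at this
  rw [eq_neg_of_add_eq_zero_left this]
  exact neg_mem (d_mem_coboundaries (mu3_mem (r := r - 1) hc.1 hb.1 ha.1 (by omega)) (by ring))

end Tw

namespace Tw

variable {k : Type*} [Field k] {X Y Z W V : Tw k stdFol} {X' Y' : Tw k stdFol}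

/-! ### Maps between extension spaces -/

/-- The class of a closed morphism. -/
def extMk {n : ℤ} (f : Hom X Y) (hf : f ∈ cocycles X Y n) : Ext X Y n :=
  Submodule.Quotient.mk ⟨f, hf⟩

theorem extMk_eq_zero {n : ℤ} {f : Hom X Y} {hf : f ∈ cocycles X Y n} :
    extMk f hf = 0 ↔ f ∈ coboundaries X Y n := by
  rw [extMk, Submodule.Quotient.mk_eq_zero]; rfl

theorem exists_extMk {n : ℤ} (ξ : Ext X Y n) : ∃ f, ∃ hf : f ∈ cocycles X Y n, extMk f hf = ξ := by
  obtain ⟨⟨f, hf⟩, rfl⟩ := Submodule.Quotient.mk_surjective _ ξ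
  exact ⟨f, hf, rfl⟩

theorem extMk_eq_extMk {n : ℤ} {f g : Hom X Y} {hf : f ∈ cocycles X Y n}
    {hg : g ∈ cocycles X Y n} : extMk f hf = extMk g hg ↔ f - g ∈ coboundaries X Y n := by
  rw [extMk, extMk, Submodule.Quotient.eq]; rfl

/-- The map of extension spaces induced by a linear map that preserves cocycles and
coboundaries. -/
def extMap {n n' : ℤ} (T : Hom X Y →ₗ[k] Hom X' Y')
    (hZ : ∀ f ∈ cocycles X Y n, T f ∈ cocycles X' Y' n')
    (hB : ∀ f ∈ coboundaries X Y n, T f ∈ coboundaries X' Y' n') : Ext X Y n →ₗ[k] Ext X' Y' n' :=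
  Submodule.mapQ _ _ (T.restrict hZ) fun f hf => hB f.1 hf

@[simp] theorem extMap_mk {n n' : ℤ} (T : Hom X Y →ₗ[k] Hom X' Y')
    (hZ : ∀ f ∈ cocycles X Y n, T f ∈ cocycles X' Y' n')
    (hB : ∀ f ∈ coboundaries X Y n, T f ∈ coboundaries X' Y' n') (f : Hom X Y)
    (hf : f ∈ cocycles X Y n) : extMap T hZ hB (extMk f hf) = extMk (T f) (hZ f hf) := rfl

theorem extMap_injective {n n' : ℤ} {T : Hom X Y →ₗ[k] Hom X' Y'}
    {hZ : ∀ f ∈ cocycles X Y n, T f ∈ cocycles X' Y' n'}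
    {hB : ∀ f ∈ coboundaries X Y n, T f ∈ coboundaries X' Y' n'}
    (h : ∀ f ∈ cocycles X Y n, T f ∈ coboundaries X' Y' n' → f ∈ coboundaries X Y n) :
    Function.Injective (extMap T hZ hB) := by
  rw [injective_iff_map_eq_zero]
  intro ξ hξ
  obtain ⟨f, hf, rfl⟩ := exists_extMk ξ
  rw [extMap_mk, extMk_eq_zero] at hξ
  exact extMk_eq_zero.2 (h f hf hξ)

theorem extMap_surjective {n n' : ℤ} {T : Hom X Y →ₗ[k] Hom X' Y'}
    {hZ : ∀ f ∈ cocycles X Y n, T f ∈ cocycles X' Y' n'}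
    {hB : ∀ f ∈ coboundaries X Y n, T f ∈ coboundaries X' Y' n'}
    (h : ∀ g ∈ cocycles X' Y' n', ∃ f ∈ cocycles X Y n, T f - g ∈ coboundaries X' Y' n') :
    Function.Surjective (extMap T hZ hB) := by
  intro ξ
  obtain ⟨g, hg, rfl⟩ := exists_extMk ξ
  obtain ⟨f, hf, hfg⟩ := h g hg
  exact ⟨extMk f hf, by rw [extMap_mk, extMk_eq_extMk]; exact hfg⟩

/-- Precomposition with a closed morphism. -/
def pull (Z : Tw k stdFol) {a : Hom X Y} {m n r : ℤ} (ha : a ∈ cocycles X Y m) (h : r = n + m) :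
    Ext Y Z n →ₗ[k] Ext X Z r :=
  extMap (preComp Z a) (fun _ hf => comp_mem_cocycles hf ha h)
    fun _ hf => comp_mem_coboundaries_left hf ha h

/-- Postcomposition with a closed morphism. -/
def push (X : Tw k stdFol) {c : Hom Y Z} {m n r : ℤ} (hc : c ∈ cocycles Y Z m) (h : r = m + n) :
    Ext X Y n →ₗ[k] Ext X Z r :=
  extMap (postComp X c) (fun _ hf => comp_mem_cocycles hc hf h)
    fun _ hf => comp_mem_coboundaries_right hc hf h

theorem pull_mk (Z : Tw k stdFol) {a : Hom X Y} {m n r : ℤ} (ha : a ∈ cocycles X Y m)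
    (h : r = n + m) {f : Hom Y Z} (hf : f ∈ cocycles Y Z n) :
    pull Z ha h (extMk f hf) = extMk (cmp X Y Z f a) (comp_mem_cocycles hf ha h) := rfl

theorem push_mk (X : Tw k stdFol) {c : Hom Y Z} {m n r : ℤ} (hc : c ∈ cocycles Y Z m)
    (h : r = m + n) {f : Hom X Y} (hf : f ∈ cocycles X Y n) :
    push X hc h (extMk f hf) = extMk (cmp X Y Z c f) (comp_mem_cocycles hc hf h) := rfl

/-! ### Graded isomorphisms -/

/-- `f` is a closed morphism of degree `m` which is invertible up to homotopy and nonzero scalars. -/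
def IsGradedIso (X Y : Tw k stdFol) (f : Hom X Y) (m : ℤ) : Prop :=
  f ∈ cocycles X Y m ∧ ∃ g ∈ cocycles Y X (-m),
    (∃ c : k, c ≠ 0 ∧ cmp X Y X g f - c • 1 ∈ coboundaries X X 0) ∧
    (∃ c : k, c ≠ 0 ∧ cmp Y X Y f g - c • 1 ∈ coboundaries Y Y 0)

theorem IsInvertible.isGradedIso {f : cocycles X Y 0} (hf : IsInvertible f) :
    IsGradedIso X Y f.1 0 := by
  obtain ⟨g, h1, h2⟩ := hf
  exact ⟨f.2, g.1, by simp, ⟨1, one_ne_zero, by simpa using h1⟩,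
    ⟨1, one_ne_zero, by simpa using h2⟩⟩

theorem comp_comp_inverse_mem {f : Hom Y Z} {a : Hom X Y} {b : Hom Y X} {n m : ℤ} {c : k}
    (hf : f ∈ cocycles Y Z n) (ha : a ∈ cocycles X Y m) (hb : b ∈ cocycles Y X (-m))
    (hab : cmp Y X Y a b - c • 1 ∈ coboundaries Y Y 0) :
    c • f - sgn k (-m) • cmp Y X Z (cmp X Y Z f a) b ∈ coboundaries Y Z n := by
  have h1 := comp_assoc_mem hf ha hb (r := n) (by ring)
  have h2 := comp_mem_coboundaries_right hf hab (r := n) (by ring)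
  rw [comp_sub_right, comp_smul_right, comp_one_right hf.1] at h2
  have := sub_mem h1 h2
  convert this using 1
  abel

theorem inverse_comp_comp_mem {f : Hom X Y} {a : Hom Y Z} {b : Hom Z Y} {n m : ℤ} {c : k}
    (hf : f ∈ cocycles X Y n) (ha : a ∈ cocycles Y Z m) (hb : b ∈ cocycles Z Y (-m))
    (hab : cmp Y Z Y b a - c • 1 ∈ coboundaries Y Y 0) :
    cmp X Z Y b (cmp X Y Z a f) - c • f ∈ coboundaries X Y n := by
  have h1 := comp_assoc_mem hb ha hf (r := n) (by ring)
  have h2 := comp_mem_coboundaries_left hab hf (r := n) (by ring)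
  rw [comp_sub_left, comp_smul_left, comp_one_left hf.1] at h2
  have := add_mem h1 (Submodule.smul_mem _ (sgn k n) h2)
  convert this using 1
  rw [smul_sub, smul_comm _ c, smul_smul (sgn k n), sgn_mul_self, one_smul]
  abel

theorem IsGradedIso.mem_coboundaries_of_comp_right {a : Hom X Y} {m : ℤ}
    (ha : IsGradedIso X Y a m) {f : Hom Y Z} {n r : ℤ} (hf : f ∈ cocycles Y Z n)
    (hfa : cmp X Y Z f a ∈ coboundaries X Z r) (hr : r = n + m) : f ∈ coboundaries Y Z n := by
  obtain ⟨ha, b, hb, -, c, hc, hab⟩ := ha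
  have h1 := comp_comp_inverse_mem hf ha hb hab
  have h2 := comp_mem_coboundaries_left hfa hb (r := n) (by omega)
  have h3 := add_mem h1 (Submodule.smul_mem _ (sgn k (-m)) h2)
  rw [sub_add_cancel] at h3
  exact (Submodule.smul_mem_iff _ hc).1 h3

theorem IsGradedIso.exists_comp_right {a : Hom X Y} {m : ℤ}
    (ha : IsGradedIso X Y a m) {f : Hom X Z} {n r : ℤ} (hf : f ∈ cocycles X Z r)
    (hr : r = n + m) : ∃ g ∈ cocycles Y Z n, cmp X Y Z g a - f ∈ coboundaries X Z r := by
  obtain ⟨ha, b, hb, ⟨c, hc, hab⟩, -⟩ := ha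
  refine ⟨(c⁻¹ * sgn k m) • cmp Y X Z f b, Submodule.smul_mem _ _
    (comp_mem_cocycles hf hb (by omega)), ?_⟩
  have h1 := comp_comp_inverse_mem (m := -m) hf hb (by rwa [neg_neg]) hab
  rw [neg_neg] at h1
  have h2 := Submodule.smul_mem _ (-c⁻¹) h1
  rw [comp_smul_left]
  convert h2 using 1
  rw [smul_sub, neg_smul, neg_smul, smul_smul, smul_smul, inv_mul_cancel₀ hc, one_smul]
  abel

theorem IsGradedIso.mem_coboundaries_of_comp_left {a : Hom Y Z} {m : ℤ}
    (ha : IsGradedIso Y Z a m) {f : Hom X Y} {n r : ℤ} (hf : f ∈ cocycles X Y n)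
    (hfa : cmp X Y Z a f ∈ coboundaries X Z r) (hr : r = m + n) : f ∈ coboundaries X Y n := by
  obtain ⟨ha, b, hb, ⟨c, hc, hab⟩, -⟩ := ha
  have h1 := inverse_comp_comp_mem hf ha hb hab
  have h2 := comp_mem_coboundaries_right hb hfa (r := n) (by omega)
  have h3 := sub_mem h2 h1
  rw [sub_sub_cancel] at h3
  exact (Submodule.smul_mem_iff _ hc).1 h3

theorem IsGradedIso.exists_comp_left {a : Hom Y Z} {m : ℤ}
    (ha : IsGradedIso Y Z a m) {f : Hom X Z} {n r : ℤ} (hf : f ∈ cocycles X Z r)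
    (hr : r = m + n) : ∃ g ∈ cocycles X Y n, cmp X Y Z a g - f ∈ coboundaries X Z r := by
  obtain ⟨ha, b, hb, -, c, hc, hab⟩ := ha
  refine ⟨c⁻¹ • cmp X Z Y b f, Submodule.smul_mem _ _ (comp_mem_cocycles hb hf (by omega)), ?_⟩
  have h1 := inverse_comp_comp_mem (m := -m) hf hb (by rwa [neg_neg]) hab
  have h2 := Submodule.smul_mem _ (c⁻¹) h1
  rw [comp_smul_right]
  convert h2 using 1
  rw [smul_sub, smul_smul, inv_mul_cancel₀ hc, one_smul]

theorem IsGradedIso.pull_bijective {a : Hom X Y} {m : ℤ} (ha : IsGradedIso X Y a m)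
    (Z : Tw k stdFol) {n r : ℤ} (h : r = n + m) : Function.Bijective (pull Z (n := n) ha.1 h) :=
  ⟨extMap_injective fun _ hf hfa => ha.mem_coboundaries_of_comp_right hf hfa h,
    extMap_surjective fun _ hf => ha.exists_comp_right hf h⟩

theorem IsGradedIso.push_bijective {a : Hom Y Z} {m : ℤ} (ha : IsGradedIso Y Z a m)
    (X : Tw k stdFol) {n r : ℤ} (h : r = m + n) : Function.Bijective (push X (n := n) ha.1 h) :=
  ⟨extMap_injective fun _ hf hfa => ha.mem_coboundaries_of_comp_left hf hfa h,
    extMap_surjective fun _ hf => ha.exists_comp_left hf h⟩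

/-! ### Isomorphism -/

theorem Iso.symm (h : Iso X Y) : Iso Y X := by
  obtain ⟨f, g, h1, h2⟩ := h
  exact ⟨g, f, h2, h1⟩

theorem comp_inverse_of_comp {f : Hom X Y} {f' : Hom Y X} {g : Hom Y Z} {g' : Hom Z Y}
    (hf : f ∈ cocycles X Y 0) (hf' : f' ∈ cocycles Y X 0) (hg : g ∈ cocycles Y Z 0)
    (hg' : g' ∈ cocycles Z Y 0) (h1 : cmp X Y X f' f - 1 ∈ coboundaries X X 0)
    (h2 : cmp Y Z Y g' g - 1 ∈ coboundaries Y Y 0) :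
    cmp X Z X (cmp Z Y X f' g') (cmp X Y Z g f) - 1 ∈ coboundaries X X 0 := by
  have hgf := comp_mem_cocycles hg hf (r := 0) (by ring)
  have a1 := comp_assoc_mem hf' hg' hgf (r := 0) (by ring)
  have a2 := comp_assoc_mem hg' hg hf (r := 0) (by ring)
  have a3 := comp_mem_coboundaries_left h2 hf (r := 0) (by ring)
  rw [comp_sub_left, comp_one_left hf.1] at a3
  simp only [sgn_zero, one_smul] at a1 a2 a3
  have a4 := comp_mem_coboundaries_right hf' (add_mem a2 a3) (r := 0) (by ring)
  rw [sub_add_sub_cancel, comp_sub_right] at a4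
  have := add_mem (sub_mem a4 a1) h1
  convert this using 1
  abel

theorem Iso.trans (h : Iso X Y) (h' : Iso Y Z) : Iso X Z := by
  obtain ⟨f, f', h1, h2⟩ := h
  obtain ⟨g, g', h3, h4⟩ := h'
  exact ⟨⟨_, comp_mem_cocycles g.2 f.2 (by ring)⟩, ⟨_, comp_mem_cocycles f'.2 g'.2 (by ring)⟩,
    comp_inverse_of_comp f.2 f'.2 g.2 g'.2 h1 h3, comp_inverse_of_comp g'.2 g.2 f'.2 f.2 h4 h2⟩

theorem Iso.finrank_ext_left (h : Iso X Y) (Z : Tw k stdFol) (n : ℤ) :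
    Module.finrank k (Ext X Z n) = Module.finrank k (Ext Y Z n) := by
  obtain ⟨f, hf⟩ := h
  exact (LinearEquiv.ofBijective _
    (hf.isGradedIso.pull_bijective Z (n := n) (by ring))).finrank_eq.symm

theorem Iso.finrank_ext_right (h : Iso Y Z) (X : Tw k stdFol) (n : ℤ) :
    Module.finrank k (Ext X Y n) = Module.finrank k (Ext X Z n) := by
  obtain ⟨f, hf⟩ := h
  exact (LinearEquiv.ofBijective _
    (hf.isGradedIso.push_bijective X (n := n) (by ring))).finrank_eq

end Tw

/-! ### Mapping cones. -/

theorem two_eq_zero_zmod : (2 : ZMod 2) = 0 := rfl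

/-- Shifting a summand by one multiplies the coefficients by reduced-degree signs of later paths.
These rules compare the operations on `X[1]`, as a block of a cone, with those on `X`. -/
theorem coefTwo_shift_mid (i j l : Fin 3) (si sj : ZMod 2) :
    coefTwo i j l si (sj + 1) = coefTwo i j l si sj * parSign (pathPar j l - 1) := by
  revert i j l si sj; decide

theorem coefTwo_shift_left (i j l : Fin 3) (si sj : ZMod 2) :
    coefTwo i j l (si + 1) sj = coefTwo i j l si sj * parSign (pathPar j l - 1) := by
  revert i j l si sj; decide

theorem coefThree_shift_first (i j l r : Fin 3) (si sj sl : ZMod 2) :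
    coefThree i j l r (si + 1) sj sl =
      coefThree i j l r si sj sl * (parSign (pathPar j l - 1) * parSign (pathPar l r - 1)) := by
  simp only [coefThree, mul_assoc, ← parSign_add]
  congr 2; ring

theorem coefThree_shift_second (i j l r : Fin 3) (si sj sl : ZMod 2) :
    coefThree i j l r si (sj + 1) sl =
      coefThree i j l r si sj sl * parSign (pathPar j l - 1) := by
  simp only [coefThree, mul_assoc, ← parSign_add]
  congr 2; linear_combination -((pathPar j l - 1)) * two_eq_zero_zmod

theorem coefThree_shift_third (i j l r : Fin 3) (si sj sl : ZMod 2) :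
    coefThree i j l r si sj (sl + 1) =
      coefThree i j l r si sj sl * parSign (pathPar l r - 1) := by
  simp only [coefThree, mul_assoc, ← parSign_add]
  congr 2; linear_combination -((pathPar l r - 1)) * two_eq_zero_zmod

/-- On the support of a homogeneous morphism the reduced-degree sign is a global sign times one sign
for each end. The signs at the ends can be absorbed by rescaling the entries. -/
theorem parSign_of_mem_homDeg {k : Type*} [Field k] {P Q : ShiftedSum} {f : Mor k P Q} {n : ℤ}
    (hf : f ∈ homDeg stdFol P Q n) {x y} (hxy : f x y ≠ 0) :
    ((parSign (pathPar (P.arc x) (Q.arc y) - 1) : ℤ) : k) =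
      -(sgn k n * (sgn k (P.shift x) * sgn k (Q.shift y))) := by
  have h2 := (hf x y hxy).2
  have h3 : pathPar (P.arc x) (Q.arc y) - 1 = ((n + (P.shift x + Q.shift y) - 1 : ℤ) : ZMod 2) := by
    rw [← pathDeg_cast, h2]; push_cast
    linear_combination -(P.shift x : ZMod 2) * two_eq_zero_zmod
  rw [h3, ← sgn_eq_parSign, sub_eq_add_neg, sgn_add, sgn_add, sgn_add]
  simp [sgn]

namespace Tw

variable {k : Type*} [Field k] {X Y : Tw k stdFol}

/-- `(C, D)` is the sum `X[1] ⊕ Y` with the differential of the mapping cone of `f`. -/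
structure ConeData (f : Hom X Y) (C : ShiftedSum) (D : Mor k C C) where
  e : Fin X.size ⊕ Fin Y.size ≃ Fin C.size
  arc_inl : ∀ x, C.arc (e (Sum.inl x)) = X.arc x
  shift_inl : ∀ x, C.shift (e (Sum.inl x)) = X.shift x + 1
  arc_inr : ∀ y, C.arc (e (Sum.inr y)) = Y.arc y
  shift_inr : ∀ y, C.shift (e (Sum.inr y)) = Y.shift y
  inl_inl : ∀ x x', D (e (Sum.inl x)) (e (Sum.inl x')) = X.δ x x'
  inl_inr : ∀ x y, D (e (Sum.inl x)) (e (Sum.inr y)) = sgn k (Y.shift y) * f x y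
  inr_inl : ∀ y x, D (e (Sum.inr y)) (e (Sum.inl x)) = 0
  inr_inr : ∀ y y', D (e (Sum.inr y)) (e (Sum.inr y')) = Y.δ y y'

namespace ConeData

variable {f : Hom X Y} {C : ShiftedSum} {D : Mor k C C} (E : ConeData f C D) {W V : ShiftedSum}

theorem sum_eq (E : ConeData f C D) (φ : Fin C.size → k) :
    ∑ c, φ c = ∑ x, φ (E.e (Sum.inl x)) + ∑ y, φ (E.e (Sum.inr y)) := by
  rw [← E.e.sum_comp, Fintype.sum_sum_type]

/-- The component in `X` of a morphism to the cone, with a sign. -/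
def fst : Mor k W C →ₗ[k] Mor k W X.toShiftedSum where
  -- The factor `(-1)^{shift x}` absorbs the entrywise signs caused by passing from `X` to `X[1]`,
  -- so that this projection commutes with the differentials.
  toFun F := Matrix.of fun w x => sgn k (X.shift x) * F w (E.e (Sum.inl x))
  map_add' F G := by ext; simp [mul_add]
  map_smul' c F := by ext; simp; ring

/-- The component in `Y` of a morphism to the cone. -/
def snd : Mor k W C →ₗ[k] Mor k W Y.toShiftedSum where
  toFun F := Matrix.of fun w y => F w (E.e (Sum.inr y))
  map_add' F G := by ext; simp
  map_smul' c F := by ext; simp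

/-- The morphism to the cone with given components. -/
def pair (u : Mor k W X.toShiftedSum) (v : Mor k W Y.toShiftedSum) : Mor k W C := fun w c =>
  Sum.elim (fun x => sgn k (X.shift x) * u w x) (v w) (E.e.symm c)

theorem fst_apply (F : Mor k W C) (w x) :
    E.fst F w x = sgn k (X.shift x) * F w (E.e (Sum.inl x)) := rfl

theorem snd_apply (F : Mor k W C) (w y) : E.snd F w y = F w (E.e (Sum.inr y)) := rfl

@[simp] theorem fst_pair (u : Mor k W X.toShiftedSum) (v : Mor k W Y.toShiftedSum) :
    E.fst (E.pair u v) = u := by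
  ext w x; simp [fst_apply, pair, sgn_mul_sgn_mul]

@[simp] theorem snd_pair (u : Mor k W X.toShiftedSum) (v : Mor k W Y.toShiftedSum) :
    E.snd (E.pair u v) = v := by
  ext w x; simp [snd_apply, pair]

theorem apply_inl (F : Mor k W C) (w x) :
    F w (E.e (Sum.inl x)) = sgn k (X.shift x) * E.fst F w x := by
  rw [fst_apply, sgn_mul_sgn_mul]

theorem hom_ext {F G : Mor k W C} (h1 : E.fst F = E.fst G) (h2 : E.snd F = E.snd G) : F = G := by
  ext w c
  obtain ⟨c, rfl⟩ := E.e.surjective c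
  rcases c with x | y
  · rw [E.apply_inl F, E.apply_inl G, h1]
  · exact congrFun (congrFun h2 w) y

theorem fst_mem {F : Mor k W C} {n r : ℤ} (hF : F ∈ homDeg stdFol W C n) (hr : r = n + 1) :
    E.fst F ∈ homDeg stdFol W X.toShiftedSum r := by
  intro w x hwx
  have := hF w (E.e (Sum.inl x)) (fun h0 => hwx (by simp [fst_apply, h0]))
  rw [E.arc_inl, E.shift_inl] at this
  exact ⟨this.1, by omega⟩

theorem snd_mem {F : Mor k W C} {n : ℤ} (hF : F ∈ homDeg stdFol W C n) :
    E.snd F ∈ homDeg stdFol W Y.toShiftedSum n := by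
  intro w y hwy
  have := hF w (E.e (Sum.inr y)) hwy
  rwa [E.arc_inr, E.shift_inr] at this

theorem mem_of_fst_snd {F : Mor k W C} {n r : ℤ} (hr : r = n + 1)
    (h1 : E.fst F ∈ homDeg stdFol W X.toShiftedSum r)
    (h2 : E.snd F ∈ homDeg stdFol W Y.toShiftedSum n) : F ∈ homDeg stdFol W C n := by
  intro w c hwc
  obtain ⟨c, rfl⟩ := E.e.surjective c
  rcases c with x | y
  · have := h1 w x (fun h0 => hwc (by rw [E.apply_inl F, h0, mul_zero]))
    rw [E.arc_inl, E.shift_inl]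
    exact ⟨this.1, by omega⟩
  · have := h2 w y hwc
    rwa [E.arc_inr, E.shift_inr]

theorem coefTwo_inl {W R : ShiftedSum} {g : Mor k X.toShiftedSum R} {n : ℤ}
    (hg : g ∈ homDeg stdFol X.toShiftedSum R n) (w x z) :
    ((coefTwo (W.arc w) (C.arc (E.e (Sum.inl x))) (R.arc z) (W.shift w)
      (C.shift (E.e (Sum.inl x))) : ℤ) : k) * g x z * sgn k (X.shift x) =
    -(sgn k n * ((coefTwo (W.arc w) (X.arc x) (R.arc z) (W.shift w) (X.shift x) : ℤ) : k)
      * g x z * sgn k (R.shift z)) := by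
  by_cases h0 : g x z = 0
  · simp [h0]
  rw [E.arc_inl, E.shift_inl, Int.cast_add, Int.cast_one, coefTwo_shift_mid, Int.cast_mul,
    parSign_of_mem_homDeg hg h0]
  linear_combination -(((coefTwo (W.arc w) (X.arc x) (R.arc z) (W.shift w) (X.shift x) : ℤ) : k) *
    sgn k n * sgn k (R.shift z) * g x z) * sgn_mul_self (k := k) (X.shift x)

theorem coefThree_inl_third {V W R : ShiftedSum} {g : Mor k X.toShiftedSum R} {n : ℤ}
    (hg : g ∈ homDeg stdFol X.toShiftedSum R n) (v w x z) :
    ((coefThree (V.arc v) (W.arc w) (C.arc (E.e (Sum.inl x))) (R.arc z) (V.shift v) (W.shift w)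
      (C.shift (E.e (Sum.inl x))) : ℤ) : k) * g x z * sgn k (X.shift x) =
    -(sgn k n * ((coefThree (V.arc v) (W.arc w) (X.arc x) (R.arc z) (V.shift v) (W.shift w)
      (X.shift x) : ℤ) : k) * g x z * sgn k (R.shift z)) := by
  by_cases h0 : g x z = 0
  · simp [h0]
  rw [E.arc_inl, E.shift_inl, Int.cast_add, Int.cast_one, coefThree_shift_third, Int.cast_mul,
    parSign_of_mem_homDeg hg h0]
  linear_combination -(((coefThree (V.arc v) (W.arc w) (X.arc x) (R.arc z) (V.shift v) (W.shift w)
      (X.shift x) : ℤ) : k) *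
    sgn k n * sgn k (R.shift z) * g x z) * sgn_mul_self (k := k) (X.shift x)

theorem coefThree_inl_second {W R T : ShiftedSum} {g : Mor k X.toShiftedSum R} {n : ℤ}
    (hg : g ∈ homDeg stdFol X.toShiftedSum R n) (w x y z) :
    ((coefThree (W.arc w) (C.arc (E.e (Sum.inl x))) (R.arc y) (T.arc z) (W.shift w)
      (C.shift (E.e (Sum.inl x))) (R.shift y) : ℤ) : k) * g x y * sgn k (X.shift x) =
    -(sgn k n * ((coefThree (W.arc w) (X.arc x) (R.arc y) (T.arc z) (W.shift w)
      (X.shift x) (R.shift y) : ℤ) : k) * g x y * sgn k (R.shift y)) := by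
  by_cases h0 : g x y = 0
  · simp [h0]
  rw [E.arc_inl, E.shift_inl, Int.cast_add, Int.cast_one, coefThree_shift_second, Int.cast_mul,
    parSign_of_mem_homDeg hg h0]
  linear_combination -(((coefThree (W.arc w) (X.arc x) (R.arc y) (T.arc z) (W.shift w)
      (X.shift x) (R.shift y) : ℤ) : k) *
    sgn k n * sgn k (R.shift y) * g x y) * sgn_mul_self (k := k) (X.shift x)

theorem coefThree_inl_inl {W T : ShiftedSum} {g : Mor k X.toShiftedSum T} {n : ℤ}
    (hg : g ∈ homDeg stdFol X.toShiftedSum T n) (w x x' z) :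
    ((coefThree (W.arc w) (C.arc (E.e (Sum.inl x))) (C.arc (E.e (Sum.inl x'))) (T.arc z)
      (W.shift w) (C.shift (E.e (Sum.inl x))) (C.shift (E.e (Sum.inl x'))) : ℤ) : k)
      * X.δ x x' * g x' z * sgn k (X.shift x) =
    -(sgn k n * ((coefThree (W.arc w) (X.arc x) (X.arc x') (T.arc z) (W.shift w)
      (X.shift x) (X.shift x') : ℤ) : k) * X.δ x x' * g x' z * sgn k (T.shift z)) := by
  by_cases h0 : X.δ x x' = 0
  · simp [h0]
  by_cases h1 : g x' z = 0
  · simp [h1]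
  rw [E.arc_inl, E.shift_inl, E.arc_inl, E.shift_inl, Int.cast_add, Int.cast_one, Int.cast_add,
    Int.cast_one, coefThree_shift_second, coefThree_shift_third, Int.cast_mul, Int.cast_mul,
    parSign_of_mem_homDeg hg h1, parSign_of_mem_homDeg X.δ_deg h0, sgn_one]
  linear_combination -(((coefThree (W.arc w) (X.arc x) (X.arc x') (T.arc z) (W.shift w)
      (X.shift x) (X.shift x') : ℤ) : k) *
    sgn k n * sgn k (T.shift z) * g x' z * X.δ x x') * (sgn_mul_self (k := k) (X.shift x) +
      sgn k (X.shift x) * sgn k (X.shift x) * sgn_mul_self (k := k) (X.shift x'))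

theorem fst_mu2_left (F : Mor k W C) : E.fst (mu2 stdFol D F) = mu2 stdFol X.δ (E.fst F) := by
  ext w x
  rw [fst_apply, mu2_std_apply, mu2_std_apply, E.sum_eq]
  simp only [E.inr_inl, zero_mul, mul_zero, Finset.sum_const_zero, add_zero, E.inl_inl,
    Finset.mul_sum]
  refine Finset.sum_congr rfl fun x' _ => ?_
  have := E.coefTwo_inl X.δ_deg w x' x
  rw [sgn_one] at this
  rw [E.arc_inl x, E.apply_inl F]
  linear_combination (sgn k (X.shift x) * E.fst F w x') * this
    + ((coefTwo (W.arc w) (X.arc x') (X.arc x) (W.shift w) (X.shift x') : ℤ) : k) * X.δ x' x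
      * E.fst F w x' * sgn_mul_self (k := k) (X.shift x)

/-- A morphism to the cone is a pair `(u, v)`, with differential `(du, dv - f ∘ u)`. This lemma and
its analogues for `μ₃` are that formula, term by term. -/
theorem snd_mu2_left (hf : f ∈ homOf X Y 0) (F : Mor k W C) :
    E.snd (mu2 stdFol D F) = mu2 stdFol Y.δ (E.snd F) - mu2 stdFol f (E.fst F) := by
  ext w y
  rw [Matrix.sub_apply, snd_apply, mu2_std_apply, mu2_std_apply, mu2_std_apply, E.sum_eq,
    add_comm, sub_eq_add_neg, ← Finset.sum_neg_distrib]
  simp only [E.inr_inr, E.inl_inr, E.arc_inr, E.shift_inr, snd_apply]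
  congr 1
  refine Finset.sum_congr rfl fun x _ => ?_
  have := E.coefTwo_inl hf w x y
  rw [sgn_zero] at this
  rw [E.apply_inl F]
  linear_combination (sgn k (Y.shift y) * E.fst F w x) * this
    - ((coefTwo (W.arc w) (X.arc x) (Y.arc y) (W.shift w) (X.shift x) : ℤ) : k) * f x y
      * E.fst F w x * sgn_mul_self (k := k) (Y.shift y)

theorem fst_mu2_right (F : Mor k W C) (G : Mor k V W) :
    E.fst (mu2 stdFol F G) = mu2 stdFol (E.fst F) G := by
  ext v x
  rw [fst_apply, mu2_std_apply, mu2_std_apply, Finset.mul_sum]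
  refine Finset.sum_congr rfl fun w _ => ?_
  rw [E.arc_inl, fst_apply]; ring

theorem snd_mu2_right (F : Mor k W C) (G : Mor k V W) :
    E.snd (mu2 stdFol F G) = mu2 stdFol (E.snd F) G := by
  ext v x
  rw [snd_apply, mu2_std_apply, mu2_std_apply]
  refine Finset.sum_congr rfl fun w _ => ?_
  rw [E.arc_inr, snd_apply]

theorem fst_mu3_left (F : Mor k W C) :
    E.fst (mu3 stdFol D D F) = mu3 stdFol X.δ X.δ (E.fst F) := by
  ext w x
  rw [fst_apply, mu3_std_apply, mu3_std_apply, E.sum_eq]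
  simp only [E.sum_eq (D := D), E.inr_inl, zero_mul, mul_zero, Finset.sum_const_zero, add_zero,
    E.inl_inl, Finset.mul_sum]
  refine Finset.sum_congr rfl fun x' _ => Finset.sum_congr rfl fun x'' _ => ?_
  have := E.coefThree_inl_inl X.δ_deg w x' x'' x
  rw [sgn_one] at this
  rw [E.arc_inl x, E.apply_inl F]
  linear_combination (sgn k (X.shift x) * E.fst F w x') * this
    + ((coefThree (W.arc w) (X.arc x') (X.arc x'') (X.arc x) (W.shift w) (X.shift x')
      (X.shift x'') : ℤ) : k) * X.δ x' x'' * X.δ x'' x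
      * E.fst F w x' * sgn_mul_self (k := k) (X.shift x)

theorem snd_mu3_left (hf : f ∈ homOf X Y 0) (F : Mor k W C) :
    E.snd (mu3 stdFol D D F) = mu3 stdFol Y.δ Y.δ (E.snd F) -
      (mu3 stdFol Y.δ f (E.fst F) + mu3 stdFol f X.δ (E.fst F)) := by
  ext w y
  rw [Matrix.sub_apply, Matrix.add_apply, snd_apply, mu3_std_apply, mu3_std_apply, mu3_std_apply,
    mu3_std_apply, E.sum_eq, add_comm, sub_eq_add_neg, ← Finset.sum_add_distrib,
    ← Finset.sum_neg_distrib]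
  simp only [E.sum_eq (D := D)]
  simp only [E.inr_inr, E.inl_inr, E.inl_inl, E.inr_inl, E.arc_inr, E.shift_inr, snd_apply,
    zero_mul, mul_zero, Finset.sum_const_zero, zero_add]
  congr 1
  refine Finset.sum_congr rfl fun x _ => ?_
  rw [add_comm, neg_add, ← Finset.sum_neg_distrib, ← Finset.sum_neg_distrib]
  congr 1
  · refine Finset.sum_congr rfl fun y' _ => ?_
    have := E.coefThree_inl_second (W := W) (T := Y.toShiftedSum) hf w x y' y
    rw [sgn_zero] at this
    rw [E.apply_inl F]
    linear_combination (sgn k (Y.shift y') * E.fst F w x * Y.δ y' y) * this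
      - ((coefThree (W.arc w) (X.arc x) (Y.arc y') (Y.arc y) (W.shift w) (X.shift x)
      (Y.shift y') : ℤ) : k) * f x y' * Y.δ y' y
      * E.fst F w x * sgn_mul_self (k := k) (Y.shift y')
  · refine Finset.sum_congr rfl fun x' _ => ?_
    have := E.coefThree_inl_inl hf w x x' y
    rw [sgn_zero] at this
    rw [E.apply_inl F]
    linear_combination (sgn k (Y.shift y) * E.fst F w x) * this
      - ((coefThree (W.arc w) (X.arc x) (X.arc x') (Y.arc y) (W.shift w) (X.shift x)
      (X.shift x') : ℤ) : k) * f x' y * X.δ x x'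
      * E.fst F w x * sgn_mul_self (k := k) (Y.shift y)

theorem fst_mu3_mid (F : Mor k W C) (G : Mor k V W) :
    E.fst (mu3 stdFol D F G) = mu3 stdFol X.δ (E.fst F) G := by
  ext v x
  rw [fst_apply, mu3_std_apply, mu3_std_apply, Finset.mul_sum]
  refine Finset.sum_congr rfl fun w _ => ?_
  rw [E.sum_eq]
  simp only [E.inr_inl, zero_mul, mul_zero, Finset.sum_const_zero, add_zero, E.inl_inl,
    Finset.mul_sum]
  refine Finset.sum_congr rfl fun x' _ => ?_
  have := E.coefThree_inl_third (V := V) (W := W) X.δ_deg v w x' x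
  rw [sgn_one] at this
  rw [E.arc_inl x, E.apply_inl F]
  linear_combination (sgn k (X.shift x) * E.fst F w x' * G v w) * this
    + ((coefThree (V.arc v) (W.arc w) (X.arc x') (X.arc x) (V.shift v) (W.shift w)
      (X.shift x') : ℤ) : k) * X.δ x' x * G v w
      * E.fst F w x' * sgn_mul_self (k := k) (X.shift x)

theorem snd_mu3_mid (hf : f ∈ homOf X Y 0) (F : Mor k W C) (G : Mor k V W) :
    E.snd (mu3 stdFol D F G) = mu3 stdFol Y.δ (E.snd F) G - mu3 stdFol f (E.fst F) G := by
  ext v y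
  rw [Matrix.sub_apply, snd_apply, mu3_std_apply, mu3_std_apply, mu3_std_apply,
    ← Finset.sum_sub_distrib]
  refine Finset.sum_congr rfl fun w _ => ?_
  rw [E.sum_eq, add_comm, sub_eq_add_neg, ← Finset.sum_neg_distrib]
  simp only [E.inr_inr, E.inl_inr, E.arc_inr, E.shift_inr, snd_apply]
  congr 1
  refine Finset.sum_congr rfl fun x _ => ?_
  have := E.coefThree_inl_third (V := V) (W := W) hf v w x y
  rw [sgn_zero] at this
  rw [E.apply_inl F]
  linear_combination (sgn k (Y.shift y) * E.fst F w x * G v w) * this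
    - ((coefThree (V.arc v) (W.arc w) (X.arc x) (Y.arc y) (V.shift v) (W.shift w)
      (X.shift x) : ℤ) : k) * f x y * G v w
      * E.fst F w x * sgn_mul_self (k := k) (Y.shift y)

theorem fst_mu3_right {U : ShiftedSum} (F : Mor k W C) (G : Mor k V W) (H : Mor k U V) :
    E.fst (mu3 stdFol F G H) = mu3 stdFol (E.fst F) G H := by
  ext v x
  simp only [fst_apply, mu3_std_apply, Finset.mul_sum, E.arc_inl]
  exact Finset.sum_congr rfl fun w _ => Finset.sum_congr rfl fun w' _ => by ring

theorem snd_mu3_right {U : ShiftedSum} (F : Mor k W C) (G : Mor k V W) (H : Mor k U V) :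
    E.snd (mu3 stdFol F G H) = mu3 stdFol (E.snd F) G H := by
  ext v x
  simp only [snd_apply, mu3_std_apply, E.arc_inr]

end ConeData

end Tw

namespace Tw

variable {k : Type*} [Field k] {X Y W : Tw k stdFol}

namespace ConeData

section Source
variable {f : Hom X Y} {C : ShiftedSum} {D : Mor k C C} (E : ConeData f C D) {Z R T : ShiftedSum}

/-- The restriction to `X` of a morphism from the cone, with a sign. -/
def resX (F : Mor k C Z) : Mor k X.toShiftedSum Z :=
  Matrix.of fun x z => sgn k (Z.shift z) * F (E.e (Sum.inl x)) z

/-- The restriction to `Y` of a morphism from the cone. -/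
def resY (F : Mor k C Z) : Mor k Y.toShiftedSum Z := Matrix.of fun y z => F (E.e (Sum.inr y)) z

theorem resX_apply (F : Mor k C Z) (x z) :
    E.resX F x z = sgn k (Z.shift z) * F (E.e (Sum.inl x)) z := rfl

theorem resY_apply (F : Mor k C Z) (y z) : E.resY F y z = F (E.e (Sum.inr y)) z := rfl

theorem res_ext {F G : Mor k C Z} (h1 : E.resX F = E.resX G) (h2 : E.resY F = E.resY G) :
    F = G := by
  ext c z
  obtain ⟨c, rfl⟩ := E.e.surjective c
  rcases c with x | y
  · have := congrFun (congrFun h1 x) z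
    rw [resX_apply, resX_apply] at this
    exact mul_left_cancel₀ (sgn_ne_zero _) this
  · exact congrFun (congrFun h2 y) z

theorem resX_mu2 {G : Mor k Z R} {n : ℤ} (hG : G ∈ homDeg stdFol Z R n) (F : Mor k C Z) :
    E.resX (mu2 stdFol G F) = -(sgn k n • mu2 stdFol G (E.resX F)) := by
  ext x r
  rw [Matrix.neg_apply, Matrix.smul_apply, resX_apply, mu2_std_apply, mu2_std_apply, smul_eq_mul,
    Finset.mul_sum, Finset.mul_sum, ← Finset.sum_neg_distrib]
  refine Finset.sum_congr rfl fun z _ => ?_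
  by_cases h0 : G z r = 0
  · simp [h0]
  rw [E.arc_inl, E.shift_inl, Int.cast_add, Int.cast_one, coefTwo_shift_left, Int.cast_mul,
    parSign_of_mem_homDeg hG h0, resX_apply]
  linear_combination -(((coefTwo (X.arc x) (Z.arc z) (R.arc r) (X.shift x) (Z.shift z) : ℤ) : k) *
    sgn k n * sgn k (Z.shift z) * F (E.e (Sum.inl x)) z * G z r) *
    sgn_mul_self (k := k) (R.shift r)

theorem resX_mu3 {H : Mor k R T} {G : Mor k Z R} {n m : ℤ} (hG : G ∈ homDeg stdFol Z R n)
    (hH : H ∈ homDeg stdFol R T m) (F : Mor k C Z) :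
    E.resX (mu3 stdFol H G F) = (sgn k n * sgn k m) • mu3 stdFol H G (E.resX F) := by
  ext x t
  rw [Matrix.smul_apply, resX_apply, mu3_std_apply, mu3_std_apply, smul_eq_mul,
    Finset.mul_sum, Finset.mul_sum]
  refine Finset.sum_congr rfl fun z _ => ?_
  rw [Finset.mul_sum, Finset.mul_sum]
  refine Finset.sum_congr rfl fun r _ => ?_
  by_cases h0 : G z r = 0
  · simp [h0]
  by_cases h1 : H r t = 0
  · simp [h1]
  rw [E.arc_inl, E.shift_inl, Int.cast_add, Int.cast_one, coefThree_shift_first, Int.cast_mul,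
    Int.cast_mul, parSign_of_mem_homDeg hG h0, parSign_of_mem_homDeg hH h1, resX_apply]
  linear_combination (((coefThree (X.arc x) (Z.arc z) (R.arc r) (T.arc t) (X.shift x) (Z.shift z)
      (R.shift r) : ℤ) : k) *
    sgn k n * sgn k m * sgn k (Z.shift z) * F (E.e (Sum.inl x)) z * G z r * H r t) *
    (sgn_mul_self (k := k) (R.shift r) +
      sgn k (R.shift r) * sgn k (R.shift r) * sgn_mul_self (k := k) (T.shift t))

theorem resY_mu2 (G : Mor k Z R) (F : Mor k C Z) :
    E.resY (mu2 stdFol G F) = mu2 stdFol G (E.resY F) := by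
  ext y r
  simp only [resY_apply, mu2_std_apply, E.arc_inr, E.shift_inr]

theorem resY_mu3 (H : Mor k R T) (G : Mor k Z R) (F : Mor k C Z) :
    E.resY (mu3 stdFol H G F) = mu3 stdFol H G (E.resY F) := by
  ext y r
  simp only [resY_apply, mu3_std_apply, E.arc_inr, E.shift_inr]

/-- Block by block: the diagonal blocks are the Maurer–Cartan equations of `X` and `Y`, the block
from `X` to `Y` says `df = 0`, and the block from `Y` to `X` is zero. -/
theorem maurerCartan (E : ConeData f C D) (hf : f ∈ cocycles X Y 0) : mu2 stdFol D D + mu3 stdFol D D D = 0 := by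
  have hX : E.resX (E.fst D) = X.δ := by
    ext x x'
    rw [resX_apply, fst_apply, E.inl_inl, sgn_mul_sgn_mul]
  have hY : E.resY (E.snd D) = Y.δ := by
    ext y y'; rw [resY_apply, snd_apply, E.inr_inr]
  have hXY : E.resX (E.snd D) = f := by
    ext x y; rw [resX_apply, snd_apply, E.inl_inr, sgn_mul_sgn_mul]
  have hYX : E.resY (E.fst D) = 0 := by
    ext x y; rw [resY_apply, fst_apply, E.inr_inl, mul_zero]; rfl
  have hadd : ∀ {Z : ShiftedSum} (F G : Mor k C Z), E.resX (F + G) = E.resX F + E.resX G := by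
    intro Z F G; ext x z; simp [resX_apply, mul_add]
  have hneg : ∀ {Z : ShiftedSum} (F : Mor k C Z), E.resX (-F) = -E.resX F := by
    intro Z F; ext x z; simp [resX_apply]
  have hzero : ∀ {Z : ShiftedSum}, E.resX (0 : Mor k C Z) = 0 := by
    intro Z; ext x z; simp [resX_apply]
  have kadd : ∀ {Z : ShiftedSum} (F G : Mor k C Z), E.resY (F + G) = E.resY F + E.resY G :=
    fun _ _ => rfl
  have kneg : ∀ {Z : ShiftedSum} (F : Mor k C Z), E.resY (-F) = -E.resY F := fun _ => rfl
  have hd := hf.2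
  change d X Y f = 0 at hd
  apply E.hom_ext
  · rw [map_add, map_zero, fst_mu2_left, fst_mu3_left]
    apply E.res_ext
    · rw [hadd, resX_mu2 _ X.δ_deg, resX_mu3 _ X.δ_deg X.δ_deg, hX, hzero, mu2_δ_δ]
      simp
    · rw [kadd, resY_mu2, resY_mu3, hYX, mu2_zero_right, mu3_zero_right, add_zero]; rfl
  · rw [map_add, map_zero, snd_mu2_left _ hf.1, snd_mu3_left _ hf.1]
    simp only [sub_eq_add_neg, neg_add]
    apply E.res_ext
    · simp only [hadd, hneg]
      rw [resX_mu2 _ Y.δ_deg, resX_mu2 _ hf.1, resX_mu3 _ Y.δ_deg Y.δ_deg,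
        resX_mu3 _ hf.1 Y.δ_deg, resX_mu3 _ X.δ_deg hf.1, hX, hXY, hzero]
      simp only [sgn_one, sgn_zero]
      rw [d_apply] at hd
      linear_combination (norm := module) hd
    · simp only [kadd, kneg, resY_mu2, resY_mu3, hY, hYX, mu2_zero_right, mu3_zero_right, mu2_δ_δ]
      simp; rfl

end Source

variable {f : Hom X Y} {C : Tw k stdFol} (E : ConeData f C.toShiftedSum C.δ)

theorem fst_d (F : Hom W C) : E.fst (d W C F) = d W X (E.fst F) := by
  simp only [d_apply, map_add, fst_mu2_left, fst_mu2_right, fst_mu3_left, fst_mu3_mid,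
    fst_mu3_right]

theorem snd_d (hf : f ∈ homOf X Y 0) (F : Hom W C) :
    E.snd (d W C F) = d W Y (E.snd F) - cmp W X Y f (E.fst F) := by
  simp only [d_apply, comp_eq, map_add, E.snd_mu2_left hf, snd_mu2_right, E.snd_mu3_left hf,
    E.snd_mu3_mid hf, snd_mu3_right]
  abel

end ConeData

theorem IsCone.exists_coneData {f : cocycles X Y 0} {C : Tw k stdFol} (h : IsCone f C) :
    Nonempty (ConeData f.1 C.toShiftedSum C.δ) := by
  obtain ⟨e, h1, h2, h3⟩ := h
  have h4 : ∀ a b, C.δ (e a) (e b) = _ := fun a b => congrFun (congrFun h3 a) b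
  exact ⟨⟨e, fun x => (h1 x).1, fun x => (h1 x).2, fun y => (h2 y).1, fun y => (h2 y).2,
    fun x x' => h4 _ _, fun x y => h4 _ _, fun y x => h4 _ _, fun y y' => h4 _ _⟩⟩

/-- The sum underlying the mapping cone. -/
def coneSum (X Y : Tw k stdFol) : ShiftedSum where
  size := X.size + Y.size
  arc := fun c => Sum.elim X.arc Y.arc (finSumFinEquiv.symm c)
  shift := fun c => Sum.elim (fun x => X.shift x + 1) Y.shift (finSumFinEquiv.symm c)

/-- The two blocks of the mapping cone. -/
def coneEquiv (X Y : Tw k stdFol) : Fin X.size ⊕ Fin Y.size ≃ Fin (coneSum X Y).size :=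
  finSumFinEquiv

theorem coneEquiv_symm_apply (c : Fin X.size ⊕ Fin Y.size) :
    (coneEquiv X Y).symm (coneEquiv X Y c) = c := Equiv.symm_apply_apply _ _

/-- The differential of the mapping cone. -/
def coneDelta (f : Hom X Y) : Mor k (coneSum X Y) (coneSum X Y) :=
  (Matrix.fromBlocks X.δ (Matrix.of fun x y => sgn k (Y.shift y) * f x y) 0 Y.δ).submatrix
    (coneEquiv X Y).symm (coneEquiv X Y).symm

theorem coneDelta_apply (f : Hom X Y) (a b) : coneDelta f (coneEquiv X Y a) (coneEquiv X Y b) =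
    Matrix.fromBlocks X.δ (Matrix.of fun x y => sgn k (Y.shift y) * f x y) 0 Y.δ a b := by
  rw [coneDelta, Matrix.submatrix_apply, coneEquiv_symm_apply, coneEquiv_symm_apply]

/-- The block structure of the mapping cone. -/
def coneDataOf (f : Hom X Y) : ConeData f (coneSum X Y) (coneDelta f) where
  e := coneEquiv X Y
  arc_inl x := congrArg (Sum.elim X.arc Y.arc) (coneEquiv_symm_apply (Sum.inl x))
  shift_inl x := congrArg (Sum.elim _ Y.shift) (coneEquiv_symm_apply (Sum.inl x))
  arc_inr x := congrArg (Sum.elim X.arc Y.arc) (coneEquiv_symm_apply (Sum.inr x))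
  shift_inr x := congrArg (Sum.elim _ Y.shift) (coneEquiv_symm_apply (Sum.inr x))
  inl_inl _ _ := coneDelta_apply f _ _
  inl_inr _ _ := coneDelta_apply f _ _
  inr_inl _ _ := coneDelta_apply f _ _
  inr_inr _ _ := coneDelta_apply f _ _

/-- The mapping cone of a closed morphism of degree zero. -/
def cone (f : Hom X Y) (hf : f ∈ cocycles X Y 0) : Tw k stdFol where
  toShiftedSum := coneSum X Y
  δ := coneDelta f
  δ_deg := by
    have E := coneDataOf f
    intro c c' hcc
    obtain ⟨c, rfl⟩ := E.e.surjective c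
    obtain ⟨c', rfl⟩ := E.e.surjective c'
    rcases c with x | y <;> rcases c' with x' | y'
    · rw [E.inl_inl] at hcc
      have := X.δ_deg x x' hcc
      rw [E.arc_inl, E.arc_inl, E.shift_inl, E.shift_inl]
      exact ⟨this.1, by omega⟩
    · rw [E.inl_inr] at hcc
      have := hf.1 x y' (right_ne_zero_of_mul hcc)
      rw [E.arc_inl, E.arc_inr, E.shift_inl, E.shift_inr]
      exact ⟨this.1, by omega⟩
    · exact absurd (E.inr_inl _ _) hcc
    · rw [E.inr_inr] at hcc
      have := Y.δ_deg y y' hcc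
      rwa [E.arc_inr, E.arc_inr, E.shift_inr, E.shift_inr]
  δ_tri := by
    intro c c' hcc
    obtain ⟨c, rfl⟩ := (coneEquiv X Y).surjective c
    obtain ⟨c', rfl⟩ := (coneEquiv X Y).surjective c'
    rw [coneDelta_apply] at hcc
    rcases c with x | y <;> rcases c' with x' | y'
    · exact Fin.lt_def.1 (X.δ_tri x x' hcc)
    -- The summands of `X[1]` come before those of `Y`, so the entries of `f` lie above the
    -- diagonal.
    · exact Nat.lt_of_lt_of_le x.2 (Nat.le_add_right _ y'.1)
    · exact absurd rfl hcc
    · exact (Fin.natAdd_lt_natAdd_iff _).2 (Y.δ_tri y y' hcc)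
  mc := (coneDataOf f).maurerCartan hf

/-- The block structure of the mapping cone, as a twisted complex. -/
def coneData (f : Hom X Y) (hf : f ∈ cocycles X Y 0) :
    ConeData f (cone f hf).toShiftedSum (cone f hf).δ := coneDataOf f

theorem isCone_cone (f : cocycles X Y 0) : IsCone f (cone f.1 f.2) := by
  refine ⟨coneEquiv X Y,
    fun x => ⟨(coneData f.1 f.2).arc_inl x, (coneData f.1 f.2).shift_inl x⟩,
    fun y => ⟨(coneData f.1 f.2).arc_inr y, (coneData f.1 f.2).shift_inr y⟩, ?_⟩
  ext a b
  exact coneDelta_apply f.1 a b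

end Tw

/-! ### The long exact sequence of a cone. -/

namespace Tw

variable {k : Type*} [Field k] {X Y W : Tw k stdFol}

namespace ConeData

variable {f : Hom X Y} {C : Tw k stdFol} (E : ConeData f C.toShiftedSum C.δ)

/-- The inclusion of `Y` in the cone, on morphism spaces. -/
def inclY (W : Tw k stdFol) : Hom W Y →ₗ[k] Hom W C where
  toFun v := E.pair 0 v
  map_add' v v' := by apply E.hom_ext <;> simp
  map_smul' c v := by apply E.hom_ext <;> simp

@[simp] theorem fst_inclY (v : Hom W Y) : E.fst (E.inclY W v) = 0 := E.fst_pair _ _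

@[simp] theorem snd_inclY (v : Hom W Y) : E.snd (E.inclY W v) = v := E.snd_pair _ _

theorem pair_mem {u : Hom W X} {v : Hom W Y} {n r : ℤ} (hu : u ∈ homOf W X r)
    (hv : v ∈ homOf W Y n) (hr : r = n + 1) : (E.pair u v : Hom W C) ∈ homOf W C n :=
  E.mem_of_fst_snd hr (by rwa [fst_pair]) (by rwa [snd_pair])

theorem d_inclY (hf : f ∈ homOf X Y 0) (v : Hom W Y) :
    d W C (E.inclY W v) = E.inclY W (d W Y v) := by
  apply E.hom_ext
  · simp [fst_d]
  · rw [E.snd_d hf]; simp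

theorem inclY_mem {v : Hom W Y} {n : ℤ} (hv : v ∈ homOf W Y n) : E.inclY W v ∈ homOf W C n :=
  E.pair_mem (zero_mem (homOf W X (n + 1))) hv rfl

theorem inclY_mem_cocycles (hf : f ∈ homOf X Y 0) {v : Hom W Y} {n : ℤ}
    (hv : v ∈ cocycles W Y n) : E.inclY W v ∈ cocycles W C n := by
  rw [mem_cocycles] at hv ⊢
  exact ⟨E.inclY_mem hv.1, by rw [E.d_inclY hf, hv.2, map_zero]⟩

theorem inclY_mem_coboundaries (hf : f ∈ homOf X Y 0) {v : Hom W Y} {n : ℤ}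
    (hv : v ∈ coboundaries W Y n) : E.inclY W v ∈ coboundaries W C n := by
  obtain ⟨u, hu, rfl⟩ := hv
  rw [← E.d_inclY hf]
  exact ⟨_, E.inclY_mem hu, rfl⟩

theorem fst_mem_cocycles {F : Hom W C} {n r : ℤ} (hF : F ∈ cocycles W C n) (hr : r = n + 1) :
    E.fst F ∈ cocycles W X r := by
  rw [mem_cocycles] at hF ⊢
  exact ⟨E.fst_mem hF.1 hr, by rw [← E.fst_d, hF.2, map_zero]⟩

theorem fst_mem_coboundaries {F : Hom W C} {n r : ℤ} (hF : F ∈ coboundaries W C n)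
    (hr : r = n + 1) : E.fst F ∈ coboundaries W X r := by
  obtain ⟨u, hu, rfl⟩ := hF
  rw [E.fst_d]
  exact d_mem_coboundaries (E.fst_mem hu (r := n) (by ring)) hr

/-- The map of extension spaces induced by the inclusion of `Y` in the cone. -/
def extIncl (hf : f ∈ homOf X Y 0) (W : Tw k stdFol) (n : ℤ) : Ext W Y n →ₗ[k] Ext W C n :=
  extMap (E.inclY W) (fun _ hv => E.inclY_mem_cocycles hf hv)
    fun _ hv => E.inclY_mem_coboundaries hf hv

/-- The map of extension spaces induced by the projection from the cone to `X[1]`. -/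
def extProj (W : Tw k stdFol) (n : ℤ) : Ext W C n →ₗ[k] Ext W X (n + 1) :=
  extMap E.fst (fun _ hv => E.fst_mem_cocycles hv rfl) fun _ hv => E.fst_mem_coboundaries hv rfl

/-- A primitive of `(0, v)` in the cone is a pair `(u, w)` with `du = 0` and `v = dw - f ∘ u`; that
is, `v` is cohomologous to `f ∘ (-u)`. -/
theorem ker_extIncl (hf : f ∈ cocycles X Y 0) (W : Tw k stdFol) (n : ℤ) :
    LinearMap.ker (E.extIncl hf.1 W n) =
      LinearMap.range (push W hf (n := n) (r := n) (by ring)) := by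
  ext ξ
  obtain ⟨v, hv, rfl⟩ := exists_extMk ξ
  rw [LinearMap.mem_ker, extIncl, extMap_mk, extMk_eq_zero]
  constructor
  · intro h
    obtain ⟨G, hG, hGv⟩ := exists_of_mem_coboundaries h (m := n - 1) (by ring)
    have h1 := congrArg E.fst hGv
    have h2 := congrArg E.snd hGv
    rw [E.fst_d, fst_inclY] at h1
    rw [E.snd_d hf.1, snd_inclY] at h2
    have hu : E.fst G ∈ cocycles W X n := ⟨E.fst_mem hG (by ring), h1⟩
    refine ⟨-extMk _ hu, ?_⟩
    rw [map_neg, push_mk, neg_eq_iff_eq_neg, ← sub_eq_zero, sub_neg_eq_add]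
    refine (extMk_eq_zero (hf := add_mem (comp_mem_cocycles hf hu (by ring)) hv)).2 ?_
    rw [← h2, add_sub_cancel]
    exact d_mem_coboundaries (E.snd_mem hG) (by ring)
  · rintro ⟨η, hη⟩
    obtain ⟨u, hu, rfl⟩ := exists_extMk η
    rw [push_mk, extMk_eq_extMk] at hη
    have h1 : E.inclY W (cmp W X Y f u) ∈ coboundaries W C n := by
      have h2 : E.inclY W (cmp W X Y f u) = -d W C (E.pair u 0) := by
        apply E.hom_ext
        · rw [fst_inclY, map_neg, E.fst_d, fst_pair, hu.2, neg_zero]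
        · rw [snd_inclY, map_neg, E.snd_d hf.1, snd_pair, fst_pair, map_zero]; simp
      rw [h2]
      exact neg_mem (d_mem_coboundaries (m := n - 1)
        (E.pair_mem hu.1 (zero_mem _) (by ring)) (by ring))
    have h3 := sub_mem h1 (E.inclY_mem_coboundaries hf.1 hη)
    rwa [map_sub, sub_sub_cancel] at h3

theorem ker_extProj (hf : f ∈ cocycles X Y 0) (W : Tw k stdFol) (n : ℤ) :
    LinearMap.ker (E.extProj W n) = LinearMap.range (E.extIncl hf.1 W n) := by
  ext ξ
  obtain ⟨F, hF, rfl⟩ := exists_extMk ξ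
  rw [LinearMap.mem_ker, extProj, extMap_mk, extMk_eq_zero]
  constructor
  · intro h
    obtain ⟨u, hu, huF⟩ := exists_of_mem_coboundaries h (m := n) (by ring)
    have hp : (E.pair u 0 : Hom W C) ∈ homOf W C (n - 1) := E.pair_mem hu (zero_mem _) (by ring)
    have hG : F - d W C (E.pair u 0) ∈ cocycles W C n :=
      sub_mem hF (coboundaries_le_cocycles _ _ _ (d_mem_coboundaries hp (by ring)))
    have hv : F - d W C (E.pair u 0) = E.inclY W (E.snd (F - d W C (E.pair u 0))) := by
      apply E.hom_ext
      · rw [map_sub, E.fst_d, fst_pair, huF, sub_self, fst_inclY]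
      · rw [snd_inclY]
    have hvc : E.snd (F - d W C (E.pair u 0)) ∈ cocycles W Y n := by
      refine ⟨E.snd_mem hG.1, ?_⟩
      have h4 : d W C (F - d W C (E.pair u 0)) = 0 := hG.2
      rw [hv, E.d_inclY hf.1] at h4
      have := congrArg E.snd h4
      rwa [snd_inclY, map_zero] at this
    refine ⟨extMk _ hvc, ?_⟩
    rw [extIncl, extMap_mk, extMk_eq_extMk, ← hv]
    rw [sub_sub_cancel_left]
    exact neg_mem (d_mem_coboundaries hp (by ring))
  · rintro ⟨η, hη⟩
    obtain ⟨v, hv, rfl⟩ := exists_extMk η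
    rw [extIncl, extMap_mk, extMk_eq_extMk] at hη
    have := E.fst_mem_coboundaries hη rfl
    rw [map_sub, fst_inclY, zero_sub] at this
    exact neg_mem_iff.1 this

theorem range_extProj (hf : f ∈ cocycles X Y 0) (W : Tw k stdFol) (n : ℤ) :
    LinearMap.range (E.extProj W n) =
      LinearMap.ker (push W hf (n := n + 1) (r := n + 1) (by ring)) := by
  ext ξ
  constructor
  · rintro ⟨η, rfl⟩
    obtain ⟨F, hF, rfl⟩ := exists_extMk η
    rw [LinearMap.mem_ker, extProj, extMap_mk, push_mk, extMk_eq_zero]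
    have h1 : d W C F = 0 := hF.2
    have h2 := congrArg E.snd h1
    rw [E.snd_d hf.1, map_zero, sub_eq_zero] at h2
    change cmp W X Y f (E.fst F) ∈ _
    rw [← h2]
    exact d_mem_coboundaries (E.snd_mem hF.1) rfl
  · intro h
    obtain ⟨u, hu, rfl⟩ := exists_extMk ξ
    rw [LinearMap.mem_ker, push_mk, extMk_eq_zero] at h
    obtain ⟨v, hv, hvu⟩ := exists_of_mem_coboundaries h (m := n) rfl
    have hF : (E.pair u v : Hom W C) ∈ cocycles W C n := by
      refine ⟨E.pair_mem hu.1 hv rfl, ?_⟩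
      change d W C _ = 0
      apply E.hom_ext
      · rw [E.fst_d, fst_pair, map_zero]; exact hu.2
      · rw [E.snd_d hf.1, fst_pair, snd_pair, hvu, sub_self, map_zero]
    exact ⟨extMk _ hF, by rw [extProj, extMap_mk, extMk_eq_extMk, fst_pair, sub_self]; exact zero_mem _⟩

/-- Rank count in the long exact sequence. The extensions of the cone are thus known from the ranks
of composition with `f` in two adjacent degrees. -/
theorem finrank_ext (E : ConeData f C.toShiftedSum C.δ) (hf : f ∈ cocycles X Y 0) (W : Tw k stdFol) (n : ℤ) :
    Module.finrank k (Ext W C n)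
      + Module.finrank k (LinearMap.range (push W hf (n := n) (r := n) (by ring)))
      + Module.finrank k (LinearMap.range (push W hf (n := n + 1) (r := n + 1) (by ring)))
    = Module.finrank k (Ext W Y n) + Module.finrank k (Ext W X (n + 1)) := by
  have h1 := LinearMap.finrank_range_add_finrank_ker (E.extProj W n)
  have h2 := LinearMap.finrank_range_add_finrank_ker (E.extIncl hf.1 W n)
  have h3 := LinearMap.finrank_range_add_finrank_ker (push W hf (n := n + 1) (r := n + 1) (by ring))
  rw [E.ker_extProj hf, E.range_extProj hf] at h1
  rw [E.ker_extIncl hf] at h2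
  omega

end ConeData

/-! ### A morphism inducing isomorphisms on the extensions from arcs is invertible -/

/-- The only summand of an arc. -/
def arcPt (k : Type*) [Field k] (i : Fin 3) (l : ℤ) : Fin (suspArc k stdFol i l).size := (0 : Fin 1)

theorem eq_arcPt {i : Fin 3} {l : ℤ} (t : Fin (suspArc k stdFol i l).size) : t = arcPt k i l :=
  Subsingleton.elim (α := Fin 1) t _

theorem suspArc_arc {i : Fin 3} {l : ℤ} (t) : (suspArc k stdFol i l).arc t = i := rfl

theorem suspArc_shift {i : Fin 3} {l : ℤ} (t) : (suspArc k stdFol i l).shift t = -l := rfl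

theorem suspArc_δ {i : Fin 3} {l : ℤ} : (suspArc k stdFol i l).δ = 0 := rfl

/-- The arc at a summand. -/
abbrev rowArc (W : Tw k stdFol) (x : Fin W.size) : Tw k stdFol :=
  suspArc k stdFol (W.arc x) (-(W.shift x))

/-- The component of a morphism at a summand of the source. -/
def row (F : Hom W Y) (x : Fin W.size) : Hom (rowArc W x) Y := Matrix.of fun _ z => F x z

theorem row_apply (F : Hom W Y) (x : Fin W.size) (t z) : row F x t z = F x z := rfl

theorem row_mem {F : Hom W Y} {n : ℤ} (hF : F ∈ homOf W Y n) (x : Fin W.size) :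
    row F x ∈ homOf (rowArc W x) Y n := by
  intro t z h
  have := hF x z h
  simp only [rowArc, suspArc, neg_neg]
  exact this

/-- As `δ` of `W` is strictly triangular, its contributions to row `x` of `dF` involve only later
rows of `F`, which vanish. -/
theorem row_d {F : Hom W Y} {x : Fin W.size} (hF : ∀ y, x < y → ∀ z, F y z = 0) :
    row (d W Y F) x = d (rowArc W x) Y (row F x) := by
  have h1 : ∀ z, mu2 stdFol F W.δ x z = 0 := fun z => Finset.sum_eq_zero fun y _ => by
    by_cases h0 : W.δ x y = 0
    · simp [h0]
    · simp [hF y (W.δ_tri x y h0)]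
  have h2 : ∀ z, mu3 stdFol Y.δ F W.δ x z = 0 := fun z =>
    Finset.sum_eq_zero fun y _ => Finset.sum_eq_zero fun c _ => by
      by_cases h0 : W.δ x y = 0
      · simp [h0]
      · simp [hF y (W.δ_tri x y h0)]
  have h3 : ∀ z, mu3 stdFol F W.δ W.δ x z = 0 := fun z =>
    Finset.sum_eq_zero fun y _ => Finset.sum_eq_zero fun y' _ => by
      by_cases h0 : W.δ x y = 0
      · simp [h0]
      by_cases h0' : W.δ y y' = 0
      · simp [h0']
      · simp [hF y' ((W.δ_tri x y h0).trans (W.δ_tri y y' h0'))]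
  ext t z
  rw [row_apply, d_apply, d_apply]
  simp only [Matrix.add_apply, h1, h2, h3, add_zero]
  simp only [suspArc_δ, mu2_zero_right, mu3_zero_right, Matrix.zero_apply, add_zero]
  rw [mu2_std_apply, mu2_std_apply, mu3_std_apply, mu3_std_apply]
  simp only [suspArc_arc, suspArc_shift, neg_neg, row_apply]

/-- Induction along the filtration of `W` by its summands, `r` bounding the rows in which the
cocycle may be nonzero. -/
theorem acyclic_of_arcs {C : Tw k stdFol}
    (h : ∀ i l n, cocycles (suspArc k stdFol i l) C n ≤ coboundaries (suspArc k stdFol i l) C n)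
    (W : Tw k stdFol) (n : ℤ) : cocycles W C n ≤ coboundaries W C n := by
  have key : ∀ r : ℕ, ∀ F ∈ cocycles W C n, (∀ x : Fin W.size, r ≤ x.1 → ∀ z, F x z = 0) →
      F ∈ coboundaries W C n := by
    intro r
    induction r with
    | zero =>
      intro F _ hF0
      have : F = 0 := by ext x z; exact hF0 x (Nat.zero_le _) z
      rw [this]; exact zero_mem _
    | succ r ih =>
      intro F hF hF0
      by_cases hr : r < W.size
      · let x₀ : Fin W.size := ⟨r, hr⟩
        have hrow : row F x₀ ∈ cocycles (rowArc W x₀) C n := by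
          refine ⟨row_mem hF.1 x₀, ?_⟩
          change d _ _ _ = 0
          rw [← row_d fun y hy z => hF0 y hy z, show d W C F = 0 from hF.2]
          rfl
        obtain ⟨G₀, hG₀, hG₀d⟩ := h _ _ _ hrow
        -- The last possibly nonzero row is a cocycle on a single arc, hence has a primitive.
        -- Extended by zero, this primitive clears the row while later rows stay zero.
        let G : Hom W C := Matrix.of fun x z => if x = x₀ then G₀ (arcPt k _ _) z else 0
        have hG : G ∈ homOf W C (n - 1) := by
          intro x z hxz
          by_cases hx : x = x₀
          · subst hx
            have := hG₀ (arcPt k _ _) z (by simpa [G] using hxz)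
            rwa [suspArc_arc, suspArc_shift, neg_neg] at this
          · simp [G, hx] at hxz
        have hGrow : row G x₀ = G₀ := by
          ext t z
          rw [eq_arcPt t]
          simp [row_apply, G]
        have hdG : d W C G ∈ coboundaries W C n := ⟨G, hG, rfl⟩
        have hz : ∀ y, x₀ < y → ∀ z, G y z = 0 := fun y hy z => by simp [G, ne_of_gt hy]
        have h1 : F - d W C G ∈ coboundaries W C n := by
          refine ih _ (sub_mem hF (coboundaries_le_cocycles _ _ _ hdG)) fun x hx z => ?_
          rcases Nat.eq_or_lt_of_le hx with hx | hx
          · have : x = x₀ := Fin.ext hx.symm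
            subst this
            have := row_d hz
            rw [hGrow, hG₀d] at this
            rw [Matrix.sub_apply, ← row_apply (d W C G) x₀ (arcPt k _ _) z, this, row_apply, sub_self]
          · have hx' : x₀ < x := hx
            have := row_d (x := x) fun y hy z => hz y (hx'.trans hy) z
            have h0 : row G x = 0 := by ext t z; exact hz x hx' z
            rw [h0, map_zero] at this
            rw [Matrix.sub_apply, ← row_apply (d W C G) x (arcPt k _ _) z, this, hF0 x hx, Matrix.zero_apply,
              sub_self]
        simpa using add_mem h1 hdG
      · exact ih F hF fun x hx z => absurd (lt_of_le_of_lt hx x.2) hr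
  exact fun F hF => key W.size F hF fun x hx => absurd x.2 (not_lt.2 hx)

/-- A primitive of the inclusion of `Y` in the cone has minus a homotopy inverse `g` on the right as
its first component. Then `f ∘ (g ∘ f - 1)` is exact, so `g ∘ f - 1` is the first component of a
cocycle in the cone, and a primitive of that cocycle shows that it is exact. -/
theorem isInvertible_of_acyclic {f : Hom X Y} (hf : f ∈ cocycles X Y 0)
    (h : ∀ W n, cocycles W (cone f hf) n ≤ coboundaries W (cone f hf) n) :
    IsInvertible (⟨f, hf⟩ : cocycles X Y 0) := by
  let E := coneData f hf
  obtain ⟨G, hG, hGd⟩ := h Y 0 (E.inclY_mem_cocycles hf.1 (one_mem_cocycles Y))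
  have h1 := congrArg E.fst hGd
  have h2 := congrArg E.snd hGd
  rw [E.fst_d, E.fst_inclY] at h1
  rw [E.snd_d hf.1, E.snd_inclY] at h2
  have hu : E.fst G ∈ cocycles Y X 0 := ⟨E.fst_mem hG (by ring), h1⟩
  have hg : -E.fst G ∈ cocycles Y X 0 := neg_mem hu
  have hfg : cmp Y X Y f (-E.fst G) - 1 ∈ coboundaries Y Y 0 := by
    have : cmp Y X Y f (-E.fst G) = -cmp Y X Y f (E.fst G) := map_neg (postComp Y f) _
    rw [this, ← h2, neg_sub_left, sub_add_cancel, ← map_neg]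
    exact d_mem_coboundaries (neg_mem (E.snd_mem hG)) (by ring)
  refine ⟨⟨_, hg⟩, ?_, hfg⟩
  set g : Hom Y X := -E.fst G with hgdef
  have hw : cmp X Y X g f - 1 ∈ cocycles X X 0 :=
    sub_mem (comp_mem_cocycles hg hf (by ring)) (one_mem_cocycles X)
  have hfw : cmp X X Y f (cmp X Y X g f - 1) ∈ coboundaries X Y 0 := by
    have a1 := comp_assoc_mem hf hg hf (r := 0) (by ring)
    have a2 := comp_mem_coboundaries_left hfg hf (r := 0) (by ring)
    rw [comp_sub_left, comp_one_left hf.1] at a2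
    simp only [sgn_zero, one_smul] at a1 a2
    rw [comp_sub_right, comp_one_right hf.1]
    simpa using add_mem a1 a2
  obtain ⟨v, hv, hvd⟩ := exists_of_mem_coboundaries hfw (m := -1) (by ring)
  have hp : (E.pair (cmp X Y X g f - 1) v : Hom X (cone f hf)) ∈ cocycles X (cone f hf) (-1) := by
    refine ⟨E.pair_mem hw.1 hv (by ring), ?_⟩
    change d X _ _ = 0
    apply E.hom_ext
    · rw [E.fst_d, E.fst_pair, map_zero]; exact hw.2
    · rw [E.snd_d hf.1, E.fst_pair, E.snd_pair, hvd, sub_self, map_zero]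
  have := E.fst_mem_coboundaries (h X (-1) hp) (r := 0) (by ring)
  rwa [E.fst_pair] at this

theorem cone_acyclic {f : Hom X Y} (hf : f ∈ cocycles X Y 0) {W : Tw k stdFol} {n : ℤ}
    (hsurj : Function.Surjective (push W hf (n := n) (r := n) (by ring)))
    (hinj : Function.Injective (push W hf (n := n + 1) (r := n + 1) (by ring))) :
    cocycles W (cone f hf) n ≤ coboundaries W (cone f hf) n := by
  intro F hF
  let E := coneData f hf
  have h1 : extMk F hF ∈ LinearMap.ker (E.extProj W n) := by
    have : E.extProj W n (extMk F hF) ∈ LinearMap.range (E.extProj W n) := ⟨_, rfl⟩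
    rw [E.range_extProj hf, LinearMap.mem_ker] at this
    exact hinj (by rw [this, map_zero])
  rw [E.ker_extProj hf] at h1
  obtain ⟨η, hη⟩ := h1
  have h2 : η ∈ LinearMap.ker (E.extIncl hf.1 W n) := by
    rw [E.ker_extIncl hf]; exact hsurj η
  rw [LinearMap.mem_ker.1 h2] at hη
  exact extMk_eq_zero.1 hη.symm

theorem isInvertible_of_push_bijective {f : Hom X Y} (hf : f ∈ cocycles X Y 0)
    (h : ∀ i l n, Function.Bijective
      (push (suspArc k stdFol i l) hf (n := n) (r := n) (by ring))) :
    IsInvertible (⟨f, hf⟩ : cocycles X Y 0) :=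
  isInvertible_of_acyclic hf fun W n =>
    acyclic_of_arcs (fun i l n => cone_acyclic hf (h i l n).2 (h i l (n + 1)).1) W n

end Tw

/-! ### The chain of suspended arcs. -/

/-- The suspended arcs are numbered by the integers: the summand `Eᵢ[s]` has the number `3s + i`. -/
def ShiftedSum.idx (P : ShiftedSum) (x : Fin P.size) : ℤ := 3 * P.shift x + ((P.arc x : ℕ) : ℤ)

/-- With the foliation data `(0, 0, 1)` the three arcs and their shifts become one uniform chain:
morphisms of degree `d` lead from `E_a` to `E_b` exactly when `b + 3d` is `a` or `a + 1`. -/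
theorem isPath_and_pathDeg_iff (i j : Fin 3) (s t d : ℤ) :
    (IsPath i j ∧ pathDeg stdFol i j = d + t - s) ↔
      (3 * t + ((j : ℕ) : ℤ)) + 3 * d - (3 * s + ((i : ℕ) : ℤ)) = 0 ∨
        (3 * t + ((j : ℕ) : ℤ)) + 3 * d - (3 * s + ((i : ℕ) : ℤ)) = 1 := by
  fin_cases i <;> fin_cases j <;> simp [IsPath, pathDeg, stdFol] <;> omega

theorem mem_homDeg_iff {k : Type*} [Field k] {P Q : ShiftedSum} {f : Mor k P Q} {n : ℤ} :
    f ∈ homDeg stdFol P Q n ↔ ∀ x y, f x y ≠ 0 →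
      Q.idx y + 3 * n - P.idx x = 0 ∨ Q.idx y + 3 * n - P.idx x = 1 :=
  forall₂_congr fun _ _ => imp_congr_right fun _ => isPath_and_pathDeg_iff _ _ _ _ _

/-- The arc with a given number. -/
def arcOf (j : ℤ) : Fin 3 := ⟨(j % 3).toNat, by omega⟩

theorem arcOf_val (j : ℤ) : (((arcOf j : Fin 3) : ℕ) : ℤ) = j % 3 := by
  simp only [arcOf]; omega

theorem three_mul_div_add_arcOf (j : ℤ) : 3 * (j / 3) + (((arcOf j : Fin 3) : ℕ) : ℤ) = j := by
  rw [arcOf_val]; omega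

theorem arcOf_eq_iff (i j : ℤ) : arcOf i = arcOf j ↔ i % 3 = j % 3 := by
  rw [← arcOf_val, ← arcOf_val, Fin.ext_iff]; omega

theorem arcOf_eq_add_one_iff (i j : ℤ) : arcOf j = arcOf i + 1 ↔ (j - i) % 3 = 1 := by
  have hi := arcOf_val i
  have hj := arcOf_val j
  generalize arcOf i = a at *
  generalize arcOf j = b at *
  fin_cases a <;> fin_cases b <;> simp at hi hj ⊢ <;> omega

namespace Tw

variable {k : Type*} [Field k] {X Y W : Tw k stdFol}

/-- The suspended arc with number `j`. -/
def arcZ (k : Type*) [Field k] (j : ℤ) : Tw k stdFol := suspArc k stdFol (arcOf j) (-(j / 3))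

theorem suspArc_eq_arcZ (i : Fin 3) (l : ℤ) :
    suspArc k stdFol i l = arcZ k (((i : ℕ) : ℤ) - 3 * l) := by
  have h1 : arcOf (((i : ℕ) : ℤ) - 3 * l) = i := by
    apply Fin.ext; simp only [arcOf]; omega
  have h2 : -((((i : ℕ) : ℤ) - 3 * l) / 3) = l := by omega
  rw [arcZ, h1, h2]

/-- The only summand of an arc. -/
def pt (k : Type*) [Field k] (j : ℤ) : Fin (arcZ k j).size := (0 : Fin 1)

theorem eq_pt {j : ℤ} (t : Fin (arcZ k j).size) : t = pt k j :=
  Subsingleton.elim (α := Fin 1) t _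

theorem sum_arcZ {j : ℤ} (φ : Fin (arcZ k j).size → k) : ∑ t, φ t = φ (pt k j) :=
  Fintype.sum_unique (ι := Fin 1) φ

theorem arcZ_arc {j : ℤ} (t) : (arcZ k j).arc t = arcOf j := rfl

theorem arcZ_shift {j : ℤ} (t) : (arcZ k j).shift t = j / 3 := neg_neg _

theorem arcZ_δ {j : ℤ} : (arcZ k j).δ = 0 := rfl

theorem arcZ_idx {j : ℤ} (t) : (arcZ k j).idx t = j := by
  rw [ShiftedSum.idx, arcZ_shift, arcZ_arc, three_mul_div_add_arcOf]

/-- The matrix with entry `1` between two arcs. -/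
def unitMor (k : Type*) [Field k] (i j : ℤ) : Hom (arcZ k i) (arcZ k j) := Matrix.of fun _ _ => 1

theorem unitMor_apply (i j : ℤ) (s t) : unitMor k i j s t = 1 := rfl

theorem d_of_δ_eq_zero (hX : X.δ = 0) (hY : Y.δ = 0) (f : Hom X Y) : d X Y f = 0 := by
  rw [d_apply, hX, hY]; simp

theorem unitMor_mem {i j n : ℤ} (h : j + 3 * n - i = 0 ∨ j + 3 * n - i = 1) :
    unitMor k i j ∈ cocycles (arcZ k i) (arcZ k j) n := by
  refine ⟨mem_homDeg_iff.2 fun x y _ => ?_, d_of_δ_eq_zero rfl rfl _⟩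
  rwa [arcZ_idx, arcZ_idx]

theorem unitMor_self (i : ℤ) : unitMor k i i = 1 := by
  ext s t
  rw [eq_pt s, eq_pt t, Matrix.one_apply_eq]; rfl

theorem comp_unitMor (i j l : ℤ) : cmp (arcZ k i) (arcZ k j) (arcZ k l) (unitMor k j l)
    (unitMor k i j) = ((coefTwo (arcOf i) (arcOf j) (arcOf l) ((i / 3 : ℤ) : ZMod 2)
      ((j / 3 : ℤ) : ZMod 2) : ℤ) : k) • unitMor k i l := by
  rw [cmp, comp_eq, arcZ_δ, arcZ_δ, arcZ_δ]
  ext s t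
  rw [Matrix.add_apply, Matrix.add_apply, Matrix.add_apply, mu2_std_apply, sum_arcZ]
  simp [unitMor_apply, arcZ_shift, arcZ_arc]

theorem comp_unitMor_eq_zero {i j l m n : ℤ} (h : j + 3 * n - i = 1) (h' : l + 3 * m - j = 1) :
    cmp (arcZ k i) (arcZ k j) (arcZ k l) (unitMor k j l) (unitMor k i j) = 0 := by
  have h1 : arcOf j = arcOf i + 1 := (arcOf_eq_add_one_iff i j).2 (by omega)
  have h2 : arcOf l = arcOf j + 1 := (arcOf_eq_add_one_iff j l).2 (by omega)
  have key : ∀ a : Fin 3, ∀ s t : ZMod 2, coefTwo a (a + 1) (a + 1 + 1) s t = 0 := by decide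
  rw [comp_unitMor, h2, h1, key]; simp

theorem exists_comp_unitMor {i j l m n : ℤ} (h : j + 3 * n - i = 0 ∨ j + 3 * n - i = 1)
    (h' : l + 3 * m - j = 0 ∨ l + 3 * m - j = 1) (hh : l + 3 * (m + n) - i ≤ 1) : ∃ c : k, c ≠ 0 ∧
    cmp (arcZ k i) (arcZ k j) (arcZ k l) (unitMor k j l) (unitMor k i j) = c • unitMor k i l := by
  refine ⟨_, ?_, comp_unitMor i j l⟩
  have key : ∀ a b c : Fin 3, ∀ s t : ZMod 2, (b = a ∧ (c = b ∨ c = b + 1)) ∨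
      (b = a + 1 ∧ c = b) → coefTwo a b c s t = 1 ∨ coefTwo a b c s t = -1 := by decide
  rcases key (arcOf i) (arcOf j) (arcOf l) ((i / 3 : ℤ) : ZMod 2) ((j / 3 : ℤ) : ZMod 2)
    (by rw [arcOf_eq_add_one_iff, arcOf_eq_add_one_iff, arcOf_eq_iff, arcOf_eq_iff]; omega)
    with h1 | h1 <;> rw [h1] <;> simp

/-- The disk sequence: three consecutive nontrivial morphisms lead back to the initial arc up to
shift. Only the nonvanishing of the coefficient matters below, not its sign. -/
theorem exists_mu3_unitMor {a b c e l m n : ℤ} (h : b + 3 * l - a = 1) (h' : c + 3 * m - b = 1)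
    (h'' : e + 3 * n - c = 1) : ∃ x : k, x ≠ 0 ∧
    mu3 stdFol (unitMor k c e) (unitMor k b c) (unitMor k a b) = x • unitMor k a e := by
  refine ⟨((coefThree (arcOf a) (arcOf b) (arcOf c) (arcOf e) ((a / 3 : ℤ) : ZMod 2)
      ((b / 3 : ℤ) : ZMod 2) ((c / 3 : ℤ) : ZMod 2) : ℤ) : k), ?_, ?_⟩
  · have key : ∀ a : Fin 3, ∀ s t u : ZMod 2, coefThree a (a + 1) (a + 1 + 1) (a + 1 + 1 + 1) s t u
        = 1 ∨ coefThree a (a + 1) (a + 1 + 1) (a + 1 + 1 + 1) s t u = -1 := by decide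
    have h1 : arcOf b = arcOf a + 1 := (arcOf_eq_add_one_iff a b).2 (by omega)
    have h2 : arcOf c = arcOf b + 1 := (arcOf_eq_add_one_iff b c).2 (by omega)
    have h3 : arcOf e = arcOf c + 1 := (arcOf_eq_add_one_iff c e).2 (by omega)
    rw [h3, h2, h1]
    rcases key (arcOf a) ((a / 3 : ℤ) : ZMod 2) ((b / 3 : ℤ) : ZMod 2) ((c / 3 : ℤ) : ZMod 2)
      with h4 | h4 <;> rw [h4] <;> simp
  · ext s t
    simp only [mu3_std_apply, sum_arcZ]
    simp [unitMor_apply, arcZ_shift, arcZ_arc]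

theorem unitMor_isGradedIso {i j n : ℤ} (h : j + 3 * n - i = 0) :
    IsGradedIso (arcZ k i) (arcZ k j) (unitMor k i j) n := by
  obtain ⟨c, hc, h1⟩ := exists_comp_unitMor (k := k) (i := i) (j := j) (l := i) (n := n) (m := -n)
    (Or.inl h) (Or.inl (by omega)) (by omega)
  obtain ⟨c', hc', h2⟩ := exists_comp_unitMor (k := k) (i := j) (j := i) (l := j) (n := -n) (m := n)
    (Or.inl (by omega)) (Or.inl (by omega)) (by omega)
  refine ⟨unitMor_mem (Or.inl h), unitMor k j i, unitMor_mem (Or.inl (by omega)),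
    ⟨c, hc, ?_⟩, ⟨c', hc', ?_⟩⟩
  · rw [h1, unitMor_self, sub_self]; exact zero_mem _
  · rw [h2, unitMor_self, sub_self]; exact zero_mem _

/-! ### Exactness -/

/-- A Toda bracket argument for the arcs `E_h`, `E_i`, `E_j`. If `g ∘ α = du`, then `u ∘ β - μ₃(g,
α, β)` is closed on `E_j`. Its composite with `α' : E_i → E_j` is cohomologous to `-g ∘ μ₃(α, β,
α')`, and `μ₃(α, β, α')` is a nonzero multiple `x` of the identity. -/
theorem exists_comp_unitMor_of_comp_mem {h i j : ℤ} (hi : i = h + 1) (hj : j = i + 1)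
    {g : Hom (arcZ k i) X} (hg : g ∈ cocycles (arcZ k i) X 0)
    (hgα : cmp (arcZ k h) (arcZ k i) X g (unitMor k h i) ∈ coboundaries (arcZ k h) X 0) :
    ∃ g' ∈ cocycles (arcZ k j) X 0,
      cmp (arcZ k i) (arcZ k j) X g' (unitMor k i j) - g ∈ coboundaries (arcZ k i) X 0 := by
  have hα : unitMor k h i ∈ cocycles (arcZ k h) (arcZ k i) 0 := unitMor_mem (Or.inr (by omega))
  have hβ : unitMor k j h ∈ cocycles (arcZ k j) (arcZ k h) 1 := unitMor_mem (Or.inr (by omega))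
  have hα' : unitMor k i j ∈ cocycles (arcZ k i) (arcZ k j) 0 := unitMor_mem (Or.inr (by omega))
  have hαβ : cmp (arcZ k j) (arcZ k h) (arcZ k i) (unitMor k h i) (unitMor k j h) = 0 :=
    comp_unitMor_eq_zero (n := 1) (m := 0) (by omega) (by omega)
  have hβα : cmp (arcZ k i) (arcZ k j) (arcZ k h) (unitMor k j h) (unitMor k i j) = 0 :=
    comp_unitMor_eq_zero (n := 0) (m := 1) (by omega) (by omega)
  obtain ⟨x, hx, h3⟩ := exists_mu3_unitMor (k := k) (a := i) (b := j) (c := h) (e := i) (l := 0)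
    (m := 1) (n := 0) (by omega) (by omega) (by omega)
  rw [unitMor_self] at h3
  obtain ⟨u, hu, hdu⟩ := exists_of_mem_coboundaries hgα (m := -1) (by ring)
  set α := unitMor k h i
  set β := unitMor k j h
  set α' := unitMor k i j
  rw [mem_cocycles] at hg hα hβ hα'
  -- the closed morphism `uβ - μ₃(g, α, β)`
  have e1 := comp_assoc_homotopy (c := g) hα.1 hβ.1
  rw [hα.2, hβ.2, hg.2, hαβ, ← hdu] at e1
  have e2 := d_comp hu hβ.1
  rw [hβ.2] at e2
  have e3 := comp_assoc_homotopy (c := u) hβ.1 hα'.1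
  rw [hβ.2, hα'.2, hβα, hdu] at e3
  have e4 := comp_mu3_relation (e := g) (c := α) hβ.1 hα'.1
  rw [hβα, hαβ, h3] at e4
  simp only [sgn_one, sgn_zero, mu3_zero_left, mu3_zero_mid, mu3_zero_right, comp_zero_right,
    comp_smul_right, comp_one_right hg.1, smul_zero, sub_zero, add_zero] at e1 e2 e3 e4
  have hg' : cmp (arcZ k j) (arcZ k h) X u β - mu3 stdFol g α β ∈ cocycles (arcZ k j) X 0 := by
    refine ⟨sub_mem (comp_mem hu hβ.1 (by ring)) (mu3_mem hg.1 hα.1 hβ.1 (by ring)), ?_⟩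
    change d _ _ _ = 0
    rw [map_sub]
    linear_combination (norm := module) e2 - e1
  refine ⟨-(x⁻¹ • (cmp (arcZ k j) (arcZ k h) X u β - mu3 stdFol g α β)),
    neg_mem (Submodule.smul_mem _ _ hg'), ?_⟩
  have e5 : cmp (arcZ k i) (arcZ k j) X (-(x⁻¹ • (cmp (arcZ k j) (arcZ k h) X u β -
      mu3 stdFol g α β))) α' - g = -(x⁻¹ • d (arcZ k i) X (mu3 stdFol u β α')) := by
    rw [← neg_smul, comp_smul_left, comp_sub_left]
    have hxx : g = x⁻¹ • x • g := by rw [smul_smul, inv_mul_cancel₀ hx, one_smul]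
    linear_combination (norm := module) x⁻¹ • (e3 - e4) - hxx
  rw [e5]
  exact neg_mem (Submodule.smul_mem _ _
    (d_mem_coboundaries (mu3_mem (r := -1) hu hβ.1 hα'.1 (by ring)) (by ring)))

/-- Precomposition with the nontrivial path between consecutive arcs. -/
def alphaMap (X : Tw k stdFol) {i j : ℤ} (h : j = i + 1) :
    Ext (arcZ k j) X 0 →ₗ[k] Ext (arcZ k i) X 0 :=
  pull X (unitMor_mem (i := i) (j := j) (n := 0) (Or.inr (by omega))) (by ring)

theorem range_alphaMap (X : Tw k stdFol) {h i j : ℤ} (hi : i = h + 1) (hj : j = i + 1) :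
    LinearMap.range (alphaMap X hj) = LinearMap.ker (alphaMap X hi) := by
  ext ξ
  constructor
  · rintro ⟨η, rfl⟩
    obtain ⟨f, hf, rfl⟩ := exists_extMk η
    rw [LinearMap.mem_ker, alphaMap, alphaMap, pull_mk, pull_mk, extMk_eq_zero]
    have := comp_assoc_mem hf (unitMor_mem (i := i) (j := j) (n := 0) (Or.inr (by omega)))
      (unitMor_mem (i := h) (j := i) (n := 0) (Or.inr (by omega))) (r := 0) (by ring)
    rw [comp_unitMor_eq_zero (n := 0) (m := 0) (by omega) (by omega)] at this
    simpa using this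
  · intro hξ
    obtain ⟨g, hg, rfl⟩ := exists_extMk ξ
    rw [LinearMap.mem_ker, alphaMap, pull_mk, extMk_eq_zero] at hξ
    obtain ⟨g', hg', hgg⟩ := exists_comp_unitMor_of_comp_mem hi hj hg hξ
    exact ⟨extMk g' hg', by rw [alphaMap, pull_mk, extMk_eq_extMk]; exact hgg⟩

/-- The multiplicity of the `j`-th arc in a twisted complex. -/
def mult (X : Tw k stdFol) (j : ℤ) : ℕ :=
  Module.finrank k (LinearMap.range (alphaMap X (i := j - 1) (j := j) (by ring)))

theorem mult_eq (X : Tw k stdFol) {i j : ℤ} (h : j = i + 1) :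
    mult X j = Module.finrank k (LinearMap.range (alphaMap X h)) := by
  obtain rfl : i = j - 1 := by omega
  rfl

theorem finrank_ker_alphaMap (X : Tw k stdFol) {i j l : ℤ} (h : j = i + 1) (hl : l = j + 1) :
    Module.finrank k (LinearMap.ker (alphaMap X h)) = mult X l := by
  rw [← range_alphaMap X h hl, mult_eq X hl]

/-- Rank–nullity for restriction from `E_j` to `E_{j-1}`, whose kernel is by exactness the image of
restriction from `E_{j+1}`. -/
theorem finrank_ext_arcZ (X : Tw k stdFol) (j : ℤ) :
    Module.finrank k (Ext (arcZ k j) X 0) = mult X j + mult X (j + 1) := by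
  have h : j = (j - 1) + 1 := by ring
  rw [← LinearMap.finrank_range_add_finrank_ker (alphaMap X h), ← mult_eq X h,
    finrank_ker_alphaMap X h rfl]

/-- Descending induction from the range where the functions agree. Multiplicities vanish for large
indices, so the dimensions of `Hom(E_j, X)` determine them. -/
theorem eq_of_add_succ_eq {f g : ℤ → ℕ} (h : ∀ j, f j + f (j + 1) = g j + g (j + 1)) {N : ℤ}
    (hf : ∀ j, N ≤ j → f j = g j) : f = g := by
  have key : ∀ n : ℕ, ∀ j, N - n ≤ j → f j = g j := by
    intro n
    induction n with
    | zero => intro j hj; exact hf j (by simpa using hj)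
    | succ n ih =>
      intro j hj
      have h1 := ih (j + 1) (by push_cast at hj; omega)
      have h2 := h j
      omega
  funext j
  exact key (N - j).toNat j (by omega)

theorem exists_bound (X : Tw k stdFol) : ∃ N : ℤ, ∀ x, |X.idx x| ≤ N := by
  obtain ⟨N, hN⟩ := (Set.finite_range fun x => |X.idx x|).bddAbove
  exact ⟨N, fun x => hN ⟨x, rfl⟩⟩

theorem mult_eq_zero {X : Tw k stdFol} {N : ℤ} (hN : ∀ x, |X.idx x| ≤ N) {j : ℤ}
    (hj : N < |j| - 1) : mult X j = 0 := by
  have h0 : ∀ ξ : Ext (arcZ k j) X 0, ξ = 0 := by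
    intro ξ
    obtain ⟨f, hf, rfl⟩ := exists_extMk ξ
    have : f = 0 := by
      ext t x
      by_contra hne
      have h1 := mem_homDeg_iff.1 hf.1 t x hne
      have h2 := hN x
      rw [arcZ_idx] at h1
      rcases abs_cases j with h3 | h3 <;> rcases abs_cases (X.idx x) with h4 | h4 <;> omega
    rw [extMk_eq_zero, this]; exact zero_mem _
  have : LinearMap.range (alphaMap X (i := j - 1) (j := j) (by ring)) = ⊥ := by
    rw [LinearMap.range_eq_bot]
    exact LinearMap.ext fun ξ => by rw [h0 ξ, map_zero, map_zero]
  rw [mult, this, finrank_bot]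

end Tw

/-! ### Direct sums of arcs and the classification of objects. -/

theorem finrank_homDeg {k : Type*} [Field k] (P Q : ShiftedSum) (n : ℤ) :
    Module.finrank k (homDeg (k := k) stdFol P Q n) =
      (Finset.univ.filter fun p : Fin P.size × Fin Q.size =>
        Q.idx p.2 + 3 * n - P.idx p.1 = 0 ∨ Q.idx p.2 + 3 * n - P.idx p.1 = 1).card := by
  classical
  let c : Fin P.size × Fin Q.size → Prop := fun p =>
    Q.idx p.2 + 3 * n - P.idx p.1 = 0 ∨ Q.idx p.2 + 3 * n - P.idx p.1 = 1
  let e : homDeg (k := k) stdFol P Q n ≃ₗ[k] ({p // c p} → k) :=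
    { toFun := fun f p => f.1 p.1.1 p.1.2
      map_add' := fun _ _ => rfl
      map_smul' := fun _ _ => rfl
      invFun := fun g => ⟨Matrix.of fun x y => if h : c (x, y) then g ⟨(x, y), h⟩ else 0,
        mem_homDeg_iff.2 fun x y hxy => by
          by_contra hc
          exact hxy (dif_neg hc)⟩
      left_inv := fun f => by
        apply Subtype.ext
        ext x y
        by_cases hc : c (x, y)
        · simp [hc]
        · have : f.1 x y = 0 := by
            by_contra h0
            exact hc (mem_homDeg_iff.1 f.2 x y h0)
          simp [hc, this]
      right_inv := fun g => by
        funext p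
        simp [p.2] }
  rw [e.finrank_eq, Module.finrank_pi, Fintype.card_subtype]

namespace Tw

variable {k : Type*} [Field k] {X Y W : Tw k stdFol}

theorem coboundaries_eq_bot (hX : X.δ = 0) (hY : Y.δ = 0) (n : ℤ) : coboundaries X Y n = ⊥ := by
  rw [eq_bot_iff]
  rintro _ ⟨u, -, rfl⟩
  exact d_of_δ_eq_zero hX hY u

theorem cocycles_eq_homOf (hX : X.δ = 0) (hY : Y.δ = 0) (n : ℤ) : cocycles X Y n = homOf X Y n :=
  inf_eq_left.2 fun f _ => d_of_δ_eq_zero hX hY f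

theorem finrank_ext_of_δ_eq_zero (hX : X.δ = 0) (hY : Y.δ = 0) (n : ℤ) :
    Module.finrank k (Ext X Y n) = (Finset.univ.filter fun p : Fin X.size × Fin Y.size =>
        Y.idx p.2 + 3 * n - X.idx p.1 = 0 ∨ Y.idx p.2 + 3 * n - X.idx p.1 = 1).card := by
  have h : (coboundaries X Y n).submoduleOf (cocycles X Y n) = ⊥ := by
    rw [coboundaries_eq_bot hX hY, eq_bot_iff]
    exact fun f hf => Subtype.ext hf
  rw [(Submodule.quotEquivOfEqBot _ h).finrank_eq, cocycles_eq_homOf hX hY, finrank_homDeg]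

/-- The direct sum of the arcs with given numbers. -/
def sumArcs (k : Type*) [Field k] {N : ℕ} (J : Fin N → ℤ) : Tw k stdFol where
  size := N
  arc x := arcOf (J x)
  shift x := J x / 3
  δ := 0
  δ_deg := Submodule.zero_mem _
  δ_tri := fun _ _ hxy => absurd rfl hxy
  mc := by simp

theorem sumArcs_idx {N : ℕ} (J : Fin N → ℤ) (x : Fin (sumArcs k J).size) :
    (sumArcs k J).idx x = J x :=
  three_mul_div_add_arcOf (J x)

theorem finrank_ext_arcZ_sumArcs {N : ℕ} (J : Fin N → ℤ) (j n : ℤ) :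
    Module.finrank k (Ext (arcZ k j) (sumArcs k J) n) =
      (Finset.univ.filter fun x => J x + 3 * n - j = 0 ∨ J x + 3 * n - j = 1).card := by
  rw [finrank_ext_of_δ_eq_zero rfl rfl]
  refine Finset.card_bij (fun p _ => p.2) ?_ ?_ ?_
  · intro p hp
    rw [Finset.mem_filter, arcZ_idx, sumArcs_idx] at hp
    exact Finset.mem_filter.2 ⟨Finset.mem_univ _, hp.2⟩
  · rintro ⟨t, x⟩ _ ⟨t', x'⟩ _ h
    exact Prod.ext ((eq_pt t).trans (eq_pt t').symm) h
  · intro x hx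
    refine ⟨(pt k j, x), ?_, rfl⟩
    rw [Finset.mem_filter, arcZ_idx, sumArcs_idx]
    exact ⟨Finset.mem_univ _, (Finset.mem_filter.1 hx).2⟩

theorem finrank_ext_sumArcs_arcZ {N : ℕ} (J : Fin N → ℤ) (j n : ℤ) :
    Module.finrank k (Ext (sumArcs k J) (arcZ k j) n) =
      (Finset.univ.filter fun x => j + 3 * n - J x = 0 ∨ j + 3 * n - J x = 1).card := by
  rw [finrank_ext_of_δ_eq_zero rfl rfl]
  refine Finset.card_bij (fun p _ => p.1) ?_ ?_ ?_
  · intro p hp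
    rw [Finset.mem_filter, arcZ_idx, sumArcs_idx] at hp
    exact Finset.mem_filter.2 ⟨Finset.mem_univ _, hp.2⟩
  · rintro ⟨x, t⟩ _ ⟨x', t'⟩ _ h
    exact Prod.ext h ((eq_pt t).trans (eq_pt t').symm)
  · intro x hx
    refine ⟨(x, pt k j), ?_, rfl⟩
    rw [Finset.mem_filter, arcZ_idx, sumArcs_idx]
    exact ⟨Finset.mem_univ _, (Finset.mem_filter.1 hx).2⟩

theorem eventually_mult_eq_zero (X : Tw k stdFol) : ∃ N : ℤ, ∀ j, N ≤ |j| → mult X j = 0 := by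
  obtain ⟨N, hN⟩ := exists_bound X
  exact ⟨N + 2, fun j hj => mult_eq_zero hN (by omega)⟩

/-- The multiplicities of a twisted complex. -/
def multFinsupp (X : Tw k stdFol) : ℤ →₀ ℕ := Finsupp.ofSupportFinite (mult X) (by
  obtain ⟨N, hN⟩ := eventually_mult_eq_zero X
  refine (Set.finite_Icc (-N) N).subset fun j hj => ?_
  by_contra hj'
  refine hj (hN j ?_)
  rw [Set.mem_Icc, ← abs_le] at hj'
  omega)

@[simp] theorem multFinsupp_apply (X : Tw k stdFol) (j : ℤ) : multFinsupp X j = mult X j := rfl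

theorem mult_eq_of_finrank_eq
    (h : ∀ j, Module.finrank k (Ext (arcZ k j) X 0) = Module.finrank k (Ext (arcZ k j) Y 0)) :
    multFinsupp X = multFinsupp Y := by
  obtain ⟨N, hN⟩ := eventually_mult_eq_zero X
  obtain ⟨M, hM⟩ := eventually_mult_eq_zero Y
  apply DFunLike.coe_injective
  refine eq_of_add_succ_eq (N := max N M) (fun j => ?_) fun j hj => ?_
  · have := h j
    rwa [finrank_ext_arcZ, finrank_ext_arcZ] at this
  · have := le_abs_self j
    rw [multFinsupp_apply, multFinsupp_apply, hN j (by omega), hM j (by omega)]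

theorem Iso.multFinsupp_eq (h : Iso X Y) : multFinsupp X = multFinsupp Y :=
  mult_eq_of_finrank_eq fun _ => h.finrank_ext_right _ _

theorem mult_sumArcs {N : ℕ} (J : Fin N → ℤ) (j : ℤ) :
    mult (sumArcs k J) j = (Finset.univ.filter fun x => J x = j).card := by
  obtain ⟨M, hM⟩ := eventually_mult_eq_zero (sumArcs k J)
  obtain ⟨M', hM'⟩ := exists_bound (sumArcs k J)
  refine congrFun (eq_of_add_succ_eq (f := mult (sumArcs k J))
    (g := fun j => (Finset.univ.filter fun x => J x = j).card)
    (N := max M (M' + 1)) (fun j => ?_) fun j hj => ?_) j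
  · rw [← finrank_ext_arcZ, finrank_ext_arcZ_sumArcs, ← Finset.card_union_of_disjoint]
    · congr 1
      ext x
      simp only [Finset.mem_filter, Finset.mem_univ, true_and, Finset.mem_union]
      omega
    · rw [Finset.disjoint_filter]
      intro x _ h1; omega
  · have := le_abs_self j
    rw [hM j (by omega), eq_comm, Finset.card_eq_zero, Finset.filter_eq_empty_iff]
    intro x _ hx
    have h1 : |J x| ≤ M' := by rw [← sumArcs_idx (k := k) J x]; exact hM' x
    rw [hx] at h1
    omega

/-- The index type of the standard object with given multiplicities. -/
abbrev StdIndex (b : ℤ →₀ ℕ) : Type := Σ j : b.support, Fin (b j)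

/-- The numbering of the summands of the standard object. -/
def stdIdx (b : ℤ →₀ ℕ) (x : Fin (Fintype.card (StdIndex b))) : ℤ :=
  ((Fintype.equivFin (StdIndex b)).symm x).1

/-- The standard object with given multiplicities. -/
def std (k : Type*) [Field k] (b : ℤ →₀ ℕ) : Tw k stdFol := sumArcs k (stdIdx b)

theorem card_stdIdx (b : ℤ →₀ ℕ) (j : ℤ) :
    (Finset.univ.filter fun x => stdIdx b x = j).card = b j := by
  have h1 : (Finset.univ.filter fun x => stdIdx b x = j).card =
      (Finset.univ.filter fun y : StdIndex b => (y.1 : ℤ) = j).card := by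
    refine Finset.card_equiv (Fintype.equivFin (StdIndex b)).symm fun x => ?_
    rw [Finset.mem_filter, Finset.mem_filter]
    simp only [Finset.mem_univ, true_and]
    rfl
  rw [h1]
  by_cases hj : j ∈ b.support
  · rw [← Fintype.card_fin (b j), ← Finset.card_univ]
    symm
    refine Finset.card_bij (fun t _ => (⟨⟨j, hj⟩, t⟩ : StdIndex b)) ?_ ?_ ?_
    · simp
    · intro t _ t' _ h
      simpa using h
    · rintro ⟨⟨i, hi⟩, t⟩ hit
      simp only [Finset.mem_filter, Finset.mem_univ, true_and] at hit
      subst hit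
      exact ⟨t, Finset.mem_univ _, rfl⟩
  · rw [Finsupp.notMem_support_iff.1 hj, Finset.card_eq_zero, Finset.filter_eq_empty_iff]
    rintro y _ rfl
    exact hj y.1.2

theorem multFinsupp_std (b : ℤ →₀ ℕ) : multFinsupp (std k b) = b := by
  ext j
  rw [multFinsupp_apply, std, mult_sumArcs, card_stdIdx]

/-- The inclusion of (or the nontrivial path to) a summand of a direct sum of arcs. -/
def toSummand (k : Type*) [Field k] {N : ℕ} (J : Fin N → ℤ) (i : ℤ) (x : Fin N) :
    Hom (arcZ k i) (sumArcs k J) := Matrix.of fun _ (y : Fin N) => if y = x then 1 else 0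

theorem toSummand_mem {N : ℕ} (J : Fin N → ℤ) {i : ℤ} {x : Fin N} (h : J x = i ∨ J x = i + 1) :
    toSummand k J i x ∈ cocycles (arcZ k i) (sumArcs k J) 0 := by
  refine ⟨mem_homDeg_iff.2 fun t y hty => ?_, d_of_δ_eq_zero rfl rfl _⟩
  have hyx : (y : Fin N) = x := by
    by_contra hne
    exact hty (if_neg hne)
  rw [arcZ_idx, sumArcs_idx, show J y = J x from congrArg J hyx]
  omega

/-- The morphism from a direct sum of arcs with given components. -/
def fromSum {N : ℕ} {J : Fin N → ℤ} (c : ∀ x, Hom (arcZ k (J x)) X) : Hom (sumArcs k J) X :=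
  Matrix.of fun x z => c x (pt k _) z

theorem fromSum_mem {N : ℕ} {J : Fin N → ℤ} {c : ∀ x, Hom (arcZ k (J x)) X}
    (hc : ∀ x, c x ∈ cocycles (arcZ k (J x)) X 0) : fromSum c ∈ cocycles (sumArcs k J) X 0 := by
  refine ⟨mem_homDeg_iff.2 fun x z hxz => ?_, ?_⟩
  · have := mem_homDeg_iff.1 (hc x).1 (pt k _) z hxz
    rw [arcZ_idx] at this
    rwa [sumArcs_idx]
  · change d _ _ _ = 0
    ext x z
    have h1 : d (arcZ k (J x)) X (c x) = 0 := (hc x).2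
    have h2 := congrFun (congrFun h1 (pt k _)) z
    rw [d_apply] at h2 ⊢
    rw [show (sumArcs k J).δ = 0 from rfl]
    rw [arcZ_δ] at h2
    simp only [mu2_zero_right, mu3_zero_right, add_zero, Matrix.add_apply] at h2 ⊢
    rw [mu2_std_apply, mu3_std_apply, arcZ_shift, arcZ_arc] at h2
    rw [mu2_std_apply, mu3_std_apply]
    exact h2

theorem comp_fromSum_toSummand {N : ℕ} {J : Fin N → ℤ} (c : ∀ x, Hom (arcZ k (J x)) X) (i : ℤ)
    (x : Fin N) : cmp (arcZ k i) (sumArcs k J) X (fromSum c) (toSummand k J i x) =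
      cmp (arcZ k i) (arcZ k (J x)) X (c x) (unitMor k i (J x)) := by
  rw [cmp, cmp, comp_eq, comp_eq, arcZ_δ, arcZ_δ, show (sumArcs k J).δ = 0 from rfl]
  simp only [mu3_zero_right, mu3_zero_mid, add_zero]
  ext t z
  rw [Matrix.add_apply, Matrix.add_apply, mu2_std_apply, mu2_std_apply, mu3_std_apply,
    mu3_std_apply, sum_arcZ, sum_arcZ]
  have h0 : ∀ y : Fin N, y ≠ x → toSummand k J i x t y = 0 := fun y hy => if_neg hy
  have h1 : toSummand k J i x t x = 1 := if_pos rfl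
  rw [arcZ_shift, arcZ_shift, arcZ_arc, arcZ_arc, unitMor_apply]
  refine congrArg₂ (· + ·) ?_ ?_
  · refine (Finset.sum_eq_single (ι := Fin N) x (fun y _ hy => ?_)
      fun h => absurd (Finset.mem_univ x) h).trans ?_
    · rw [h0 y hy, mul_zero, mul_zero]
    · rw [h1]; rfl
  · refine (Finset.sum_eq_single (ι := Fin N) x (fun y _ hy => ?_)
      fun h => absurd (Finset.mem_univ x) h).trans ?_
    · refine Finset.sum_eq_zero fun z' _ => ?_
      rw [h0 y hy, mul_zero, mul_zero, mul_zero]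
    · rw [h1]; rfl

/-- Lifts of a basis of the range span a complement of the kernel. -/
theorem exists_span_sup_ker {V V' : Type*} [AddCommGroup V] [Module k V] [AddCommGroup V']
    [Module k V'] [FiniteDimensional k V'] (T : V →ₗ[k] V') :
    ∃ e : Fin (Module.finrank k (LinearMap.range T)) → V,
      Submodule.span k (Set.range e) ⊔ LinearMap.ker T = ⊤ := by
  let B := Module.finBasis k (LinearMap.range T)
  choose e he using fun t => (B t).2
  refine ⟨e, ?_⟩
  rw [eq_top_iff]
  intro v _
  have h1 := B.sum_repr ⟨T v, v, rfl⟩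
  have h2 := congrArg Subtype.val h1
  simp only [AddSubmonoidClass.coe_finsetSum, SetLike.val_smul] at h2
  rw [Submodule.mem_sup]
  refine ⟨∑ t, B.repr ⟨T v, v, rfl⟩ t • e t, Submodule.sum_mem _ fun t _ =>
    Submodule.smul_mem _ _ (Submodule.subset_span ⟨t, rfl⟩),
    v - ∑ t, B.repr ⟨T v, v, rfl⟩ t • e t, ?_, by simp⟩
  rw [LinearMap.mem_ker, map_sub, map_sum, sub_eq_zero]
  refine h2.symm.trans (Finset.sum_congr rfl fun t _ => ?_)
  rw [map_smul, he]

/-- Precomposition with the graded isomorphism between `E_{j-3n}` and `E_j` turns extensions of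
degree `n` into morphisms of degree zero from another arc. -/
theorem push_bijective_of_arcZ {f : Hom X Y} (hf : f ∈ cocycles X Y 0)
    (h : ∀ j, Function.Bijective (push (arcZ k j) hf (n := 0) (r := 0) (by ring))) (j n : ℤ) :
    Function.Bijective (push (arcZ k j) hf (n := n) (r := n) (by ring)) := by
  have hτ : IsGradedIso (arcZ k (j - 3 * n)) (arcZ k j) (unitMor k (j - 3 * n) j) (-n) :=
    unitMor_isGradedIso (by ring)
  constructor
  · refine extMap_injective fun u hu hfu => ?_
    have h1 := comp_mem_coboundaries_left hfu hτ.1 (r := 0) (by ring)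
    have h2 := comp_assoc_mem hf hu hτ.1 (r := 0) (by ring)
    have h3 := add_mem h2 (Submodule.smul_mem _ (sgn k (-n)) h1)
    simp only [postComp_apply, sub_add_cancel] at h3
    have h4 := comp_mem_cocycles hu hτ.1 (r := 0) (by ring)
    refine hτ.mem_coboundaries_of_comp_right hu (r := 0) ?_ (by ring)
    rw [← extMk_eq_zero (hf := h4)]
    apply (h _).1
    rw [push_mk, map_zero, extMk_eq_zero]
    exact h3
  · refine extMap_surjective fun g hg => ?_
    have h1 := comp_mem_cocycles hg hτ.1 (r := 0) (by ring)
    obtain ⟨ξ, hξ⟩ := (h _).2 (extMk _ h1)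
    obtain ⟨u₀, hu₀, rfl⟩ := exists_extMk ξ
    rw [push_mk, extMk_eq_extMk] at hξ
    obtain ⟨u, hu, huu⟩ := hτ.exists_comp_right hu₀ (n := n) (by ring)
    have h2 := comp_mem_coboundaries_right hf huu (r := 0) (by ring)
    rw [comp_sub_right] at h2
    have h3 := comp_assoc_mem hf hu hτ.1 (r := 0) (by ring)
    have h4 := sub_mem (add_mem hξ h2) h3
    refine ⟨sgn k (-n) • u, Submodule.smul_mem _ _ hu, ?_⟩
    rw [map_smul, postComp_apply]
    refine hτ.mem_coboundaries_of_comp_right (r := 0) (sub_mem (Submodule.smul_mem _ _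
      (comp_mem_cocycles hf hu (by ring))) hg) ?_ (by ring)
    rw [comp_sub_left, comp_smul_left]
    convert h4 using 1
    abel

theorem isInvertible_of_arcZ {f : Hom X Y} (hf : f ∈ cocycles X Y 0)
    (h : ∀ j, Function.Bijective (push (arcZ k j) hf (n := 0) (r := 0) (by ring))) :
    IsInvertible (⟨f, hf⟩ : cocycles X Y 0) := by
  refine isInvertible_of_push_bijective hf fun i l n => ?_
  rw [suspArc_eq_arcZ]
  exact push_bijective_of_arcZ hf h _ n

/-- For each `j` choose `mult X j` morphisms from `E_j` to `X` whose restrictions to `E_{j-1}` form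
a basis of the image of `alphaMap`. Together they give a morphism from the sum of arcs to `X`. It is
onto on `Hom(E_j, -)` for every `j`, hence bijective there by equality of dimensions, hence
invertible. -/
theorem iso_std (X : Tw k stdFol) : Iso (std k (multFinsupp X)) X := by
  set b := multFinsupp X with hb
  have hex : ∀ j, ∃ e : Fin (mult X j) → Ext (arcZ k j) X 0,
      Submodule.span k (Set.range e) ⊔ LinearMap.ker (alphaMap X (i := j - 1) (j := j) (by ring)) =
        ⊤ := fun j => exists_span_sup_ker _
  choose e he using hex
  let y : Fin (Fintype.card (StdIndex b)) → StdIndex b := (Fintype.equivFin (StdIndex b)).symm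
  have hy : Function.Surjective y := (Fintype.equivFin (StdIndex b)).symm.surjective
  choose c hc hce using fun x => exists_extMk (X := arcZ k (stdIdx b x)) (e (y x).1 (y x).2)
  have hφ : fromSum (J := stdIdx b) c ∈ cocycles (std k b) X 0 := fromSum_mem hc
  have hmem : ∀ j t, e j t ∈ LinearMap.range (push (arcZ k j) hφ (n := 0) (r := 0) (by ring)) := by
    intro j t
    have hj : j ∈ b.support := Finsupp.mem_support_iff.2 (fun h0 => by
      have : mult X j = 0 := h0
      exact (Fin.cast this t).elim0)
    obtain ⟨x, hx⟩ := hy ⟨⟨j, hj⟩, t⟩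
    have h1 : e j t = e (⟨⟨j, hj⟩, t⟩ : StdIndex b).1 (⟨⟨j, hj⟩, t⟩ : StdIndex b).2 := rfl
    have h2 : e (y x).1 (y x).2 ∈
        LinearMap.range (push (arcZ k (y x).1) hφ (n := 0) (r := 0) (by ring)) := by
      refine ⟨extMk _ (toSummand_mem (stdIdx b) (x := x) (Or.inl rfl)), ?_⟩
      have h3 := comp_fromSum_toSummand (J := stdIdx b) c (stdIdx b x) x
      rw [unitMor_self, comp_one_right (hc x).1] at h3
      refine Eq.trans (extMk_eq_extMk.2 ?_) (hce x)
      have h4 : cmp (arcZ k (stdIdx b x)) (sumArcs k (stdIdx b)) X (fromSum (J := stdIdx b) c)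
        (toSummand k (stdIdx b) (stdIdx b x) x) - c x ∈ coboundaries (arcZ k (stdIdx b x)) X 0 := by
        rw [h3, sub_self]; exact zero_mem _
      exact h4
    rw [hx] at h2
    exact h2
  have hmemα : ∀ i j (hij : j = i + 1) t, alphaMap X hij (e j t) ∈
      LinearMap.range (push (arcZ k i) hφ (n := 0) (r := 0) (by ring)) := by
    intro i j hij t
    have hj : j ∈ b.support := Finsupp.mem_support_iff.2 (fun h0 => by
      have : mult X j = 0 := h0
      exact (Fin.cast this t).elim0)
    obtain ⟨x, hx⟩ := hy ⟨⟨j, hj⟩, t⟩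
    have h2 : ∀ hij' : ((y x).1 : ℤ) = i + 1, alphaMap X hij' (e (y x).1 (y x).2) ∈
        LinearMap.range (push (arcZ k i) hφ (n := 0) (r := 0) (by ring)) := by
      intro hij'
      refine ⟨extMk _ (toSummand_mem (stdIdx b) (x := x) (Or.inr hij')), ?_⟩
      have h3 := comp_fromSum_toSummand (J := stdIdx b) c i x
      refine Eq.trans (extMk_eq_extMk.2 ?_)
        (congrArg (alphaMap X (j := stdIdx b x) hij') (hce x))
      have h4 : cmp (arcZ k i) (sumArcs k (stdIdx b)) X (fromSum (J := stdIdx b) c)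
        (toSummand k (stdIdx b) i x) - cmp (arcZ k i) (arcZ k (stdIdx b x)) X (c x)
          (unitMor k i (stdIdx b x)) ∈ coboundaries (arcZ k i) X 0 := by
        rw [h3, sub_self]; exact zero_mem _
      exact h4
    rw [hx] at h2
    exact h2 hij
  refine ⟨⟨_, hφ⟩, isInvertible_of_arcZ hφ fun j => ?_⟩
  -- `Hom(E_j, X)` is spanned by the chosen elements and the kernel of `alphaMap`. That kernel is
  -- the image of `Hom(E_{j+1}, X)`, where the chosen elements restrict into the range by `hmemα`
  -- and the kernel restricts to zero.
  have hsurj : Function.Surjective (push (arcZ k j) hφ (n := 0) (r := 0) (by ring)) := by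
    rw [← LinearMap.range_eq_top, eq_top_iff, ← he j]
    refine sup_le (Submodule.span_le.2 ?_) ?_
    · rintro _ ⟨t, rfl⟩; exact hmem j t
    · rw [← range_alphaMap X (h := j - 1) (i := j) (j := j + 1) (by ring) rfl]
      rintro _ ⟨v, rfl⟩
      have hv : v ∈ (⊤ : Submodule k (Ext (arcZ k (j + 1)) X 0)) := trivial
      rw [← he (j + 1), Submodule.mem_sup] at hv
      obtain ⟨w, hw, z, hz, rfl⟩ := hv
      have hz' : alphaMap X (i := j) (j := j + 1) rfl z = 0 := by
        have : ∀ i (hi : j + 1 = i + 1) (hi' : j + 1 - 1 = i), alphaMap X (i := i) hi z = 0 := by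
          rintro i hi rfl; exact hz
        exact this j rfl (by ring)
      have : Submodule.span k (Set.range (e (j + 1))) ≤ (LinearMap.range (push (arcZ k j) hφ
          (n := 0) (r := 0) (by ring))).comap (alphaMap X (i := j) (j := j + 1) rfl) := by
        rw [Submodule.span_le]
        rintro _ ⟨t, rfl⟩
        exact hmemα j (j + 1) rfl t
      have h5 := this hw
      rw [Submodule.mem_comap] at h5
      rw [map_add, hz']
      exact (Submodule.add_mem_iff_left _ (zero_mem _)).2 h5
  refine ⟨(LinearMap.injective_iff_surjective_of_finrank_eq_finrank ?_).2 hsurj, hsurj⟩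
  rw [finrank_ext_arcZ, finrank_ext_arcZ, ← multFinsupp_apply, ← multFinsupp_apply,
    multFinsupp_std]
  rfl

theorem iso_iff_multFinsupp_eq : Iso X Y ↔ multFinsupp X = multFinsupp Y :=
  ⟨Iso.multFinsupp_eq, fun h => (iso_std X).symm.trans (h ▸ iso_std Y)⟩

end Tw

/-! ### Cones of morphisms from an arc, and the count of morphisms with given cone. -/

namespace Tw

variable {k : Type*} [Field k] {X Y L Z W : Tw k stdFol}

theorem finrank_ext_arcZ_arcZ (i j n : ℤ) : Module.finrank k (Ext (arcZ k i) (arcZ k j) n) =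
    if j + 3 * n - i = 0 ∨ j + 3 * n - i = 1 then 1 else 0 := by
  rw [finrank_ext_of_δ_eq_zero rfl rfl]
  simp only [arcZ_idx]
  split_ifs with h
  · rw [Finset.filter_true_of_mem fun _ _ => h]; rfl
  · rw [Finset.filter_false_of_mem fun _ _ => h]; rfl

theorem finrank_ext_arcZ_deg (L : Tw k stdFol) (j n : ℤ) :
    Module.finrank k (Ext (arcZ k j) L n) = mult L (j - 3 * n) + mult L (j - 3 * n + 1) := by
  rw [← finrank_ext_arcZ]
  exact (LinearEquiv.ofBijective _ ((unitMor_isGradedIso (k := k) (i := j - 3 * n) (j := j)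
    (n := -n) (by ring)).pull_bijective L (n := n) (r := 0) (by ring))).finrank_eq

theorem push_push {f : Hom Y L} {g : Hom X Y} (hf : f ∈ cocycles Y L 0) (hg : g ∈ cocycles X Y 0)
    (n : ℤ) (ξ : Ext W X n) :
    push W hf (n := n) (r := n) (by ring) (push W hg (n := n) (r := n) (by ring) ξ) =
      sgn k n • push W (comp_mem_cocycles hf hg (r := 0) (by ring)) (n := n) (r := n)
        (by ring) ξ := by
  obtain ⟨u, hu, rfl⟩ := exists_extMk ξ
  rw [push_mk, push_mk, push_mk]
  exact extMk_eq_extMk (hg := Submodule.smul_mem _ _ (comp_mem_cocycles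
    (comp_mem_cocycles hf hg (r := 0) (by ring)) hu (by ring))).2
    (comp_assoc_mem hf hg hu (by ring))

theorem range_push_comp {f : Hom Y L} {g : Hom X Y} (hf : f ∈ cocycles Y L 0)
    (hg : IsGradedIso X Y g 0) (n : ℤ) :
    LinearMap.range (push W hf (n := n) (r := n) (by ring)) =
      LinearMap.range (push W (comp_mem_cocycles hf hg.1 (r := 0) (by ring)) (n := n) (r := n)
        (by ring)) := by
  ext ξ
  constructor
  · rintro ⟨η, rfl⟩
    obtain ⟨θ, rfl⟩ := (hg.push_bijective W (n := n) (r := n) (by ring)).2 η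
    rw [push_push hf hg.1]
    exact Submodule.smul_mem _ _ ⟨θ, rfl⟩
  · rintro ⟨θ, rfl⟩
    refine ⟨sgn k n • push W hg.1 (n := n) (r := n) (by ring) θ, ?_⟩
    rw [map_smul, push_push hf hg.1, smul_smul, sgn_mul_self, one_smul]

theorem eq_smul_unitMor {i j : ℤ} (f : Hom (arcZ k i) (arcZ k j)) :
    f = f (pt k i) (pt k j) • unitMor k i j := by
  ext s t
  rw [eq_pt s, eq_pt t, Matrix.smul_apply, unitMor_apply, smul_eq_mul, mul_one]

theorem comp_unitMor_mem_coboundaries_iff {j l n : ℤ} {g : Hom (arcZ k j) L}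
    (hg : g ∈ cocycles (arcZ k j) L 0) (h : j + 3 * n - l = 0) :
    cmp (arcZ k l) (arcZ k j) L g (unitMor k l j) ∈ coboundaries (arcZ k l) L n ↔
      g ∈ coboundaries (arcZ k j) L 0 :=
  ⟨fun h1 => (unitMor_isGradedIso h).mem_coboundaries_of_comp_right hg h1 (by ring),
    fun h1 => comp_mem_coboundaries_left h1 (unitMor_mem (Or.inl h)) (by ring)⟩

/-- Here `E_l` is `E_{j-1}` up to shift, and the unit morphism from `E_l` to `E_j` is, up to a
nonzero scalar, the shift isomorphism followed by the path `E_{j-1} → E_j`. -/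
theorem comp_unitMor_mem_coboundaries_iff' {j l n : ℤ} {g : Hom (arcZ k j) L}
    (hg : g ∈ cocycles (arcZ k j) L 0) (h : j + 3 * n - l = 1) :
    cmp (arcZ k l) (arcZ k j) L g (unitMor k l j) ∈ coboundaries (arcZ k l) L n ↔
      cmp (arcZ k (j - 1)) (arcZ k j) L g (unitMor k (j - 1) j) ∈
        coboundaries (arcZ k (j - 1)) L 0 := by
  have hα : unitMor k (j - 1) j ∈ cocycles (arcZ k (j - 1)) (arcZ k j) 0 :=
    unitMor_mem (Or.inr (by ring))
  have hτ : unitMor k l (j - 1) ∈ cocycles (arcZ k l) (arcZ k (j - 1)) n :=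
    unitMor_mem (Or.inl (by omega))
  rw [← comp_unitMor_mem_coboundaries_iff (comp_mem_cocycles hg hα (r := 0) (by ring))
    (l := l) (n := n) (by omega)]
  obtain ⟨c, hc, h1⟩ := exists_comp_unitMor (k := k) (i := l) (j := j - 1) (l := j) (n := n)
    (m := 0) (Or.inl (by omega)) (Or.inr (by omega)) (by omega)
  have h2 := comp_assoc_mem hg hα hτ (r := n) (by ring)
  rw [h1, comp_smul_right] at h2
  rw [← Submodule.smul_mem_iff _ hc]
  constructor
  · intro h3
    have h4 := sub_mem h3 h2
    rwa [sub_sub_cancel, Submodule.smul_mem_iff _ (sgn_ne_zero n)] at h4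
  · intro h3
    have h4 := add_mem h2 (Submodule.smul_mem _ (sgn k n) h3)
    rw [sub_add_cancel] at h4
    exact h4

open Classical in
-- The source has dimension at most one, spanned by `unitMor`, so the rank is one or zero according
-- to whether the composite of `g` with this generator is nonzero.
theorem finrank_range_push {j l n : ℤ} {g : Hom (arcZ k j) L} (hg : g ∈ cocycles (arcZ k j) L 0) :
    Module.finrank k (LinearMap.range (push (arcZ k l) hg (n := n) (r := n) (by ring))) =
      if (j + 3 * n - l = 0 ∧ extMk g hg ≠ 0) ∨
        (j + 3 * n - l = 1 ∧ alphaMap L (i := j - 1) (j := j) (by ring) (extMk g hg) ≠ 0)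
      then 1 else 0 := by
  simp only [alphaMap, pull_mk, ne_eq, extMk_eq_zero]
  by_cases h : j + 3 * n - l = 0 ∨ j + 3 * n - l = 1
  · have h1 : LinearMap.range (push (arcZ k l) hg (n := n) (r := n) (by ring)) =
        Submodule.span k {push (arcZ k l) hg (n := n) (r := n) (by ring)
          (extMk (unitMor k l j) (unitMor_mem h))} := by
      apply le_antisymm
      · rintro _ ⟨η, rfl⟩
        obtain ⟨u, hu, rfl⟩ := exists_extMk η
        have : extMk u hu = u (pt k l) (pt k j) • extMk (unitMor k l j) (unitMor_mem h) := by
          refine extMk_eq_extMk (hg := Submodule.smul_mem _ _ (unitMor_mem h)).2 ?_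
          rw [← eq_smul_unitMor, sub_self]
          exact zero_mem _
        rw [this, map_smul]
        exact Submodule.smul_mem _ _ (Submodule.mem_span_singleton_self _)
      · rw [Submodule.span_singleton_le_iff_mem]
        exact ⟨_, rfl⟩
    rw [h1, push_mk]
    have h2 : cmp (arcZ k l) (arcZ k j) L g (unitMor k l j) ∈ coboundaries (arcZ k l) L n ↔
        ¬((j + 3 * n - l = 0 ∧ ¬g ∈ coboundaries (arcZ k j) L 0) ∨ (j + 3 * n - l = 1 ∧
          ¬ cmp (arcZ k (j - 1)) (arcZ k j) L g (unitMor k (j - 1) j) ∈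
            coboundaries (arcZ k (j - 1)) L 0)) := by
      rcases h with h | h
      · rw [comp_unitMor_mem_coboundaries_iff hg h]
        simp [h]
      · rw [comp_unitMor_mem_coboundaries_iff' hg h]
        simp [h]
    split_ifs with h3
    · refine finrank_span_singleton ?_
      rw [Ne, extMk_eq_zero, h2]
      exact fun h => h h3
    · rw [← h2] at h3
      rw [extMk_eq_zero.2 h3, Submodule.span_zero_singleton, finrank_bot]
  · rw [if_neg (by tauto)]
    have h1 := LinearMap.finrank_range_le (push (arcZ k l) hg (n := n) (r := n) (by ring))
    rw [finrank_ext_arcZ_arcZ, if_neg h] at h1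
    omega

theorem finsupp_eq_of_add_succ_eq {a b : ℤ →₀ ℕ} (h : ∀ j, a j + a (j + 1) = b j + b (j + 1)) :
    a = b := by
  obtain ⟨N, hN⟩ := (a.support ∪ b.support).bddAbove
  apply DFunLike.coe_injective
  refine eq_of_add_succ_eq (N := N + 1) h fun j hj => ?_
  have : j ∉ a.support ∪ b.support := fun hj' => by have := hN hj'; omega
  rw [Finset.mem_union, not_or, Finsupp.notMem_support_iff, Finsupp.notMem_support_iff] at this
  rw [this.1, this.2]

section Cone

variable {j : ℤ} {φ : cocycles (arcZ k j) X 0} {C : Tw k stdFol}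

open Classical in
theorem IsCone.finrank_ext_arcZ {f : cocycles X L 0} (hC : IsCone f C) (hφ : IsInvertible φ)
    (l : ℤ) {ξ : Ext (arcZ k j) L 0} (hξ : pull L φ.2 (n := 0) (r := 0) (by ring) (cls f) = ξ) :
    mult C l + mult C (l + 1) + (if (j - l = 0 ∧ ξ ≠ 0) ∨ (j - l = 1 ∧
        alphaMap L (i := j - 1) (j := j) (by ring) ξ ≠ 0) then 1 else 0)
      + (if (j + 3 - l = 0 ∧ ξ ≠ 0) ∨ (j + 3 - l = 1 ∧
        alphaMap L (i := j - 1) (j := j) (by ring) ξ ≠ 0) then 1 else 0) =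
      mult L l + mult L (l + 1) + if j + 3 - l = 0 ∨ j + 3 - l = 1 then 1 else 0 := by
  obtain ⟨E⟩ := hC.exists_coneData
  have h1 := E.finrank_ext f.2 (arcZ k l) 0
  have hiso : Iso (arcZ k j) X := ⟨φ, hφ⟩
  have hξ' : ξ = extMk _ (comp_mem_cocycles f.2 φ.2 (r := 0) (by ring)) := hξ.symm
  rw [range_push_comp f.2 hφ.isGradedIso, range_push_comp f.2 hφ.isGradedIso, finrank_range_push,
    finrank_range_push, ← hiso.finrank_ext_right, finrank_ext_arcZ_arcZ, Tw.finrank_ext_arcZ,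
    Tw.finrank_ext_arcZ, ← hξ'] at h1
  simpa using h1

/-- The long exact sequence gives the sums of neighbouring multiplicities of the cone, and these
determine it. If `ξ` survives on `E_{j-1}`, a summand `E_j` of `L` is cancelled. If `ξ` is nonzero
but dies there, a summand `E_{j+1}` is replaced by `E_{j+2}`, the third vertex of the triangle. If
`ξ = 0`, the cone is `L ⊕ E_j[1]` with `E_j[1] ≅ E_{j+3}`. -/
theorem IsCone.multFinsupp_eq {f : cocycles X L 0} (hC : IsCone f C) (hφ : IsInvertible φ)
    {ξ : Ext (arcZ k j) L 0} (hξ : pull L φ.2 (n := 0) (r := 0) (by ring) (cls f) = ξ) :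
    (alphaMap L (i := j - 1) (j := j) (by ring) ξ ≠ 0 →
      multFinsupp C + Finsupp.single j 1 = multFinsupp L) ∧
    (ξ ≠ 0 → alphaMap L (i := j - 1) (j := j) (by ring) ξ = 0 →
      multFinsupp C + Finsupp.single (j + 1) 1 = multFinsupp L + Finsupp.single (j + 2) 1) ∧
    (ξ = 0 → multFinsupp C = multFinsupp L + Finsupp.single (j + 3) 1) := by
  have h := fun l => hC.finrank_ext_arcZ hφ l hξ
  refine ⟨fun h1 => ?_, fun h1 h2 => ?_, fun h1 => ?_⟩ <;>
    refine finsupp_eq_of_add_succ_eq fun l => ?_ <;> have h3 := h l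
  · have h4 : ξ ≠ 0 := fun h0 => h1 (by rw [h0, map_zero])
    simp only [ne_eq, h1, h4, not_false_eq_true, and_true] at h3
    simp only [Finsupp.add_apply, multFinsupp_apply, Finsupp.single_apply]
    split_ifs at h3 ⊢ <;> omega
  · simp only [ne_eq, h1, h2, not_false_eq_true, and_true, not_true_eq_false, and_false, or_false,
      if_false] at h3
    simp only [Finsupp.add_apply, multFinsupp_apply, Finsupp.single_apply]
    split_ifs at h3 ⊢ <;> omega
  · simp only [ne_eq, h1, map_zero, not_true_eq_false, and_false, or_false,
      if_false] at h3
    simp only [Finsupp.add_apply, multFinsupp_apply, Finsupp.single_apply]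
    split_ifs at h3 ⊢ <;> omega

end Cone

/-- The morphisms from the `j`-th arc to `L` with cone isomorphic to `Z`. -/
def coneSet (j : ℤ) (L Z : Tw k stdFol) : Set (Ext (arcZ k j) L 0) :=
  {ξ | (alphaMap L (i := j - 1) (j := j) (by ring) ξ ≠ 0 ∧
      multFinsupp Z + Finsupp.single j 1 = multFinsupp L) ∨
    (ξ ≠ 0 ∧ alphaMap L (i := j - 1) (j := j) (by ring) ξ = 0 ∧
      multFinsupp Z + Finsupp.single (j + 1) 1 = multFinsupp L + Finsupp.single (j + 2) 1) ∨
    (ξ = 0 ∧ multFinsupp Z = multFinsupp L + Finsupp.single (j + 3) 1)}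

/-- The Hall product uses an arbitrary representative `X` of the class of an arc; pulling back along
an isomorphism reduces to the arc itself, where the class of the cone is known. -/
theorem card_homWithCone_eq {j : ℤ} (hX : Iso (arcZ k j) X) (L Z : Tw k stdFol) :
    Nat.card (homWithCone X L Z) = Nat.card (coneSet j L Z) := by
  obtain ⟨φ, hφ⟩ := hX
  refine Nat.card_congr ((Equiv.ofBijective _
    (hφ.isGradedIso.pull_bijective L (n := 0) (r := 0) (by ring))).subtypeEquiv fun ζ => ?_)
  set ξ := pull L φ.2 (n := 0) (r := 0) (by ring) ζ with hξ
  have hc : ∀ {a b c : ℤ →₀ ℕ}, a + c = b + c → a = b := fun h => add_right_cancel h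
  constructor
  · rintro ⟨f, rfl, C, hC, hCZ⟩
    obtain ⟨h1, h2, h3⟩ := hC.multFinsupp_eq hφ hξ.symm
    rw [iso_iff_multFinsupp_eq] at hCZ
    rw [hCZ] at h1 h2 h3
    by_cases h0 : ξ = 0
    · exact Or.inr (Or.inr ⟨h0, h3 h0⟩)
    · by_cases hα : alphaMap L (i := j - 1) (j := j) (by ring) ξ = 0
      · exact Or.inr (Or.inl ⟨h0, hα, h2 h0 hα⟩)
      · exact Or.inl ⟨hα, h1 hα⟩
  · intro h
    obtain ⟨f, rfl⟩ : ∃ f : cocycles X L 0, cls f = ζ := Submodule.Quotient.mk_surjective _ ζ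
    refine ⟨f, rfl, _, isCone_cone f, iso_iff_multFinsupp_eq.2 ?_⟩
    obtain ⟨h1, h2, h3⟩ := (isCone_cone f).multFinsupp_eq hφ hξ.symm
    rcases h with ⟨h4, h5⟩ | ⟨h4, h5, h6⟩ | ⟨h4, h5⟩
    · exact hc ((h1 h4).trans h5.symm)
    · exact hc ((h2 h4 h5).trans h6.symm)
    · exact (h3 h4).trans h5.symm

theorem natCard_ext (X Y : Tw k stdFol) (n : ℤ) :
    Nat.card (Ext X Y n) = Nat.card k ^ Module.finrank k (Ext X Y n) :=
  Module.natCard_eq_pow_finrank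

section Finite

variable [Finite k]

/-- The three conditions on the multiplicities exclude one another, so the set is the complement of
the kernel of `alphaMap`, the kernel without zero, the set `{0}`, or empty. -/
theorem card_coneSet (j : ℤ) (L Z : Tw k stdFol) : Nat.card (coneSet j L Z) =
    if multFinsupp Z + Finsupp.single j 1 = multFinsupp L then
      Nat.card k ^ (mult L j + mult L (j + 1)) - Nat.card k ^ mult L (j + 1)
    else if multFinsupp Z + Finsupp.single (j + 1) 1 = multFinsupp L + Finsupp.single (j + 2) 1 then
      Nat.card k ^ mult L (j + 1) - 1
    else if multFinsupp Z = multFinsupp L + Finsupp.single (j + 3) 1 then 1 else 0 := by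
  have : Finite (Ext (arcZ k j) L 0) := Module.finite_of_finite k
  set α := alphaMap L (i := j - 1) (j := j) (by ring) with hα
  have hker : Nat.card (LinearMap.ker α) = Nat.card k ^ mult L (j + 1) := by
    rw [Module.natCard_eq_pow_finrank (K := k), hα, finrank_ker_alphaMap L _ rfl]
  have hker' : (LinearMap.ker α : Set (Ext (arcZ k j) L 0)).ncard = Nat.card k ^ mult L (j + 1) :=
    hker
  split_ifs with h1 h2 h3
  · have hs : coneSet j L Z = (LinearMap.ker α : Set (Ext (arcZ k j) L 0))ᶜ := by
      ext ξ
      simp only [coneSet, Set.mem_ofPred_eq, Set.mem_compl_iff, SetLike.mem_coe, LinearMap.mem_ker]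
      constructor
      · rintro (h | ⟨-, -, h⟩ | ⟨-, h⟩)
        · exact h.1
        · have := DFunLike.congr_fun h1 j
          have := DFunLike.congr_fun h j
          simp at *; omega
        · have := DFunLike.congr_fun h1 j
          have := DFunLike.congr_fun h j
          simp at *; omega
      · exact fun h => Or.inl ⟨h, h1⟩
    rw [Nat.card_coe_set_eq, hs, Set.ncard_compl, hker', natCard_ext, finrank_ext_arcZ]
  · have hs : coneSet j L Z = (LinearMap.ker α : Set (Ext (arcZ k j) L 0)) \ {0} := by
      ext ξ
      simp only [coneSet, Set.mem_ofPred_eq, Set.mem_sdiff, SetLike.mem_coe, LinearMap.mem_ker,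
        Set.mem_singleton_iff]
      constructor
      · rintro (h | ⟨h, h', -⟩ | ⟨-, h⟩)
        · exact absurd h.2 h1
        · exact ⟨h', h⟩
        · have := DFunLike.congr_fun h2 (j + 1)
          have := DFunLike.congr_fun h (j + 1)
          simp at *; omega
      · exact fun h => Or.inr (Or.inl ⟨h.2, h.1, h2⟩)
    rw [Nat.card_coe_set_eq, hs, Set.ncard_sdiff_singleton_of_mem (zero_mem _), hker']
  · have hs : coneSet j L Z = {0} := by
      ext ξ
      simp only [coneSet, Set.mem_ofPred_eq, Set.mem_singleton_iff]
      constructor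
      · rintro (h | ⟨h, h', h''⟩ | ⟨h, -⟩)
        · exact absurd h.2 h1
        · exact absurd h'' h2
        · exact h
      · exact fun h => Or.inr (Or.inr ⟨h, h3⟩)
    rw [Nat.card_coe_set_eq, hs, Set.ncard_singleton]
  · have hs : coneSet j L Z = ∅ := by
      ext ξ
      simp only [coneSet, Set.mem_ofPred_eq, Set.mem_empty_iff_false, iff_false]
      tauto
    rw [Nat.card_coe_set_eq, hs, Set.ncard_empty]

/-- The endomorphisms of an arc are the multiples of the identity, and the automorphisms are the
nonzero ones. -/
theorem card_aut {j : ℤ} (hX : Iso (arcZ k j) X) : Nat.card (aut X) = Nat.card k - 1 := by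
  have hd : Module.finrank k (Ext X X 0) = 1 := by
    rw [← hX.finrank_ext_left, ← hX.finrank_ext_right, finrank_ext_arcZ_arcZ, if_pos (by simp)]
  have : Finite (Ext X X 0) := Module.finite_of_finite k
  have h1 : extMk 1 (one_mem_cocycles X) ≠ 0 := by
    intro h0
    rw [extMk_eq_zero] at h0
    have : ∀ ξ : Ext X X 0, ξ = 0 := by
      intro ξ
      obtain ⟨f, hf, rfl⟩ := exists_extMk ξ
      rw [extMk_eq_zero, ← comp_one_right hf.1]
      exact comp_mem_coboundaries_right hf h0 (by ring)
    have : Subsingleton (Ext X X 0) := ⟨fun a b => by rw [this a, this b]⟩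
    rw [Module.finrank_zero_of_subsingleton] at hd
    omega
  have hs : aut X = {0}ᶜ := by
    ext ξ
    rw [Set.mem_compl_iff, Set.mem_singleton_iff]
    constructor
    · rintro ⟨f, rfl, g, hg, -⟩ h0
      have h2 : f.1 ∈ coboundaries X X 0 := extMk_eq_zero (hf := f.2).1 h0
      refine h1 (extMk_eq_zero.2 ?_)
      have h3 := sub_mem (comp_mem_coboundaries_right g.2 h2 (r := 0) (by ring)) hg
      rwa [cmp, sub_sub_cancel] at h3
    · intro h0
      obtain ⟨c, rfl⟩ := (finrank_eq_one_iff_of_nonzero' _ h1).1 hd ξ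
      have hc : c ≠ 0 := fun hc => h0 (by rw [hc, zero_smul])
      refine ⟨⟨c • 1, Submodule.smul_mem _ _ (one_mem_cocycles X)⟩, rfl,
        ⟨c⁻¹ • 1, Submodule.smul_mem _ _ (one_mem_cocycles X)⟩, ?_, ?_⟩
      · change cmp X X X (c⁻¹ • 1) (c • 1) - 1 ∈ _
        rw [comp_smul_left, comp_smul_right, comp_one_right (one_mem_homDeg _), smul_smul,
          inv_mul_cancel₀ hc, one_smul, sub_self]
        exact zero_mem _
      · change cmp X X X (c • 1) (c⁻¹ • 1) - 1 ∈ _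
        rw [comp_smul_left, comp_smul_right, comp_one_right (one_mem_homDeg _), smul_smul,
          mul_inv_cancel₀ hc, one_smul, sub_self]
        exact zero_mem _
  rw [Nat.card_coe_set_eq, hs, Set.ncard_compl, Set.ncard_singleton, natCard_ext, hd, pow_one]

end Finite

end Tw

/-! ### The Euler form, the negative extensions and the Hall numbers in terms of multiplicities. -/

theorem finite_support_mul_comp {ι : Type*} {e : ι → ℤ} (he : Function.Injective e) (c : ι → ℤ)
    (a : ℤ →₀ ℤ) : (Function.support fun n => c n * a (e n)).Finite := by
  refine (a.hasFiniteSupport.preimage (he.injOn)).subset fun n hn => ?_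
  exact fun h0 => hn (by simp only [h0, mul_zero])

/-- Turns a sum over degrees into a linear functional of the multiplicities, whose additivity is
what later computations use. -/
theorem finsum_mul_comp {ι : Type*} {e : ι → ℤ} (he : Function.Injective e) {c : ι → ℤ} {w : ℤ → ℤ}
    (hw : ∀ n, w (e n) = c n) (hw' : ∀ l, l ∉ Set.range e → w l = 0) (a : ℤ →₀ ℤ) :
    ∑ᶠ n, c n * a (e n) = Finsupp.linearCombination ℤ w a := by
  have h1 : ∑ᶠ n, c n * a (e n) = ∑ᶠ l ∈ Set.range e, a l * w l := by
    rw [finsum_mem_range he]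
    exact finsum_congr fun n => by rw [hw, mul_comm]
  have h2 : ∑ᶠ l ∈ Set.range e, a l * w l = ∑ᶠ l, a l * w l := by
    rw [← finsum_mem_univ fun l => a l * w l]
    refine finsum_mem_inter_support_eq' _ _ _ fun l hl => ⟨fun _ => trivial, fun _ => ?_⟩
    by_contra hl'
    exact hl (by simp only [hw' l hl', mul_zero])
  rw [h1, h2, Finsupp.linearCombination_apply, Finsupp.sum]
  refine finsum_eq_sum_of_support_subset _ fun l hl => ?_
  rw [Finset.mem_coe, Finsupp.mem_support_iff]
  exact fun h0 => hl (by simp only [h0, zero_mul])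

/-- Multiplicities as integers. -/
def toZ : (ℤ →₀ ℕ) →+ (ℤ →₀ ℤ) := Finsupp.mapRange.addMonoidHom (Nat.castAddMonoidHom ℤ)

@[simp] theorem toZ_apply (a : ℤ →₀ ℕ) (l : ℤ) : toZ a l = (a l : ℤ) := rfl

@[simp] theorem toZ_single (l : ℤ) (n : ℕ) : toZ (Finsupp.single l n) = Finsupp.single l (n : ℤ) :=
  Finsupp.mapRange_single (hf := Nat.cast_zero)

theorem toZ_injective : Function.Injective toZ := fun a b h => by
  ext l
  have := DFunLike.congr_fun h l
  simpa using this

/-- The Euler form of two arcs. -/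
def eulerWt (d : ℤ) : ℤ :=
  if d % 3 = 0 then ((d / 3).negOnePow : ℤ) else if d % 3 = 2 then ((d / 3 + 1).negOnePow : ℤ) else 0

/-- The alternating sum of the dimensions of the negative extensions of two arcs. -/
def negExtWt (d : ℤ) : ℤ := if 3 ≤ d ∧ d % 3 ≠ 2 then ((d / 3).negOnePow : ℤ) else 0

namespace Tw

variable {k : Type*} [Field k] {X L Z : Tw k stdFol} {j : ℤ}

theorem finrank_ext_std_arcZ (a : ℤ →₀ ℕ) (j n : ℤ) :
    Module.finrank k (Ext (std k a) (arcZ k j) n) = a (j + 3 * n) + a (j + 3 * n - 1) := by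
  rw [std, finrank_ext_sumArcs_arcZ, ← card_stdIdx a, ← card_stdIdx a,
    ← Finset.card_union_of_disjoint]
  · congr 1
    ext x
    simp only [Finset.mem_filter, Finset.mem_univ, true_and, Finset.mem_union]
    omega
  · rw [Finset.disjoint_filter]
    intro x _ h1; omega

/-- The extensions of degree `n` from a sum of arcs to `E_j` come from the summands numbered `j +
3n` and `j + 3n - 1`; these are the residues `0` and `2` modulo `3` in `eulerWt`. -/
theorem euler_eq (hX : Iso (arcZ k j) X) (Z : Tw k stdFol) : euler Z X =
    Finsupp.linearCombination ℤ (fun l => eulerWt (l - j)) (toZ (multFinsupp Z)) := by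
  have h1 : ∀ n : ℤ, (n.negOnePow : ℤ) * (Module.finrank k (Ext Z X n) : ℤ) =
      (n.negOnePow : ℤ) * toZ (multFinsupp Z) (j + 3 * n) +
        (n.negOnePow : ℤ) * toZ (multFinsupp Z) (j + 3 * n - 1) := by
    intro n
    rw [← hX.finrank_ext_right, ← (iso_std Z).finrank_ext_left, finrank_ext_std_arcZ]
    push_cast
    rw [mul_add]; rfl
  have i1 : Function.Injective fun n : ℤ => j + 3 * n := fun a b h => by
    have : j + 3 * a = j + 3 * b := h
    omega
  have i2 : Function.Injective fun n : ℤ => j + 3 * n - 1 := fun a b h => by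
    have : j + 3 * a - 1 = j + 3 * b - 1 := h
    omega
  rw [euler, finsum_congr h1, finsum_add_distrib (finite_support_mul_comp i1 _ _)
    (finite_support_mul_comp i2 _ _),
    finsum_mul_comp (w := fun l => if (l - j) % 3 = 0 then (((l - j) / 3).negOnePow : ℤ) else 0) i1,
    finsum_mul_comp (w := fun l => if (l - j) % 3 = 2 then (((l - j) / 3 + 1).negOnePow : ℤ) else 0)
      i2, Finsupp.linearCombination_apply, Finsupp.linearCombination_apply,
      Finsupp.linearCombination_apply, ← Finsupp.sum_add]
  · refine Finsupp.sum_congr fun l _ => ?_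
    rw [← smul_add, eulerWt]
    congr 1
    split_ifs <;> omega
  · intro n
    rw [if_pos (by omega), show (j + 3 * n - 1 - j) / 3 + 1 = n by omega]
  · intro l hl
    refine if_neg fun h => hl ⟨(l - j) / 3 + 1, ?_⟩
    dsimp only; omega
  · intro n
    rw [if_pos (by omega), show (j + 3 * n - j) / 3 = n by omega]
  · intro l hl
    refine if_neg fun h => hl ⟨(l - j) / 3, ?_⟩
    dsimp only; omega

theorem negExtSum_eq (j : ℤ) (a : ℤ →₀ ℕ) :
    ∑ᶠ n : ℕ, (((n : ℤ) + 1).negOnePow : ℤ) * ((a (j + 3 * (n + 1)) + a (j + 3 * (n + 1) + 1) : ℕ) : ℤ)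
      = Finsupp.linearCombination ℤ (fun l => negExtWt (l - j)) (toZ a) := by
  have h1 : ∀ n : ℕ, (((n : ℤ) + 1).negOnePow : ℤ) *
      ((a (j + 3 * (n + 1)) + a (j + 3 * (n + 1) + 1) : ℕ) : ℤ) =
      (((n : ℤ) + 1).negOnePow : ℤ) * toZ a (j + 3 * (n + 1)) +
        (((n : ℤ) + 1).negOnePow : ℤ) * toZ a (j + 3 * (n + 1) + 1) := by
    intro n
    push_cast
    rw [mul_add]; rfl
  have i1 : Function.Injective fun n : ℕ => j + 3 * ((n : ℤ) + 1) := fun a b h => by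
    have : j + 3 * ((a : ℤ) + 1) = j + 3 * (b + 1) := h
    omega
  have i2 : Function.Injective fun n : ℕ => j + 3 * ((n : ℤ) + 1) + 1 := fun a b h => by
    have : j + 3 * ((a : ℤ) + 1) + 1 = j + 3 * (b + 1) + 1 := h
    omega
  rw [finsum_congr h1, finsum_add_distrib (finite_support_mul_comp i1 _ _)
    (finite_support_mul_comp i2 _ _),
    finsum_mul_comp (w := fun l => if 3 ≤ l - j ∧ (l - j) % 3 = 0 then
      (((l - j) / 3).negOnePow : ℤ) else 0) i1,
    finsum_mul_comp (w := fun l => if 3 ≤ l - j ∧ (l - j) % 3 = 1 then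
      (((l - j) / 3).negOnePow : ℤ) else 0)
      i2, Finsupp.linearCombination_apply, Finsupp.linearCombination_apply,
      Finsupp.linearCombination_apply, ← Finsupp.sum_add]
  · refine Finsupp.sum_congr fun l _ => ?_
    rw [← smul_add, negExtWt]
    congr 1
    split_ifs <;> omega
  · intro n
    rw [if_pos (by omega), show (j + 3 * ((n : ℤ) + 1) + 1 - j) / 3 = n + 1 by omega]
  · intro l hl
    refine if_neg fun h => hl ⟨((l - j) / 3 - 1).toNat, ?_⟩
    dsimp only; omega
  · intro n
    rw [if_pos (by omega), show (j + 3 * ((n : ℤ) + 1) - j) / 3 = n + 1 by omega]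
  · intro l hl
    refine if_neg fun h => hl ⟨((l - j) / 3 - 1).toNat, ?_⟩
    dsimp only; omega

theorem finprod_zpow_eq {F : Type*} [Field F] {x : F} (hx : x ≠ 0) {f : ℕ → ℤ}
    (hf : (Function.support f).Finite) : ∏ᶠ n, x ^ f n = x ^ ∑ᶠ n, f n := by
  have h1 : (Function.mulSupport fun n => x ^ f n) ⊆ hf.toFinset := fun n hn => by
    rw [Set.Finite.coe_toFinset]
    exact fun h0 => hn (by simp only [h0, zpow_zero])
  rw [finprod_eq_prod_of_mulSupport_subset _ h1, finsum_eq_sum _ hf]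
  induction hf.toFinset using Finset.induction_on with
  | empty => simp
  | insert n s hn ih => rw [Finset.prod_insert hn, Finset.sum_insert hn, zpow_add₀ hx, ih]

theorem negExtProd_eq [Finite k] (hX : Iso (arcZ k j) X) (L : Tw k stdFol) : negExtProd X L =
    (Nat.card k : ℚ) ^
      Finsupp.linearCombination ℤ (fun l => negExtWt (l - j)) (toZ (multFinsupp L)) := by
  have hk : (Nat.card k : ℚ) ≠ 0 := Nat.cast_ne_zero.2 Nat.card_pos.ne'
  rw [← negExtSum_eq, ← finprod_zpow_eq hk, negExtProd]
  · refine finprod_congr fun n => ?_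
    rw [natCard_ext, ← hX.finrank_ext_left, finrank_ext_arcZ_deg,
      show j - 3 * -((n : ℤ) + 1) = j + 3 * (n + 1) by ring, zpow_mul', zpow_natCast]
    push_cast
    rfl
  · have i1 : Function.Injective fun n : ℕ => j + 3 * ((n : ℤ) + 1) := fun a b h => by
      have : j + 3 * ((a : ℤ) + 1) = j + 3 * (b + 1) := h
      omega
    have i2 : Function.Injective fun n : ℕ => j + 3 * ((n : ℤ) + 1) + 1 := fun a b h => by
      have : j + 3 * ((a : ℤ) + 1) + 1 = j + 3 * (b + 1) + 1 := h
      omega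
    refine (((multFinsupp L).hasFiniteSupport.preimage i1.injOn).union
      ((multFinsupp L).hasFiniteSupport.preimage i2.injOn)).subset fun n hn => ?_
    by_contra hc
    rw [Set.mem_union, not_or] at hc
    refine hn ?_
    have h1 : multFinsupp L (j + 3 * ((n : ℤ) + 1)) = 0 := by_contra fun h => hc.1 h
    have h2 : multFinsupp L (j + 3 * ((n : ℤ) + 1) + 1) = 0 := by_contra fun h => hc.2 h
    simp only [h1, h2, add_zero, Nat.cast_zero, mul_zero]

theorem negExtProd_self [Finite k] (hX : Iso (arcZ k j) X) : negExtProd X X = 1 := by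
  have h1 : multFinsupp X = Finsupp.single j 1 := by
    rw [← hX.multFinsupp_eq]
    refine finsupp_eq_of_add_succ_eq fun l => ?_
    rw [multFinsupp_apply, multFinsupp_apply, ← finrank_ext_arcZ, finrank_ext_arcZ_arcZ,
      Finsupp.single_apply, Finsupp.single_apply]
    split_ifs <;> omega
  rw [negExtProd_eq hX, h1, toZ_single, Finsupp.linearCombination_single]
  simp [negExtWt]

/-- The denominator is `|k| - 1`, the number of automorphisms of an arc; an arc has no negative
self-extensions, so the other correction factor is `1`. -/
theorem toen_eq [Finite k] (hX : Iso (arcZ k j) X) (Z L : Tw k stdFol) : toen X Z L =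
    (Nat.card k : ℚ) ^ Finsupp.linearCombination ℤ (fun l => negExtWt (l - j)) (toZ (multFinsupp L))
      * (if multFinsupp Z + Finsupp.single j 1 = multFinsupp L then
        ((Nat.card k : ℚ) ^ (multFinsupp L j + multFinsupp L (j + 1)) -
          (Nat.card k : ℚ) ^ multFinsupp L (j + 1)) / (Nat.card k - 1)
      else if multFinsupp Z + Finsupp.single (j + 1) 1 = multFinsupp L + Finsupp.single (j + 2) 1 then
        ((Nat.card k : ℚ) ^ multFinsupp L (j + 1) - 1) / (Nat.card k - 1)
      else if multFinsupp Z = multFinsupp L + Finsupp.single (j + 3) 1 then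
        1 / ((Nat.card k : ℚ) - 1) else 0) := by
  have hk : 1 ≤ Nat.card k := Nat.card_pos
  rw [toen, card_homWithCone_eq hX, card_coneSet, card_aut hX, negExtProd_self hX,
    negExtProd_eq hX, div_one, mul_comm, Nat.cast_sub hk, Nat.cast_one]
  congr 1
  simp only [multFinsupp_apply]
  split_ifs
  · rw [Nat.cast_sub (Nat.pow_le_pow_right hk (by omega))]
    push_cast; rfl
  · rw [Nat.cast_sub (Nat.one_le_pow _ _ hk)]
    push_cast; rfl
  · simp
  · simp

end Tw

/-! ### Arc operators and their comparison with the Hall product. -/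

section

variable {K : Type*} [Field K]

/-- The exponent by which adding the `j`-th arc twists the `(j + d)`-th one. -/
def actWt (d : ℤ) : ℤ := eulerWt d + 2 * negExtWt d

/-- The exponent by which adding the `j`-th arc twists an object with given multiplicities. -/
def actExp (j : ℤ) : (ℤ →₀ ℤ) →ₗ[ℤ] ℤ := Finsupp.linearCombination ℤ fun l => actWt (l - j)

theorem actExp_single (j l x : ℤ) : actExp j (Finsupp.single l x) = x * actWt (l - j) := by
  rw [actExp, Finsupp.linearCombination_single, smul_eq_mul]

/-- The quantum integer `(q²ⁿ - 1) / (q² - 1)`. -/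
def qInt (q : K) (n : ℤ) : K := (q ^ (2 * n) - 1) / (q ^ 2 - 1)

@[simp] theorem qInt_zero (q : K) : qInt q 0 = 0 := by simp [qInt]

/-- The weighted translation `e_a ↦ c(a) e_{a + v}`. -/
def transl (v : ℤ →₀ ℤ) (c : (ℤ →₀ ℤ) → K) : Module.End K ((ℤ →₀ ℤ) →₀ K) :=
  Finsupp.linearCombination K fun a => Finsupp.single (a + v) (c a)

theorem transl_single (v : ℤ →₀ ℤ) (c : (ℤ →₀ ℤ) → K) (a : ℤ →₀ ℤ) (x : K) :
    transl v c (Finsupp.single a x) = Finsupp.single (a + v) (x * c a) := by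
  rw [transl, Finsupp.linearCombination_single, Finsupp.smul_single, smul_eq_mul]

/-- The action of the `j`-th arc. -/
def arcAct (q : K) (j : ℤ) : Module.End K ((ℤ →₀ ℤ) →₀ K) :=
  -- The three terms are the three possible shapes of the middle object. Multiplicities may be
  -- arbitrary integers here, so translations always compose; on genuine multiplicities the factors
  -- `qInt` vanish when the summand to be removed is absent.
  transl (Finsupp.single j 1) (fun a => q ^ actExp j a * q ^ (2 * a (j + 1))) +
  transl (Finsupp.single (j + 1) 1 - Finsupp.single (j + 2) 1)
    (fun a => q ^ actExp j a * qInt q (a (j + 2))) +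
  transl (-Finsupp.single (j + 3) 1)
    (fun a => q ^ actExp j a * (q ^ 2 / (q ^ 2 - 1) * qInt q (a (j + 3))))

theorem arcAct_single (q : K) (j : ℤ) (a : ℤ →₀ ℤ) : arcAct q j (Finsupp.single a 1) =
    Finsupp.single (a + Finsupp.single j 1) (q ^ actExp j a * q ^ (2 * a (j + 1))) +
    Finsupp.single (a + (Finsupp.single (j + 1) 1 - Finsupp.single (j + 2) 1))
      (q ^ actExp j a * qInt q (a (j + 2))) +
    Finsupp.single (a + -Finsupp.single (j + 3) 1)
      (q ^ actExp j a * (q ^ 2 / (q ^ 2 - 1) * qInt q (a (j + 3)))) := by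
  simp only [arcAct, LinearMap.add_apply, transl_single, one_mul]

/-- The product of the quantum factorials of the multiplicities. -/
def qFac (q : K) (a : ℤ →₀ ℕ) : K := a.prod fun _ n => ∏ i ∈ Finset.range n, qInt q (i + 1)

theorem qFac_add_single (q : K) (a : ℤ →₀ ℕ) (j : ℤ) :
    qFac q (a + Finsupp.single j 1) = qFac q a * qInt q (a j + 1) := by
  have h0 : ∀ i : ℤ, (fun (_ : ℤ) (n : ℕ) => ∏ i ∈ Finset.range n, qInt q (i + 1)) i 0 = 1 := by simp
  rw [qFac, qFac, ← Finsupp.mul_prod_erase' a j _ h0,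
    ← Finsupp.mul_prod_erase' (a + Finsupp.single j 1) j _ h0, Finsupp.erase_add,
    Finsupp.erase_single, add_zero, Finsupp.add_apply, Finsupp.single_eq_same,
    Finset.prod_range_succ]
  ring

/-! ### Isomorphism classes -/

section Classes

variable {k : Type*} [Field k]

/-- The multiplicities of an isomorphism class. -/
def classMult : IsoClass k stdFol → (ℤ →₀ ℕ) :=
  Quot.lift Tw.multFinsupp fun _ _ h => h.multFinsupp_eq

theorem multFinsupp_out (c : IsoClass k stdFol) : Tw.multFinsupp c.out = classMult c :=
  congrArg classMult c.out_eq

/-- Isomorphism classes are determined by their multiplicities. -/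
def classEquiv (k : Type*) [Field k] : (ℤ →₀ ℕ) ≃ IsoClass k stdFol where
  toFun b := Quot.mk _ (Tw.std k b)
  invFun := classMult
  left_inv b := Tw.multFinsupp_std b
  right_inv c := by
    rcases c with ⟨X⟩
    exact Quot.sound (Tw.iso_std X)

theorem classMult_classEquiv (b : ℤ →₀ ℕ) : classMult (classEquiv k b) = b :=
  (classEquiv k).left_inv b

/-- The isomorphism class of the `j`-th arc. -/
def arcClass (k : Type*) [Field k] (j : ℤ) : IsoClass k stdFol := Quot.mk _ (Tw.arcZ k j)

theorem arcClass_out (j : ℤ) : Tw.Iso (Tw.arcZ k j) (arcClass k j).out :=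
  Tw.iso_iff_multFinsupp_eq.2 (multFinsupp_out (arcClass k j)).symm

theorem classEquiv_zero : classEquiv k 0 = Quot.mk _ (Tw.zero k stdFol) := by
  refine ((Equiv.symm_apply_eq (classEquiv k) (x := Quot.mk _ (Tw.zero k stdFol))).1 ?_).symm
  change Tw.multFinsupp (Tw.zero k stdFol) = 0
  refine Tw.finsupp_eq_of_add_succ_eq fun j => ?_
  have h : Module.finrank k (Tw.Ext (Tw.arcZ k j) (Tw.zero k stdFol) 0) = 0 := by
    rw [Tw.finrank_ext_of_δ_eq_zero rfl rfl, Finset.card_eq_zero]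
    exact Finset.eq_empty_of_forall_notMem fun p => p.2.elim0
  rw [Tw.finrank_ext_arcZ] at h
  exact h

end Classes

section Act

variable {k : Type*} [Field k] {q : K}

theorem finsum_ite_single {ι M : Type*} [AddCommMonoid M] {p : ι → Prop} [DecidablePred p]
    {f : ι → M} {b : ι} (hb : ∀ x, p x ↔ x = b) : ∑ᶠ x, (if p x then f x else 0) = f b := by
  rw [finsum_eq_single _ b fun x hx => if_neg fun h => hx ((hb x).1 h), if_pos ((hb b).2 rfl)]

theorem finite_support_ite {ι M : Type*} [AddCommMonoid M] {p : ι → Prop} [DecidablePred p]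
    {f : ι → M} (hp : {x | p x}.Finite) : (Function.support fun x => if p x then f x else 0).Finite :=
  hp.subset fun x hx => by
    by_contra h
    exact hx (if_neg h)

/-- The comparison of the Hall algebra with the space of the action. -/
def hallMap (k : Type*) [Field k] (q : K) : Hall k K stdFol →ₗ[K] ((ℤ →₀ ℤ) →₀ K) :=
  -- The quantum factorials cancel the quantum integer in the coefficient for adding an arc.
  Finsupp.linearCombination K fun c => Finsupp.single (toZ (classMult c)) (qFac q (classMult c))⁻¹

theorem hallMap_single (b : ℤ →₀ ℕ) (x : K) : hallMap k q (Finsupp.single (classEquiv k b) x) =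
    Finsupp.single (toZ b) (x * (qFac q b)⁻¹) := by
  rw [hallMap, Finsupp.linearCombination_single, classMult_classEquiv, Finsupp.smul_single,
    smul_eq_mul]

/-- The factor `2` reflects `|k| = q²`: the Euler form is an exponent of `q`, the negative
extensions one of `|k|`. -/
theorem actExp_eq (j : ℤ) (a : ℤ →₀ ℤ) : actExp j a =
    Finsupp.linearCombination ℤ (fun l => eulerWt (l - j)) a +
      2 * Finsupp.linearCombination ℤ (fun l => negExtWt (l - j)) a := by
  simp only [actExp, Finsupp.linearCombination_apply, Finsupp.sum, Finset.mul_sum,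
    ← Finset.sum_add_distrib, smul_eq_mul, actWt]
  exact Finset.sum_congr rfl fun l _ => by ring

theorem qInt_natCast (q : K) (n : ℕ) : qInt q n = ((q ^ 2) ^ n - 1) / (q ^ 2 - 1) := by
  rw [qInt, zpow_mul, zpow_natCast, zpow_ofNat]

theorem qInt_natCast_add_one (q : K) (n : ℕ) :
    qInt q (n + 1) = ((q ^ 2) ^ (n + 1) - 1) / (q ^ 2 - 1) := by
  rw [← qInt_natCast]; push_cast; rfl

section Finite

variable [Finite k] [CharZero K]

theorem one_lt_natCard : 1 < Nat.card k := Finite.one_lt_card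

theorem q_ne_zero (hq : q ^ 2 = (Nat.card k : K)) : q ≠ 0 := by
  rintro rfl
  have h : (Nat.card k : K) = 0 := by rw [← hq]; simp
  exact Nat.card_pos.ne' (Nat.cast_eq_zero.1 h)

theorem q_sq_pow_sub_one_ne_zero (hq : q ^ 2 = (Nat.card k : K)) (n : ℕ) :
    (q ^ 2) ^ (n + 1) - 1 ≠ 0 := by
  rw [hq, sub_ne_zero]
  have h := Nat.one_lt_pow (Nat.succ_ne_zero n) (one_lt_natCard (k := k))
  exact_mod_cast h.ne'

theorem q_sq_sub_one_ne_zero (hq : q ^ 2 = (Nat.card k : K)) : q ^ 2 - 1 ≠ 0 := by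
  simpa using q_sq_pow_sub_one_ne_zero hq 0

theorem qInt_ne_zero (hq : q ^ 2 = (Nat.card k : K)) (n : ℕ) : qInt q (n + 1) ≠ 0 := by
  rw [qInt_natCast_add_one]
  exact div_ne_zero (q_sq_pow_sub_one_ne_zero hq n) (q_sq_sub_one_ne_zero hq)

theorem qFac_ne_zero (hq : q ^ 2 = (Nat.card k : K)) (a : ℤ →₀ ℕ) : qFac q a ≠ 0 :=
  Finset.prod_ne_zero_iff.2 fun _ _ => Finset.prod_ne_zero_iff.2 fun i _ => qInt_ne_zero hq i

theorem hallMap_injective (hq : q ^ 2 = (Nat.card k : K)) : Function.Injective (hallMap k q) := by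
  rw [injective_iff_map_eq_zero]
  intro x hx
  ext c
  obtain ⟨b, rfl⟩ := (classEquiv k).surjective c
  have h1 := DFunLike.congr_fun hx (toZ b)
  rw [hallMap, Finsupp.linearCombination_apply, Finsupp.sum_apply,
    Finsupp.sum_eq_single (classEquiv k b)] at h1
  · rw [classMult_classEquiv, Finsupp.smul_single, Finsupp.single_eq_same, smul_eq_mul,
      Finsupp.zero_apply, mul_eq_zero] at h1
    exact h1.resolve_right (inv_ne_zero (qFac_ne_zero hq b))
  · intro c _ hc
    rw [Finsupp.smul_single, Finsupp.single_eq_of_ne]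
    intro h
    refine hc ?_
    rw [toZ_injective h]
    exact ((classEquiv k).right_inv c).symm
  · intro; simp

theorem toen_cast (hq : q ^ 2 = (Nat.card k : K)) (j : ℤ) (a b : ℤ →₀ ℕ) :
    ((Tw.toen (arcClass k j).out (classEquiv k a).out
      (classEquiv k b).out : ℚ) : K) =
    (q ^ 2) ^ Finsupp.linearCombination ℤ (fun l => negExtWt (l - j)) (toZ b)
      * (if a + Finsupp.single j 1 = b then
        ((q ^ 2) ^ (b j + b (j + 1)) - (q ^ 2) ^ b (j + 1)) / (q ^ 2 - 1)
      else if a + Finsupp.single (j + 1) 1 = b + Finsupp.single (j + 2) 1 then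
        ((q ^ 2) ^ b (j + 1) - 1) / (q ^ 2 - 1)
      else if a = b + Finsupp.single (j + 3) 1 then 1 / (q ^ 2 - 1) else 0) := by
  rw [Tw.toen_eq (arcClass_out j), multFinsupp_out, multFinsupp_out, classMult_classEquiv,
    classMult_classEquiv, hq]
  split_ifs <;> push_cast <;> rfl

/-- Writing the nested alternative as a sum of three mutually exclusive ones lets the sum over all
middle objects split into three sums with at most one nonzero term each. -/
theorem single_toen (hq : q ^ 2 = (Nat.card k : K)) (j : ℤ) (a b : ℤ →₀ ℕ) :
    (Finsupp.single (classEquiv k b) ((Tw.toen (arcClass k j).out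
      (classEquiv k a).out (classEquiv k b).out : ℚ) : K) : Hall k K stdFol) =
    (if a + Finsupp.single j 1 = b then Finsupp.single (classEquiv k b)
      ((q ^ 2) ^ Finsupp.linearCombination ℤ (fun l => negExtWt (l - j)) (toZ b) *
        (((q ^ 2) ^ (b j + b (j + 1)) - (q ^ 2) ^ b (j + 1)) / (q ^ 2 - 1))) else 0) +
    (if a + Finsupp.single (j + 1) 1 = b + Finsupp.single (j + 2) 1 then
      Finsupp.single (classEquiv k b)
      ((q ^ 2) ^ Finsupp.linearCombination ℤ (fun l => negExtWt (l - j)) (toZ b) *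
        (((q ^ 2) ^ b (j + 1) - 1) / (q ^ 2 - 1))) else 0) +
    (if a = b + Finsupp.single (j + 3) 1 then Finsupp.single (classEquiv k b)
      ((q ^ 2) ^ Finsupp.linearCombination ℤ (fun l => negExtWt (l - j)) (toZ b) *
        (1 / (q ^ 2 - 1))) else 0) := by
  rw [toen_cast hq]
  by_cases h1 : a + Finsupp.single j 1 = b
  · have h2 : ¬ a + Finsupp.single (j + 1) 1 = b + Finsupp.single (j + 2) 1 := fun h => by
      have e1 := DFunLike.congr_fun h1 j
      have e2 := DFunLike.congr_fun h j
      simp at e1 e2; omega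
    have h3 : ¬ a = b + Finsupp.single (j + 3) 1 := fun h => by
      have e1 := DFunLike.congr_fun h1 j
      have e2 := DFunLike.congr_fun h j
      simp at e1 e2; omega
    simp [h1, h2, h3]
  · by_cases h2 : a + Finsupp.single (j + 1) 1 = b + Finsupp.single (j + 2) 1
    · have h3 : ¬ a = b + Finsupp.single (j + 3) 1 := fun h => by
        have e1 := DFunLike.congr_fun h2 (j + 1)
        have e2 := DFunLike.congr_fun h (j + 1)
        simp at e1 e2; omega
      simp [h1, h2, h3]
    · by_cases h3 : a = b + Finsupp.single (j + 3) 1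
      · simp only [if_neg h1, if_neg h2, if_pos h3, zero_add]
      · simp only [if_neg h1, if_neg h2, if_neg h3, zero_add, mul_zero, Finsupp.single_zero]

/-- The three kinds of middle terms are compared with the three summands of `arcAct`. In the last
two, the absence of the arc to be removed makes both sides zero. -/
theorem hallMap_mulBasis (hq : q ^ 2 = (Nat.card k : K)) (j : ℤ) (a : ℤ →₀ ℕ) :
    hallMap k q (hallMulBasis k q stdFol (arcClass k j) (classEquiv k a)) =
      (qFac q a)⁻¹ • arcAct q j (Finsupp.single (toZ a) 1) := by
  have hq0 := q_ne_zero hq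
  have hq1 := q_sq_sub_one_ne_zero hq
  have hq2 : q ^ 2 ≠ 0 := pow_ne_zero 2 hq0
  rw [hallMulBasis, Tw.euler_eq (arcClass_out j), multFinsupp_out, classMult_classEquiv,
    ← finsum_comp_equiv (classEquiv k), finsum_congr (single_toen hq j a)]
  have hexp : ∀ E N : ℤ, q ^ (E + 2 * N) = q ^ E * (q ^ 2) ^ N := fun E N => by
    rw [zpow_add₀ hq0, zpow_mul, zpow_ofNat]
  have hν : ∀ (c : ℤ →₀ ℕ) (l : ℤ),
      Finsupp.linearCombination ℤ (fun l => negExtWt (l - j)) (toZ (c + Finsupp.single l 1)) =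
        Finsupp.linearCombination ℤ (fun l => negExtWt (l - j)) (toZ c) + negExtWt (l - j) := by
    intro c l
    rw [map_add, map_add, toZ_single, Finsupp.linearCombination_single, Nat.cast_one, one_smul]
  have hsame : ∀ (c : ℤ →₀ ℕ) (l : ℤ), (c + Finsupp.single l 1 : ℤ →₀ ℕ) l = c l + 1 := by simp
  have hdiff : ∀ (c : ℤ →₀ ℕ) {l m : ℤ}, l ≠ m → (c + Finsupp.single l 1 : ℤ →₀ ℕ) m = c m := by
    intro c l m h; simp [h]
  have u1 : ∀ b, a + Finsupp.single j 1 = b ↔ b = a + Finsupp.single j 1 := fun b => eq_comm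
  have hfin : ∀ l (d : ℤ →₀ ℕ), {b : ℤ →₀ ℕ | d = b + Finsupp.single l 1}.Finite := fun l d =>
    Set.Subsingleton.finite fun b hb b' hb' => add_right_cancel (hb.symm.trans hb')
  rw [finsum_add_distrib, finsum_add_distrib, finsum_ite_single u1, map_smul, map_add, map_add,
    arcAct_single, smul_add, smul_add, smul_add, smul_add, actExp_eq]
  rotate_left
  · exact finite_support_ite ((Set.finite_singleton (a + Finsupp.single j 1)).subset fun b hb =>
      (u1 b).1 hb)
  · exact finite_support_ite (hfin _ _)
  · exact ((finite_support_ite ((Set.finite_singleton (a + Finsupp.single j 1)).subset fun b hb =>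
      (u1 b).1 hb)).union (finite_support_ite (hfin _ _))).subset (Function.support_add _ _)
  · exact finite_support_ite (hfin _ _)
  refine congrArg₂ (· + ·) (congrArg₂ (· + ·) ?_ ?_) ?_
  · rw [hallMap_single, hν, qFac_add_single, qInt_natCast_add_one, Finsupp.smul_single,
      Finsupp.smul_single, map_add, toZ_single, Nat.cast_one]
    have hf := qFac_ne_zero hq a
    have hn := q_sq_pow_sub_one_ne_zero hq (a j)
    have e3 : negExtWt (j - j) = 0 := by simp [negExtWt]
    rw [hsame, hdiff a (show j ≠ j + 1 by omega), e3, add_zero, toZ_apply, hexp, zpow_mul,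
      zpow_natCast, zpow_ofNat, smul_eq_mul, smul_eq_mul]
    congr 1
    field_simp
    ring
  · by_cases ha : a (j + 2) = 0
    · rw [toZ_apply, ha, Nat.cast_zero, qInt_zero, mul_zero, Finsupp.single_zero, smul_zero]
      rw [finsum_eq_zero_of_forall_eq_zero, map_zero, smul_zero]
      refine fun b => if_neg fun h => ?_
      have := DFunLike.congr_fun h (j + 2)
      simp [ha] at this
    · obtain ⟨c, rfl⟩ : ∃ c, a = c + Finsupp.single (j + 2) 1 :=
        ⟨_, (tsub_add_cancel_of_le (Finsupp.single_le_iff.2 (Nat.one_le_iff_ne_zero.2 ha))).symm⟩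
      have u2 : ∀ b, c + Finsupp.single (j + 2) 1 + Finsupp.single (j + 1) 1 =
          b + Finsupp.single (j + 2) 1 ↔ b = c + Finsupp.single (j + 1) 1 := fun b => by
        rw [add_right_comm, add_left_inj, eq_comm]
      have hf := qFac_ne_zero hq c
      have hn := q_sq_pow_sub_one_ne_zero hq (c (j + 1))
      have hn' := q_sq_pow_sub_one_ne_zero hq (c (j + 2))
      have e1 : negExtWt (j + 1 - j) = 0 := if_neg (by omega)
      have e2 : negExtWt (j + 2 - j) = 0 := if_neg (by omega)
      rw [finsum_ite_single u2, hallMap_single, hν, hν, e1, e2, add_zero, toZ_apply, hsame, hsame,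
        qFac_add_single, qFac_add_single, Nat.cast_add_one, qInt_natCast_add_one,
        qInt_natCast_add_one, hexp, Finsupp.smul_single, Finsupp.smul_single, smul_eq_mul,
        smul_eq_mul]
      congr 1
      · simp only [map_add, toZ_single, Nat.cast_one]
        abel
      · field_simp
  · by_cases ha : a (j + 3) = 0
    · rw [toZ_apply, ha, Nat.cast_zero, qInt_zero, mul_zero, mul_zero, Finsupp.single_zero,
        smul_zero, finsum_eq_zero_of_forall_eq_zero, map_zero, smul_zero]
      refine fun b => if_neg fun h => ?_
      have := DFunLike.congr_fun h (j + 3)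
      simp [ha] at this
    · obtain ⟨c, rfl⟩ : ∃ c, a = c + Finsupp.single (j + 3) 1 :=
        ⟨_, (tsub_add_cancel_of_le (Finsupp.single_le_iff.2 (Nat.one_le_iff_ne_zero.2 ha))).symm⟩
      have u3 : ∀ b, c + Finsupp.single (j + 3) 1 = b + Finsupp.single (j + 3) 1 ↔ b = c :=
        fun b => by rw [add_left_inj, eq_comm]
      have hf := qFac_ne_zero hq c
      have hn := q_sq_pow_sub_one_ne_zero hq (c (j + 3))
      -- Removing `E_{j+3}` raises the exponent of `|k|` by one, whence the factor `q²` in the last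
      -- summand of `arcAct`.
      have e1 : negExtWt (j + 3 - j) = -1 := by
        rw [show j + 3 - j = 3 by ring]; decide
      rw [finsum_ite_single u3, hallMap_single, hν, e1, toZ_apply, hsame, qFac_add_single,
        Nat.cast_add_one, qInt_natCast_add_one, hexp, zpow_add₀ hq2, Finsupp.smul_single,
        Finsupp.smul_single, smul_eq_mul, smul_eq_mul, zpow_neg_one]
      congr 1
      · simp only [map_add, toZ_single, Nat.cast_one]
        abel
      · field_simp

end Finite
end Act

end

/-! ### Commutation relations of the arc operators. -/

section

variable {K : Type*} [Field K] {q : K}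

theorem transl_mul (v w : ℤ →₀ ℤ) (c d : (ℤ →₀ ℤ) → K) :
    transl v c * transl w d = transl (w + v) fun a => d a * c (a + w) := by
  refine Finsupp.lhom_ext fun a x => ?_
  rw [Module.End.mul_apply, transl_single, transl_single, transl_single, add_assoc, mul_assoc]

theorem transl_comm {v w : ℤ →₀ ℤ} {c d : (ℤ →₀ ℤ) → K} {x : K}
    (h : ∀ a, d a * c (a + w) = x * (c a * d (a + v))) :
    transl v c * transl w d = x • (transl w d * transl v c) := by
  rw [transl_mul, transl_mul]
  refine Finsupp.lhom_ext fun a y => ?_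
  rw [LinearMap.smul_apply, transl_single, transl_single, Finsupp.smul_single, add_comm w v, h,
    smul_eq_mul]
  congr 1; ring

theorem transl_add (v : ℤ →₀ ℤ) (c d : (ℤ →₀ ℤ) → K) :
    transl v c + transl v d = transl v fun a => c a + d a := by
  refine Finsupp.lhom_ext fun a y => ?_
  rw [LinearMap.add_apply, transl_single, transl_single, transl_single, ← Finsupp.single_add,
    mul_add]

theorem smul_transl (x : K) (v : ℤ →₀ ℤ) (c : (ℤ →₀ ℤ) → K) :
    x • transl v c = transl v fun a => x * c a := by
  refine Finsupp.lhom_ext fun a y => ?_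
  rw [LinearMap.smul_apply, transl_single, transl_single, Finsupp.smul_single, smul_eq_mul]
  congr 1; ring

theorem transl_zero_one : transl 0 (fun _ => (1 : K)) = 1 := by
  refine Finsupp.lhom_ext fun a y => ?_
  rw [transl_single, add_zero, mul_one]; rfl

theorem actWt_zero : actWt 0 = 1 := by decide
theorem actWt_one : actWt 1 = 0 := by decide
theorem actWt_two : actWt 2 = -1 := by decide
theorem actWt_three : actWt 3 = -3 := by decide
theorem actWt_four : actWt 4 = -2 := by decide
theorem actWt_five : actWt 5 = 1 := by decide
theorem actWt_six : actWt 6 = 3 := by decide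
theorem actWt_neg_one : actWt (-1) = 1 := by decide
theorem actWt_neg_two : actWt (-2) = 0 := by decide
theorem actWt_neg_three : actWt (-3) = -1 := by decide

/-- The weight of the summand of the action adding the `j`-th arc. -/
def arcAddCoef (q : K) (j : ℤ) (a : ℤ →₀ ℤ) : K := q ^ actExp j a * q ^ (2 * a (j + 1))

/-- The weight of the summand of the action replacing the `(j + 2)`-th arc. -/
def arcMidCoef (q : K) (j : ℤ) (a : ℤ →₀ ℤ) : K := q ^ actExp j a * qInt q (a (j + 2))

/-- The weight of the summand of the action removing the `(j + 3)`-th arc. -/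
def arcDelCoef (q : K) (j : ℤ) (a : ℤ →₀ ℤ) : K :=
  q ^ actExp j a * (q ^ 2 / (q ^ 2 - 1) * qInt q (a (j + 3)))

/-- The summand of the action adding the `j`-th arc. -/
def arcAdd (q : K) (j : ℤ) : Module.End K ((ℤ →₀ ℤ) →₀ K) :=
  transl (Finsupp.single j 1) (arcAddCoef q j)

/-- The summand of the action replacing the `(j + 2)`-th arc. -/
def arcMid (q : K) (j : ℤ) : Module.End K ((ℤ →₀ ℤ) →₀ K) :=
  transl (Finsupp.single (j + 1) 1 - Finsupp.single (j + 2) 1) (arcMidCoef q j)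

/-- The summand of the action removing the `(j + 3)`-th arc. -/
def arcDel (q : K) (j : ℤ) : Module.End K ((ℤ →₀ ℤ) →₀ K) :=
  transl (-Finsupp.single (j + 3) 1) (arcDelCoef q j)

theorem arcAct_eq (q : K) (j : ℤ) : arcAct q j = arcAdd q j + arcMid q j + arcDel q j := rfl

theorem transl_eq {v w : ℤ →₀ ℤ} {c d : (ℤ →₀ ℤ) → K} (hvw : v = w) (hcd : ∀ a, c a = d a) :
    transl v c = transl w d := by
  rw [hvw, funext hcd]

theorem transl_eq_add {u v w w' : ℤ →₀ ℤ} {c d d' : (ℤ →₀ ℤ) → K} (hv : v = u) (hw : w = u)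
    (hw' : w' = u) (h : ∀ a, c a = d a + d' a) : transl v c = transl w d + transl w' d' := by
  rw [hv, hw, hw', transl_add, funext h]

theorem actWt_eq (n : ℤ) : actWt (3 * n) = (if 0 < n then 3 else 1) * (n.negOnePow : ℤ) ∧
    actWt (3 * n + 1) = (if 0 < n then 2 else 0) * (n.negOnePow : ℤ) ∧
    actWt (3 * n + 2) = -(n.negOnePow : ℤ) := by
  have h0 : 3 * n % 3 = 0 := by omega
  have h1 : (3 * n + 1) % 3 = 1 := by omega
  have h2 : (3 * n + 2) % 3 = 2 := by omega
  have h0' : 3 * n / 3 = n := by omega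
  have h1' : (3 * n + 1) / 3 = n := by omega
  have h2' : (3 * n + 2) / 3 = n := by omega
  refine ⟨?_, ?_, ?_⟩
  · by_cases h : 0 < n
    · have : 3 ≤ 3 * n := by omega
      simp [actWt, eulerWt, negExtWt, h0, h0', h, this]; ring
    · have : ¬ 3 ≤ 3 * n := by omega
      simp [actWt, eulerWt, negExtWt, h0, h0', h, this]
  · by_cases h : 0 < n
    · have : 3 ≤ 3 * n + 1 := by omega
      simp [actWt, eulerWt, negExtWt, h1, h1', h, this]
    · have : ¬ 3 ≤ 3 * n + 1 := by omega
      simp [actWt, eulerWt, negExtWt, h1, h, this]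
  · simp [actWt, eulerWt, negExtWt, h2, h2', Int.negOnePow_succ]

/-- The Euler form is additive on the triangle formed by `E_j`, `E_{j+1}`, `E_{j+2}`. Truncation to
negative extensions breaks this only at `d = 3`. -/
theorem actWt_add_actWt (d : ℤ) : actWt d + actWt (d - 2) + (if d = 3 then 2 else 0) =
    actWt (d - 1) := by
  obtain ⟨n, hn⟩ : ∃ n, d = 3 * n ∨ d = 3 * n + 1 ∨ d = 3 * n + 2 := ⟨d / 3, by omega⟩
  have e := actWt_eq n
  have e' := actWt_eq (n - 1)
  have hs : ((n - 1).negOnePow : ℤ) = -(n.negOnePow : ℤ) := by simp [Int.negOnePow_sub]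
  rw [hs, show 3 * (n - 1) = 3 * n - 3 by ring] at e'
  have h1 : ((1 : ℤ).negOnePow : ℤ) = -1 := rfl
  rcases hn with rfl | rfl | rfl
  · rw [e.1, show 3 * n - 2 = 3 * n - 3 + 1 by ring, show 3 * n - 1 = 3 * n - 3 + 2 by ring, e'.2.1,
      e'.2.2]
    by_cases hn1 : n = 1
    · subst hn1; simp
    · split_ifs <;> omega
  · rw [e.2.1, show 3 * n + 1 - 2 = 3 * n - 3 + 2 by ring, show 3 * n + 1 - 1 = 3 * n by ring, e.1,
      e'.2.2]
    split_ifs <;> omega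
  · rw [e.2.2, show 3 * n + 2 - 2 = 3 * n by ring, show 3 * n + 2 - 1 = 3 * n + 1 by ring, e.1,
      e.2.1]
    split_ifs <;> omega

theorem actExp_add_two (j : ℤ) (a : ℤ →₀ ℤ) :
    actExp j a + actExp (j + 2) a + 2 * a (j + 3) = actExp (j + 1) a := by
  induction a using Finsupp.induction_linear with
  | zero => simp
  | add a b ha hb =>
    rw [map_add (actExp j), map_add (actExp (j + 2)), map_add (actExp (j + 1)), Finsupp.add_apply]
    linarith
  | single l x =>
    have h := actWt_add_actWt (l - j)
    rw [actExp_single, actExp_single, actExp_single, Finsupp.single_apply,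
      show l - (j + 2) = l - j - 2 by ring, show l - (j + 1) = l - j - 1 by ring, ← h]
    split_ifs <;> first | omega | ring

/-- `E_{j+3}` is a shift of `E_j`, so the Euler exponents cancel; the correction at `d = 3` and `d =
4` comes from the extensions that the shift moves across the truncation. -/
theorem actWt_add_actWt_three (d : ℤ) : actWt d + actWt (d - 3) +
    ((if d = 3 then 2 else 0) + if d = 4 then 2 else 0) = 0 := by
  obtain ⟨n, hn⟩ : ∃ n, d = 3 * n ∨ d = 3 * n + 1 ∨ d = 3 * n + 2 := ⟨d / 3, by omega⟩
  have e := actWt_eq n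
  have e' := actWt_eq (n - 1)
  have hs : ((n - 1).negOnePow : ℤ) = -(n.negOnePow : ℤ) := by simp [Int.negOnePow_sub]
  rw [hs, show 3 * (n - 1) = 3 * n - 3 by ring] at e'
  rcases hn with rfl | rfl | rfl
  · rw [e.1, e'.1]
    by_cases hn1 : n = 1
    · subst hn1; simp
    · split_ifs <;> omega
  · rw [e.2.1, show 3 * n + 1 - 3 = 3 * n - 3 + 1 by ring, e'.2.1]
    by_cases hn1 : n = 1
    · subst hn1; simp
    · split_ifs <;> omega
  · rw [e.2.2, show 3 * n + 2 - 3 = 3 * n - 3 + 2 by ring, e'.2.2]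
    split_ifs <;> omega

theorem actExp_add_three (j : ℤ) (a : ℤ →₀ ℤ) :
    actExp j a + actExp (j + 3) a + 2 * a (j + 3) + 2 * a (j + 4) = 0 := by
  induction a using Finsupp.induction_linear with
  | zero => simp
  | add a b ha hb =>
    rw [map_add (actExp j), map_add (actExp (j + 3)), Finsupp.add_apply, Finsupp.add_apply]
    linarith
  | single l x =>
    have h := congrArg (x * ·) (actWt_add_actWt_three (l - j))
    simp only [mul_zero] at h
    rw [actExp_single, actExp_single, Finsupp.single_apply, Finsupp.single_apply,
      show l - (j + 3) = l - j - 3 by ring]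
    refine Eq.trans ?_ h
    split_ifs <;> first | omega | ring

set_option linter.unusedSimpArgs false

/-- Seven of the nine products of summands commute up to `q` individually. The other two translate
by the same vector, and only their sum obeys the rule (`hs`). -/
theorem arcAct_mul_arcAct_one (hq0 : q ≠ 0) (hq1 : q ^ 2 - 1 ≠ 0) (j : ℤ) :
    arcAct q j * arcAct q (j + 1) = q ^ (1 : ℤ) • (arcAct q (j + 1) * arcAct q j) := by
  obtain ⟨hAA, hAM, hAD, hMA, hMD, hDM, hDD⟩ :
      arcAdd q j * arcAdd q (j + 1) = q ^ (1 : ℤ) • (arcAdd q (j + 1) * arcAdd q j) ∧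
      arcAdd q j * arcMid q (j + 1) = q ^ (1 : ℤ) • (arcMid q (j + 1) * arcAdd q j) ∧
      arcAdd q j * arcDel q (j + 1) = q ^ (1 : ℤ) • (arcDel q (j + 1) * arcAdd q j) ∧
      arcMid q j * arcAdd q (j + 1) = q ^ (1 : ℤ) • (arcAdd q (j + 1) * arcMid q j) ∧
      arcMid q j * arcDel q (j + 1) = q ^ (1 : ℤ) • (arcDel q (j + 1) * arcMid q j) ∧
      arcDel q j * arcMid q (j + 1) = q ^ (1 : ℤ) • (arcMid q (j + 1) * arcDel q j) ∧
      arcDel q j * arcDel q (j + 1) = q ^ (1 : ℤ) • (arcDel q (j + 1) * arcDel q j) := by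
    refine ⟨?_, ?_, ?_, ?_, ?_, ?_, ?_⟩ <;> refine transl_comm fun a => ?_
    all_goals
      simp only [arcAddCoef, arcMidCoef, arcDelCoef, qInt, map_add, map_sub, map_neg, actExp_single,
        Finsupp.add_apply, Finsupp.sub_apply, Finsupp.neg_apply, Finsupp.single_apply, add_assoc,
        add_sub_add_left_eq_sub, add_sub_cancel_left, sub_add_cancel_left, sub_self, one_mul,
        add_right_inj, add_eq_left, left_eq_add]
      norm_num [actWt_zero, actWt_one, actWt_two, actWt_three, actWt_four, actWt_five, actWt_six,
        actWt_neg_one, actWt_neg_two, actWt_neg_three]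
      simp only [mul_add, mul_sub, mul_one, mul_neg, zpow_add₀ hq0, zpow_sub₀ hq0, zpow_neg, zpow_ofNat, zpow_one]
      field_simp
      try ring
  have hs : arcMid q j * arcMid q (j + 1) + arcDel q j * arcAdd q (j + 1) =
      q ^ (1 : ℤ) • (arcMid q (j + 1) * arcMid q j) + q ^ (1 : ℤ) • (arcAdd q (j + 1) * arcDel q j) := by
    simp only [arcAdd, arcMid, arcDel, transl_mul, smul_transl]
    rw [transl_eq (v := Finsupp.single (j + 1) 1 + -Finsupp.single (j + 3) 1)
      (w := Finsupp.single (j + 1 + 1) 1 - Finsupp.single (j + 1 + 2) 1 +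
        (Finsupp.single (j + 1) 1 - Finsupp.single (j + 2) 1)) ?_ fun _ => rfl,
      transl_eq (v := -Finsupp.single (j + 3) 1 + Finsupp.single (j + 1) 1)
      (w := Finsupp.single (j + 1) 1 - Finsupp.single (j + 2) 1 +
        (Finsupp.single (j + 1 + 1) 1 - Finsupp.single (j + 1 + 2) 1)) ?_ fun _ => rfl,
      transl_add, transl_add]
    refine transl_eq (add_comm _ _) fun a => ?_
    simp only [arcAddCoef, arcMidCoef, arcDelCoef, qInt, map_add, map_sub, map_neg, actExp_single,
      Finsupp.add_apply, Finsupp.sub_apply, Finsupp.neg_apply, Finsupp.single_apply, add_assoc,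
      add_sub_add_left_eq_sub, add_sub_cancel_left, sub_add_cancel_left, sub_self, one_mul,
      add_right_inj, add_eq_left, left_eq_add]
    norm_num [actWt_zero, actWt_one, actWt_two, actWt_three, actWt_four, actWt_five, actWt_six,
      actWt_neg_one, actWt_neg_two, actWt_neg_three]
    simp only [mul_add, mul_sub, mul_one, mul_neg, zpow_add₀ hq0, zpow_sub₀ hq0, zpow_neg, zpow_ofNat, zpow_one]
    field_simp
    try ring
    all_goals rw [show j + 1 + 1 = j + 2 by ring, show j + 1 + 2 = j + 3 by ring]; abel
  have hexp : arcAct q j * arcAct q (j + 1) = arcMid q j * arcMid q (j + 1) +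
      arcDel q j * arcAdd q (j + 1) + (arcAdd q j * arcAdd q (j + 1) + arcAdd q j * arcMid q (j + 1) +
      arcAdd q j * arcDel q (j + 1) + arcMid q j * arcAdd q (j + 1) + arcMid q j * arcDel q (j + 1) +
      arcDel q j * arcMid q (j + 1) + arcDel q j * arcDel q (j + 1)) := by
    rw [arcAct_eq, arcAct_eq]
    simp only [mul_add, add_mul]
    abel
  rw [hexp, hs, hAA, hAM, hAD, hMA, hMD, hDM, hDD, arcAct_eq, arcAct_eq]
  simp only [mul_add, add_mul, smul_add]
  abel

/-- Six products commute up to `q⁻¹`. The defects of the remaining three are, up to `q⁻¹`, the three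
summands of `arcAct q (j + 1)`; their exponents match by `actExp_add_two`. -/
theorem arcAct_mul_arcAct_two (hq0 : q ≠ 0) (hq1 : q ^ 2 - 1 ≠ 0) (j : ℤ) :
    arcAct q j * arcAct q (j + 2) = q ^ (-1 : ℤ) • (arcAct q (j + 2) * arcAct q j) +
      q⁻¹ • arcAct q (j + 1) := by
  obtain ⟨hAA, hAM, hAD, hMM, hMD, hDD⟩ :
      arcAdd q j * arcAdd q (j + 2) = q ^ (-1 : ℤ) • (arcAdd q (j + 2) * arcAdd q j) ∧
      arcAdd q j * arcMid q (j + 2) = q ^ (-1 : ℤ) • (arcMid q (j + 2) * arcAdd q j) ∧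
      arcAdd q j * arcDel q (j + 2) = q ^ (-1 : ℤ) • (arcDel q (j + 2) * arcAdd q j) ∧
      arcMid q j * arcMid q (j + 2) = q ^ (-1 : ℤ) • (arcMid q (j + 2) * arcMid q j) ∧
      arcMid q j * arcDel q (j + 2) = q ^ (-1 : ℤ) • (arcDel q (j + 2) * arcMid q j) ∧
      arcDel q j * arcDel q (j + 2) = q ^ (-1 : ℤ) • (arcDel q (j + 2) * arcDel q j) := by
    refine ⟨?_, ?_, ?_, ?_, ?_, ?_⟩ <;> refine transl_comm fun a => ?_
    all_goals
      simp only [arcAddCoef, arcMidCoef, arcDelCoef, qInt, map_add, map_sub, map_neg, actExp_single,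
        Finsupp.add_apply, Finsupp.sub_apply, Finsupp.neg_apply, Finsupp.single_apply, add_assoc,
        add_sub_add_left_eq_sub, add_sub_cancel_left, sub_add_cancel_left, sub_self, one_mul,
        add_right_inj, add_eq_left, left_eq_add]
      norm_num [actWt_zero, actWt_one, actWt_two, actWt_three, actWt_four, actWt_five, actWt_six,
        actWt_neg_one, actWt_neg_two, actWt_neg_three]
      simp only [mul_add, mul_sub, mul_one, mul_neg, zpow_add₀ hq0, zpow_sub₀ hq0, zpow_neg, zpow_ofNat, zpow_one]
      field_simp
      try ring
  have hE : ∀ a, q ^ actExp (j + 1) a = q ^ actExp j a * q ^ actExp (j + 2) a * q ^ (2 * a (j + 3)) :=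
    fun a => by rw [← actExp_add_two, zpow_add₀ hq0, zpow_add₀ hq0]
  obtain ⟨hMA, hDA, hDM⟩ :
      arcMid q j * arcAdd q (j + 2) = q ^ (-1 : ℤ) • (arcAdd q (j + 2) * arcMid q j) +
        q⁻¹ • arcAdd q (j + 1) ∧
      arcDel q j * arcAdd q (j + 2) = q ^ (-1 : ℤ) • (arcAdd q (j + 2) * arcDel q j) +
        q⁻¹ • arcMid q (j + 1) ∧
      arcDel q j * arcMid q (j + 2) = q ^ (-1 : ℤ) • (arcMid q (j + 2) * arcDel q j) +
        q⁻¹ • arcDel q (j + 1) := by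
    simp only [arcAdd, arcMid, arcDel, transl_mul, ← transl_zero_one, smul_transl]
    refine ⟨transl_eq_add (u := Finsupp.single (j + 1) 1) ?_ ?_ ?_ fun a => ?_,
      transl_eq_add (u := Finsupp.single (j + 2) 1 - Finsupp.single (j + 3) 1) ?_ ?_ ?_ fun a => ?_,
      transl_eq_add (u := -Finsupp.single (j + 4) 1) ?_ ?_ ?_ fun a => ?_⟩
    any_goals first
      | abel1 | (simp only [add_assoc]; norm_num; done) | (simp only [add_assoc]; norm_num; abel1)
    all_goals
      simp only [arcAddCoef, arcMidCoef, arcDelCoef, qInt, map_add, map_sub, map_neg, actExp_single,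
        Finsupp.add_apply, Finsupp.sub_apply, Finsupp.neg_apply, Finsupp.single_apply, add_assoc,
        add_sub_add_left_eq_sub, add_sub_cancel_left, sub_add_cancel_left, sub_self, one_mul,
        add_right_inj, add_eq_left, left_eq_add]
      norm_num [actWt_zero, actWt_one, actWt_two, actWt_three, actWt_four, actWt_five, actWt_six,
        actWt_neg_one, actWt_neg_two, actWt_neg_three]
      simp only [mul_add, mul_sub, mul_one, mul_neg, zpow_add₀ hq0, zpow_sub₀ hq0, zpow_neg, hE a, zpow_ofNat, zpow_one]
      field_simp
      try ring
  rw [arcAct_eq, arcAct_eq, arcAct_eq]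
  simp only [mul_add, add_mul, smul_add, hAA, hAM, hAD, hMA, hMM, hMD, hDA, hDM, hDD]
  abel

/-- Only removing `E_{j+3}` after adding it fails to commute up to `q⁻²`; the defect is a
translation by zero, and `actExp_add_three` shows that it is a constant. -/
theorem arcAct_mul_arcAct_three (hq0 : q ≠ 0) (hq1 : q ^ 2 - 1 ≠ 0) (j : ℤ) :
    arcAct q j * arcAct q (j + 3) = q ^ (-2 : ℤ) • (arcAct q (j + 3) * arcAct q j) +
      (q⁻¹ / (q ^ 2 - 1)) • 1 := by
  obtain ⟨hAA, hAM, hAD, hMA, hMM, hMD, hDM, hDD⟩ :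
      arcAdd q j * arcAdd q (j + 3) = q ^ (-2 : ℤ) • (arcAdd q (j + 3) * arcAdd q j) ∧
      arcAdd q j * arcMid q (j + 3) = q ^ (-2 : ℤ) • (arcMid q (j + 3) * arcAdd q j) ∧
      arcAdd q j * arcDel q (j + 3) = q ^ (-2 : ℤ) • (arcDel q (j + 3) * arcAdd q j) ∧
      arcMid q j * arcAdd q (j + 3) = q ^ (-2 : ℤ) • (arcAdd q (j + 3) * arcMid q j) ∧
      arcMid q j * arcMid q (j + 3) = q ^ (-2 : ℤ) • (arcMid q (j + 3) * arcMid q j) ∧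
      arcMid q j * arcDel q (j + 3) = q ^ (-2 : ℤ) • (arcDel q (j + 3) * arcMid q j) ∧
      arcDel q j * arcMid q (j + 3) = q ^ (-2 : ℤ) • (arcMid q (j + 3) * arcDel q j) ∧
      arcDel q j * arcDel q (j + 3) = q ^ (-2 : ℤ) • (arcDel q (j + 3) * arcDel q j) := by
    refine ⟨?_, ?_, ?_, ?_, ?_, ?_, ?_, ?_⟩ <;> refine transl_comm fun a => ?_
    all_goals
      simp only [arcAddCoef, arcMidCoef, arcDelCoef, qInt, map_add, map_sub, map_neg, actExp_single,
        Finsupp.add_apply, Finsupp.sub_apply, Finsupp.neg_apply, Finsupp.single_apply, add_assoc,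
        add_sub_add_left_eq_sub, add_sub_cancel_left, sub_add_cancel_left, sub_self, one_mul,
        add_right_inj, add_eq_left, left_eq_add]
      norm_num [actWt_zero, actWt_one, actWt_two, actWt_three, actWt_four, actWt_five, actWt_six,
        actWt_neg_one, actWt_neg_two, actWt_neg_three]
      simp only [mul_add, mul_sub, mul_one, mul_neg, zpow_add₀ hq0, zpow_sub₀ hq0, zpow_neg, zpow_ofNat, zpow_one]
      field_simp
      try ring
  have hE : ∀ a, q ^ actExp j a * q ^ actExp (j + 3) a * (q ^ (2 * a (j + 3)) *
      q ^ (2 * a (j + 4))) = 1 := fun a => by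
    rw [← zpow_add₀ hq0, ← zpow_add₀ hq0, ← zpow_add₀ hq0, ← add_assoc, actExp_add_three, zpow_zero]
  have hDA :
      arcDel q j * arcAdd q (j + 3) = q ^ (-2 : ℤ) • (arcAdd q (j + 3) * arcDel q j) +
        (q⁻¹ / (q ^ 2 - 1)) • 1 := by
    simp only [arcAdd, arcMid, arcDel, transl_mul, ← transl_zero_one, smul_transl]
    refine transl_eq_add (u := 0) ?_ ?_ ?_ fun a => ?_
    any_goals abel1
    all_goals
      simp only [arcAddCoef, arcMidCoef, arcDelCoef, qInt, map_add, map_sub, map_neg, actExp_single,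
        Finsupp.add_apply, Finsupp.sub_apply, Finsupp.neg_apply, Finsupp.single_apply, add_assoc,
        add_sub_add_left_eq_sub, add_sub_cancel_left, sub_add_cancel_left, sub_self, one_mul,
        add_right_inj, add_eq_left, left_eq_add]
      norm_num [actWt_zero, actWt_one, actWt_two, actWt_three, actWt_four, actWt_five, actWt_six,
        actWt_neg_one, actWt_neg_two, actWt_neg_three]
      simp only [mul_add, mul_sub, mul_one, mul_neg, zpow_add₀ hq0, zpow_sub₀ hq0, zpow_neg, zpow_ofNat, zpow_one]
      linear_combination (norm := (field_simp; try ring)) (q⁻¹ / (q ^ 2 - 1)) * hE a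
  rw [arcAct_eq, arcAct_eq]
  simp only [mul_add, add_mul, smul_add, hAA, hAM, hAD, hMA, hMM, hMD, hDA, hDM, hDD]
  abel

theorem transl_comm_of_linear (hq0 : q ≠ 0) {v w : ℤ →₀ ℤ} {c d t u : (ℤ →₀ ℤ) → K}
    {f g : (ℤ →₀ ℤ) →ₗ[ℤ] ℤ} (hc : ∀ a, c a = q ^ f a * t a) (hd : ∀ a, d a = q ^ g a * u a)
    (ht : ∀ a, t (a + w) = t a) (hu : ∀ a, u (a + v) = u a) {x : ℤ} (hx : f w = x + g v) :
    transl v c * transl w d = q ^ x • (transl w d * transl v c) := by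
  refine transl_comm fun a => ?_
  rw [hc, hc, hd, hd, ht, hu, map_add, map_add, hx, zpow_add₀ hq0, zpow_add₀ hq0, zpow_add₀ hq0]
  ring

/-- Outside the range of the correction terms the weights are exactly additive on triangles and
antisymmetric under shift. -/
theorem actWt_recursion {d : ℤ} (hd : 3 ≤ d ∨ d < -3) :
    actWt (d + 1) = actWt d + actWt (d + 2) ∧ actWt (d + 3) = -actWt d := by
  have h1 := actWt_add_actWt (d + 2)
  have h2 := actWt_add_actWt_three (d + 3)
  rw [if_neg (by omega)] at h1
  rw [if_neg (by omega), if_neg (by omega)] at h2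
  rw [show d + 2 - 2 = d by ring, show d + 2 - 1 = d + 1 by ring] at h1
  rw [show d + 3 - 3 = d by ring] at h2
  omega

/-- At distance at least four the non-exponential factor of one operator does not see the
translation of the other. So all nine products commute up to powers of `q`, and the powers agree by
`actWt_recursion`. -/
theorem arcAct_mul_arcAct_of_le (hq0 : q ≠ 0) {j l : ℤ} (h : j + 4 ≤ l) :
    arcAct q j * arcAct q l = q ^ (actWt (l - j) - actWt (j - l)) • (arcAct q l * arcAct q j) := by
  have e1 := actWt_recursion (d := l - j) (by omega)
  have e2 := actWt_recursion (d := j - l) (by omega)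
  rw [show l - j + 1 = l + 1 - j by ring, show l - j + 2 = l + 2 - j by ring,
    show l - j + 3 = l + 3 - j by ring] at e1
  rw [show j - l + 1 = j + 1 - l by ring, show j - l + 2 = j + 2 - l by ring,
    show j - l + 3 = j + 3 - l by ring] at e2
  have n : ∀ (a : ℤ →₀ ℤ) {m m' : ℤ}, m ≠ m' → (a + Finsupp.single m 1 : ℤ →₀ ℤ) m' = a m' := by
    intro a m m' hm; simp [hm]
  have n' : ∀ (a : ℤ →₀ ℤ) {m m' m'' : ℤ}, m ≠ m'' → m' ≠ m'' →
      (a + (Finsupp.single m 1 - Finsupp.single m' 1) : ℤ →₀ ℤ) m'' = a m'' := by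
    intro a m m' m'' hm hm'; simp [hm, hm']
  have n'' : ∀ (a : ℤ →₀ ℤ) {m m' : ℤ}, m ≠ m' → (a + -Finsupp.single m 1 : ℤ →₀ ℤ) m' = a m' := by
    intro a m m' hm; simp [hm]
  obtain ⟨hAA, hAM, hAD, hMA, hMM, hMD, hDA, hDM, hDD⟩ :
      arcAdd q j * arcAdd q l =
        q ^ (actWt (l - j) - actWt (j - l)) • (arcAdd q l * arcAdd q j) ∧
      arcAdd q j * arcMid q l =
        q ^ (actWt (l - j) - actWt (j - l)) • (arcMid q l * arcAdd q j) ∧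
      arcAdd q j * arcDel q l =
        q ^ (actWt (l - j) - actWt (j - l)) • (arcDel q l * arcAdd q j) ∧
      arcMid q j * arcAdd q l =
        q ^ (actWt (l - j) - actWt (j - l)) • (arcAdd q l * arcMid q j) ∧
      arcMid q j * arcMid q l =
        q ^ (actWt (l - j) - actWt (j - l)) • (arcMid q l * arcMid q j) ∧
      arcMid q j * arcDel q l =
        q ^ (actWt (l - j) - actWt (j - l)) • (arcDel q l * arcMid q j) ∧
      arcDel q j * arcAdd q l =
        q ^ (actWt (l - j) - actWt (j - l)) • (arcAdd q l * arcDel q j) ∧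
      arcDel q j * arcMid q l =
        q ^ (actWt (l - j) - actWt (j - l)) • (arcMid q l * arcDel q j) ∧
      arcDel q j * arcDel q l =
        q ^ (actWt (l - j) - actWt (j - l)) • (arcDel q l * arcDel q j) := by
    refine ⟨?_, ?_, ?_, ?_, ?_, ?_, ?_, ?_, ?_⟩ <;>
      refine transl_comm_of_linear hq0 (fun _ => rfl) (fun _ => rfl) (fun a => ?_) (fun a => ?_) ?_
    any_goals
      first | rw [n a (by omega)] | rw [n'' a (by omega)] | rw [n' a (by omega) (by omega)]
    all_goals
      simp only [map_sub, map_neg, actExp_single, one_mul]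
      omega
  rw [arcAct_eq, arcAct_eq]
  simp only [mul_add, add_mul, smul_add, hAA, hAM, hAD, hMA, hMM, hMD, hDA, hDM, hDD]
  abel

end

/-! ### Straightening -/

section Straighten

variable {K : Type*} [Field K] {B : Type*} [Ring B] [Algebra K B]

/-- The exponent of the commutation rule of two arcs. -/
def commExp (d : ℤ) : ℤ :=
  if d % 3 = 0 then 2 * ((d / 3).negOnePow : ℤ) else
    if d % 3 = 1 then ((d / 3).negOnePow : ℤ) else -((d / 3).negOnePow : ℤ)

/-- The lower order term of the commutation rule of two arcs. -/
def commTail (q : K) (x : ℤ → B) (j l : ℤ) : B :=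
  if l = j + 2 then q⁻¹ • x (j + 1) else if l = j + 3 then (q⁻¹ / (q ^ 2 - 1)) • 1 else 0

/-- A family of elements satisfying the commutation rules of the arcs of a disk. -/
def IsArcFamily (q : K) (x : ℤ → B) : Prop := ∀ j l, j < l →
  x l * x j = q ^ commExp (l - j) • (x j * x l) + commTail q x j l

/-- The span of the words of length less than `n`. -/
def wordsLT (K : Type*) [Field K] {B : Type*} [Ring B] [Algebra K B] (x : ℤ → B) (n : ℕ) :
    Submodule K B :=
  Submodule.span K {b | ∃ w : List ℤ, w.length < n ∧ (w.map x).prod = b}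

theorem word_mem_wordsLT {x : ℤ → B} {n : ℕ} {w : List ℤ} (h : w.length < n) :
    (w.map x).prod ∈ wordsLT K x n := Submodule.subset_span ⟨w, h, rfl⟩

theorem mul_mem_wordsLT {x : ℤ → B} {n : ℕ} (i : ℤ) {b : B} (h : b ∈ wordsLT K x n) :
    x i * b ∈ wordsLT K x (n + 1) := by
  have : wordsLT K x n ≤ (wordsLT K x (n + 1)).comap (LinearMap.mulLeft K (x i)) := by
    rw [wordsLT, Submodule.span_le]
    rintro _ ⟨w, hw, rfl⟩
    exact Submodule.subset_span ⟨i :: w, by simpa using hw, by simp⟩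
  exact this h

variable {q : K} {x : ℤ → B}

/-- The correction in a commutation rule has at most one letter in place of two, so exchanging
neighbours costs a scalar and shorter words. -/
theorem IsArcFamily.exists_swap (hx : IsArcFamily q x) (hq : q ≠ 0) (i j : ℤ) (w : List ℤ) :
    ∃ c : K, ((i :: j :: w).map x).prod - c • ((j :: i :: w).map x).prod ∈
      wordsLT K x (w.length + 2) := by
  have htail : ∀ i j, commTail q x i j * (w.map x).prod ∈ wordsLT K x (w.length + 2) := by
    intro i j
    rw [commTail]
    split_ifs
    · rw [smul_mul_assoc]
      refine Submodule.smul_mem _ _ ?_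
      rw [← List.prod_cons, ← List.map_cons]
      exact word_mem_wordsLT (by simp)
    · rw [smul_mul_assoc, one_mul]
      exact Submodule.smul_mem _ _ (word_mem_wordsLT (by omega))
    · rw [zero_mul]; exact zero_mem _
  rcases lt_trichotomy i j with h | rfl | h
  · refine ⟨(q ^ commExp (j - i))⁻¹, ?_⟩
    have h1 := hx i j h
    have h0 : q ^ commExp (j - i) ≠ 0 := zpow_ne_zero _ hq
    simp only [List.map_cons, List.prod_cons]
    rw [← mul_assoc, ← mul_assoc, h1, add_mul, smul_add, smul_mul_assoc, inv_smul_smul₀ h0,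
      sub_add_cancel_left]
    exact neg_mem (Submodule.smul_mem _ _ (htail i j))
  · exact ⟨1, by rw [one_smul, sub_self]; exact zero_mem _⟩
  · refine ⟨q ^ commExp (i - j), ?_⟩
    have h1 := hx j i h
    simp only [List.map_cons, List.prod_cons]
    rw [← mul_assoc, ← mul_assoc, h1, add_mul, smul_mul_assoc, add_sub_cancel_left]
    exact htail j i

theorem IsArcFamily.exists_of_perm (hx : IsArcFamily q x) (hq : q ≠ 0) {w w' : List ℤ}
    (h : w.Perm w') :
    ∃ c : K, (w.map x).prod - c • (w'.map x).prod ∈ wordsLT K x w.length := by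
  induction h with
  | nil => exact ⟨1, by rw [one_smul, sub_self]; exact zero_mem _⟩
  | cons i h ih =>
    obtain ⟨c, hc⟩ := ih
    refine ⟨c, ?_⟩
    simp only [List.map_cons, List.prod_cons, List.length_cons]
    rw [← mul_smul_comm, ← mul_sub]
    exact mul_mem_wordsLT i hc
  | swap i j w => exact hx.exists_swap hq j i w
  | trans h h' ih ih' =>
    obtain ⟨c, hc⟩ := ih
    obtain ⟨c', hc'⟩ := ih'
    refine ⟨c * c', ?_⟩
    rw [← h.length_eq] at hc'
    have := add_mem hc (Submodule.smul_mem _ c hc')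
    rwa [smul_sub, smul_smul, sub_add_sub_cancel] at this

/-- The product of a multiset of arcs in increasing order. -/
def sortedWord (x : ℤ → B) (m : Multiset ℤ) : B := ((m.sort (· ≤ ·)).map x).prod

/-- Sorting a word changes it by a scalar and strictly shorter words, so induction on the length
applies. -/
theorem IsArcFamily.word_mem_span (hx : IsArcFamily q x) (hq : q ≠ 0) (w : List ℤ) :
    (w.map x).prod ∈ Submodule.span K (Set.range (sortedWord x)) := by
  induction hn : w.length using Nat.strong_induction_on generalizing w with
  | _ n ih =>
    subst hn
    have hp : w.Perm ((w : Multiset ℤ).sort (· ≤ ·)) :=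
      Multiset.coe_eq_coe.1 (Multiset.sort_eq (w : Multiset ℤ) (· ≤ ·)).symm
    obtain ⟨c, hc⟩ := hx.exists_of_perm hq hp
    have h1 : wordsLT K x w.length ≤ Submodule.span K (Set.range (sortedWord x)) := by
      rw [wordsLT, Submodule.span_le]
      rintro _ ⟨w', hw', rfl⟩
      exact ih _ hw' w' rfl
    have h2 := add_mem (h1 hc) (Submodule.smul_mem _ c
      (Submodule.subset_span ⟨(w : Multiset ℤ), rfl⟩))
    rwa [sortedWord, sub_add_cancel] at h2

theorem IsArcFamily.lift_mem_span (hx : IsArcFamily q x) (hq : q ≠ 0) {ι : Type*} (e : ι → ℤ)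
    (w : FreeAlgebra K ι) : FreeAlgebra.lift K (fun i => x (e i)) w ∈
      Submodule.span K (Set.range (sortedWord x)) := by
  have h1 : FreeAlgebra.lift K (fun i => x (e i)) w ∈ Algebra.adjoin K (Set.range x) := by
    induction w using FreeAlgebra.induction with
    | grade0 r => rw [AlgHom.commutes]; exact Subalgebra.algebraMap_mem _ _
    | grade1 i =>
      rw [FreeAlgebra.lift_ι_apply]; exact Algebra.subset_adjoin ⟨_, rfl⟩
    | mul a b ha hb => rw [map_mul]; exact mul_mem ha hb
    | add a b ha hb => rw [map_add]; exact add_mem ha hb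
  rw [← Subalgebra.mem_toSubmodule, Algebra.adjoin_eq_span] at h1
  refine Submodule.span_le.2 ?_ h1
  intro b hb
  obtain ⟨l, hl, rfl⟩ := Submonoid.exists_list_of_mem_closure hb
  obtain ⟨w, rfl⟩ : ∃ w : List ℤ, w.map x = l := by
    induction l with
    | nil => exact ⟨[], rfl⟩
    | cons y l ih =>
      obtain ⟨i, hi⟩ := hl y (by simp)
      obtain ⟨w, hw⟩ := ih (fun z hz => hl z (by simp [hz]))
        (Submonoid.list_prod_mem _ fun z hz => Submonoid.subset_closure (hl z (by simp [hz])))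
      exact ⟨i :: w, by rw [List.map_cons, hi, hw]⟩
  exact hx.word_mem_span hq w

end Straighten

/-! ### The action is an arc family -/

section Action

variable {K : Type*} [Field K] {q : K}

theorem commExp_eq {d : ℤ} (hd : 4 ≤ d) : actWt d - actWt (-d) = commExp d := by
  obtain ⟨n, hn⟩ : ∃ n, d = 3 * n ∨ d = 3 * n + 1 ∨ d = 3 * n + 2 := ⟨d / 3, by omega⟩
  have hs : ((-n).negOnePow : ℤ) = (n.negOnePow : ℤ) := by simp
  have hs' : ((-n - 1).negOnePow : ℤ) = -(n.negOnePow : ℤ) := by simp [Int.negOnePow_sub]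
  rcases hn with rfl | rfl | rfl
  · rw [show -(3 * n) = 3 * -n by ring, (actWt_eq n).1, (actWt_eq (-n)).1, commExp,
      if_pos (by omega), if_neg (by omega), if_pos (by omega), show 3 * n / 3 = n by omega, hs]
    ring
  · rw [show -(3 * n + 1) = 3 * (-n - 1) + 2 by ring, (actWt_eq n).2.1, (actWt_eq (-n - 1)).2.2,
      commExp, if_pos (by omega), if_neg (by omega), if_pos (by omega),
      show (3 * n + 1) / 3 = n by omega, hs']
    ring
  · rw [show -(3 * n + 2) = 3 * (-n - 1) + 1 by ring, (actWt_eq n).2.2, (actWt_eq (-n - 1)).2.1,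
      commExp, if_neg (by omega), if_neg (by omega), if_neg (by omega),
      show (3 * n + 2) / 3 = n by omega]
    ring

/-- The opposite algebra appears because the disk algebra carries the opposite Hall product: the
first letter of a word acts first. -/
theorem isArcFamily_arcAct (hq0 : q ≠ 0) (hq1 : q ^ 2 - 1 ≠ 0) :
    IsArcFamily q fun j => MulOpposite.op (arcAct q j) := by
  intro j l hjl
  apply MulOpposite.unop_injective
  have htail : MulOpposite.unop (commTail q (fun j => MulOpposite.op (arcAct q j)) j l) =
      if l = j + 2 then q⁻¹ • arcAct q (j + 1) else
        if l = j + 3 then (q⁻¹ / (q ^ 2 - 1)) • 1 else 0 := by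
    rw [commTail]; split_ifs <;> rfl
  rw [MulOpposite.unop_add, htail]
  change arcAct q j * arcAct q l = q ^ commExp (l - j) • (arcAct q l * arcAct q j) + _
  by_cases h1 : l = j + 1
  · subst h1
    rw [if_neg (by omega), if_neg (by omega), add_zero, arcAct_mul_arcAct_one hq0 hq1,
      show j + 1 - j = 1 by ring, show commExp 1 = 1 from rfl]
  by_cases h2 : l = j + 2
  · subst h2
    rw [if_pos rfl, arcAct_mul_arcAct_two hq0 hq1, show j + 2 - j = 2 by ring,
      show commExp 2 = -1 from rfl]
  by_cases h3 : l = j + 3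
  · subst h3
    rw [if_neg (by omega), if_pos rfl, arcAct_mul_arcAct_three hq0 hq1, show j + 3 - j = 3 by ring,
      show commExp 3 = -2 from rfl]
  rw [if_neg h2, if_neg h3, add_zero, arcAct_mul_arcAct_of_le hq0 (by omega),
    ← commExp_eq (by omega), neg_sub]

/-- The multiplicities of a multiset of arcs. -/
def multisetMult (m : Multiset ℤ) : ℤ →₀ ℤ := toZ (Multiset.toFinsupp m)

theorem multisetMult_injective : Function.Injective multisetMult :=
  toZ_injective.comp Multiset.toFinsupp.injective

/-- In an increasing word each letter `j` acts on a vector without arcs numbered above `j`, so the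
replacing and removing terms vanish and the letter is simply added. -/
theorem exists_word_apply (hq0 : q ≠ 0) (w : List ℤ) (hw : w.Pairwise (· ≤ ·)) : ∃ c : K, c ≠ 0 ∧
    MulOpposite.unop ((w.map fun j => MulOpposite.op (arcAct q j)).prod) (Finsupp.single 0 1) =
      Finsupp.single (multisetMult w) c := by
  induction w using List.reverseRecOn with
  | nil => exact ⟨1, one_ne_zero, by simp [multisetMult]⟩
  | append_singleton w j ih =>
    rw [List.pairwise_append] at hw
    obtain ⟨c, hc, h1⟩ := ih hw.1
    have h0 : ∀ l, j < l → multisetMult w l = 0 := by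
      intro l hl
      rw [multisetMult, toZ_apply, Multiset.toFinsupp_apply, Nat.cast_eq_zero,
        Multiset.count_eq_zero, Multiset.mem_coe]
      intro hmem
      have := hw.2.2 l hmem j (by simp)
      omega
    refine ⟨c * q ^ actExp j (multisetMult w), mul_ne_zero hc (zpow_ne_zero _ hq0), ?_⟩
    rw [List.map_append, List.prod_append, MulOpposite.unop_mul, Module.End.mul_apply, h1,
      List.map_singleton, List.prod_singleton, MulOpposite.unop_op, ← mul_one c,
      ← smul_eq_mul, ← Finsupp.smul_single, map_smul, arcAct_single, h0 _ (by omega),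
      h0 _ (by omega), h0 _ (by omega), qInt_zero]
    simp only [mul_zero, Finsupp.single_zero, add_zero, zpow_zero, mul_one, Finsupp.smul_single,
      smul_eq_mul]
    congr 1
    rw [multisetMult, multisetMult, ← Multiset.coe_add, map_add, map_add, Multiset.coe_singleton,
      Multiset.toFinsupp_singleton, toZ_single, Nat.cast_one]

/-- Completeness of the commutation rules: an element that kills the vector of the zero object
vanishes in every algebra in which the rules hold. -/
theorem lift_eq_zero_of_apply_eq_zero (hq0 : q ≠ 0) (hq1 : q ^ 2 - 1 ≠ 0) {B : Type*} [Ring B]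
    [Algebra K B] {y : ℤ → B} (hy : IsArcFamily q y) {ι : Type*} (e : ι → ℤ) (w : FreeAlgebra K ι)
    (h : MulOpposite.unop (FreeAlgebra.lift K (fun i => MulOpposite.op (arcAct q (e i))) w)
      (Finsupp.single 0 1) = 0) : FreeAlgebra.lift K (fun i => y (e i)) w = 0 := by
  -- Straightening in the product algebra yields one set of coefficients valid in both factors. The
  -- operators force these coefficients to vanish.
  let x : ℤ → B × (Module.End K ((ℤ →₀ ℤ) →₀ K))ᵐᵒᵖ := fun j => (y j, MulOpposite.op (arcAct q j))
  let F := AlgHom.fst K B (Module.End K ((ℤ →₀ ℤ) →₀ K))ᵐᵒᵖ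
  let G := AlgHom.snd K B (Module.End K ((ℤ →₀ ℤ) →₀ K))ᵐᵒᵖ
  have hx : IsArcFamily q x := fun j l hjl => by
    refine Prod.ext ?_ ?_
    · have h1 : (commTail q x j l).1 = commTail q y j l := by
        rw [commTail, commTail]; split_ifs <;> rfl
      rw [Prod.fst_add, h1]
      exact hy j l hjl
    · have h1 : (commTail q x j l).2 = commTail q (fun j => MulOpposite.op (arcAct q j)) j l := by
        rw [commTail, commTail]; split_ifs <;> rfl
      rw [Prod.snd_add, h1]
      exact isArcFamily_arcAct hq0 hq1 j l hjl
  have hF : FreeAlgebra.lift K (fun i => y (e i)) w = F (FreeAlgebra.lift K (fun i => x (e i)) w) := by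
    rw [← AlgHom.comp_apply]
    congr 1
    exact FreeAlgebra.hom_ext (funext fun i => by simp [F, x])
  have hG : FreeAlgebra.lift K (fun i => MulOpposite.op (arcAct q (e i))) w =
      G (FreeAlgebra.lift K (fun i => x (e i)) w) := by
    rw [← AlgHom.comp_apply]
    congr 1
    exact FreeAlgebra.hom_ext (funext fun i => by simp [G, x])
  obtain ⟨f, hf⟩ := Finsupp.mem_span_range_iff_exists_finsupp.1 (hx.lift_mem_span hq0 e w)
  let ev : B × (Module.End K ((ℤ →₀ ℤ) →₀ K))ᵐᵒᵖ →ₗ[K] ((ℤ →₀ ℤ) →₀ K) :=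
    LinearMap.applyₗ (Finsupp.single 0 1) ∘ₗ (MulOpposite.opLinearEquiv K).symm.toLinearMap ∘ₗ
      G.toLinearMap
  have hP : ∀ m, ∃ c : K, c ≠ 0 ∧ ev (sortedWord x m) = Finsupp.single (multisetMult m) c := by
    intro m
    obtain ⟨c, hc, h1⟩ := exists_word_apply hq0 _ (Multiset.pairwise_sort m (· ≤ ·))
    rw [Multiset.sort_eq] at h1
    refine ⟨c, hc, ?_⟩
    rw [← h1]
    change MulOpposite.unop (G (sortedWord x m)) (Finsupp.single 0 1) = _
    rw [sortedWord, map_list_prod, List.map_map]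
    rfl
  choose c hc hcm using hP
  have hf0 : f = 0 := by
    rw [hG, ← hf] at h
    replace h : ev (f.sum fun i a => a • sortedWord x i) = 0 := h
    rw [Finsupp.sum, map_sum] at h
    ext m
    have h2 := DFunLike.congr_fun h (multisetMult m)
    rw [Finsupp.finsetSum_apply, Finsupp.zero_apply, Finset.sum_eq_single m] at h2
    · rw [map_smul, hcm, Finsupp.smul_single, Finsupp.single_eq_same, smul_eq_mul] at h2
      exact (mul_eq_zero.1 h2).resolve_right (hc m)
    · intro m' _ hm'
      rw [map_smul, hcm, Finsupp.smul_single, Finsupp.single_eq_of_ne]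
      exact fun h => hm' (multisetMult_injective h.symm)
    · intro hm
      rw [Finsupp.notMem_support_iff.1 hm, zero_smul, map_zero, Finsupp.zero_apply]
  rw [hF, ← hf, hf0, Finsupp.sum_zero_index, map_zero]

end Action

/-! ### The disk algebra -/

/-- The number of a suspended arc. -/
def letterIdx (p : Fin 3 × ℤ) : ℤ := ((p.1 : ℕ) : ℤ) - 3 * p.2

/-- The suspended arc with a given number. -/
def letterOf (j : ℤ) : Fin 3 × ℤ := (arcOf j, -(j / 3))

theorem letterIdx_letterOf (j : ℤ) : letterIdx (letterOf j) = j := by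
  rw [letterIdx, letterOf, arcOf_val]; omega

theorem letterOf_letterIdx (p : Fin 3 × ℤ) : letterOf (letterIdx p) = p := by
  obtain ⟨i, l⟩ := p
  refine Prod.ext (Fin.ext ?_) ?_
  · simp only [letterOf, arcOf, letterIdx]; omega
  · simp only [letterOf, letterIdx]; omega

section

variable {K : Type*} [Field K] {k : Type*} [Field k] {q : K}

/-- The arcs of the disk algebra. -/
def diskArcZ (k : Type*) [Field k] (q : K) (j : ℤ) : DiskAlg k q stdFol :=
  diskArc k q stdFol (letterOf j).1 (letterOf j).2

theorem diskArc_eq (i : Fin 3) (l : ℤ) :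
    diskArc k q stdFol i l = diskArcZ k q (letterIdx (i, l)) := by
  rw [diskArcZ, letterOf_letterIdx]

theorem diskAlg_hom_ext {B : Type*} [Semiring B] [Algebra K B] {f g : DiskAlg k q stdFol →ₐ[K] B}
    (h : ∀ i l, f (diskArc k q stdFol i l) = g (diskArc k q stdFol i l)) : f = g := by
  refine RingQuot.ringQuot_ext' K _ _ (FreeAlgebra.hom_ext (funext fun p => ?_))
  exact h p.1 p.2

end

section

variable {K : Type*} [Field K] [CharZero K] {k : Type*} [Field k] [Finite k] {q : K}

theorem hallMap_hallMul (hq : q ^ 2 = (Nat.card k : K)) (j : ℤ) (x : Hall k K stdFol) :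
    hallMap k q (hallMul k q stdFol (Finsupp.single (arcClass k j) 1) x) =
      arcAct q j (hallMap k q x) := by
  induction x using Finsupp.induction_linear with
  | zero => simp
  | add x y hx hy => simp only [map_add, hx, hy]
  | single c t =>
    obtain ⟨a, rfl⟩ := (classEquiv k).surjective c
    have h1 : hallMul k q stdFol (Finsupp.single (arcClass k j) 1)
        (Finsupp.single (classEquiv k a) t) =
        t • hallMulBasis k q stdFol (arcClass k j) (classEquiv k a) := by
      rw [hallMul, Finsupp.linearCombination_single, one_smul, Finsupp.linearCombination_single]
    rw [h1, map_smul, hallMap_mulBasis hq, hallMap_single, smul_smul, ← map_smul,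
      Finsupp.smul_single, smul_eq_mul, mul_one]

theorem hallMap_kappa (hq : q ^ 2 = (Nat.card k : K)) (w : FreeAlgebra K (Fin 3 × ℤ)) :
    hallMap k q (kappa k q stdFol w) =
      MulOpposite.unop (FreeAlgebra.lift K (fun p => MulOpposite.op (arcAct q (letterIdx p))) w)
        (Finsupp.single 0 1) := by
  have h1 : ∀ x : Hall k K stdFol, hallMap k q (MulOpposite.unop (FreeAlgebra.lift K
      (fun a : Fin 3 × ℤ => MulOpposite.op (hallMul k q stdFol
        (Finsupp.single (Quot.mk _ (Tw.suspArc k stdFol a.1 a.2)) 1) :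
          Module.End K (Hall k K stdFol))) w) x) =
      MulOpposite.unop (FreeAlgebra.lift K (fun p => MulOpposite.op (arcAct q (letterIdx p))) w)
        (hallMap k q x) := by
    induction w using FreeAlgebra.induction with
    | grade0 r =>
      intro x
      rw [AlgHom.commutes, AlgHom.commutes]
      exact map_smul (hallMap k q) r x
    | grade1 p =>
      intro x
      rw [FreeAlgebra.lift_ι_apply, FreeAlgebra.lift_ι_apply, MulOpposite.unop_op,
        MulOpposite.unop_op, ← hallMap_hallMul hq, Tw.suspArc_eq_arcZ]
      rfl
    | mul a b ha hb =>
      intro x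
      rw [map_mul, map_mul, MulOpposite.unop_mul, MulOpposite.unop_mul, Module.End.mul_apply,
        Module.End.mul_apply, hb, ha]
    | add a b ha hb =>
      intro x
      rw [map_add, map_add, MulOpposite.unop_add, MulOpposite.unop_add, LinearMap.add_apply,
        LinearMap.add_apply, map_add, ha, hb]
  rw [kappa, h1, ← classEquiv_zero, hallMap_single, map_zero, qFac, Finsupp.prod_zero_index,
    inv_one, one_mul]

/-- The defining relations of the disk algebra become equalities of vectors for the explicit
operators, because `hallMap` is injective and intertwines the two actions. -/
theorem kappa_eq_iff (hq : q ^ 2 = (Nat.card k : K)) (w w' : FreeAlgebra K (Fin 3 × ℤ)) :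
    kappa k q stdFol w = kappa k q stdFol w' ↔
      MulOpposite.unop (FreeAlgebra.lift K (fun p => MulOpposite.op (arcAct q (letterIdx p))) w)
        (Finsupp.single 0 1) =
      MulOpposite.unop (FreeAlgebra.lift K (fun p => MulOpposite.op (arcAct q (letterIdx p))) w')
        (Finsupp.single 0 1) := by
  rw [← hallMap_kappa hq, ← hallMap_kappa hq, (hallMap_injective hq).eq_iff]

/-- The homomorphism from the disk algebra given by an arc family. -/
def diskLift (hq : q ^ 2 = (Nat.card k : K)) {B : Type*} [Ring B] [Algebra K B] {y : ℤ → B}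
    (hy : IsArcFamily q y) : DiskAlg k q stdFol →ₐ[K] B :=
  RingQuot.liftAlgHom K ⟨FreeAlgebra.lift K fun p => y (letterIdx p), fun a b hab => by
    rw [kappa_eq_iff hq] at hab
    rw [← sub_eq_zero, ← map_sub]
    refine lift_eq_zero_of_apply_eq_zero (q_ne_zero hq) (q_sq_sub_one_ne_zero hq) hy _ _ ?_
    rw [map_sub, MulOpposite.unop_sub, LinearMap.sub_apply, hab, sub_self]⟩

theorem diskLift_diskArc (hq : q ^ 2 = (Nat.card k : K)) {B : Type*} [Ring B] [Algebra K B]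
    {y : ℤ → B} (hy : IsArcFamily q y) (i : Fin 3) (l : ℤ) :
    diskLift hq hy (diskArc k q stdFol i l) = y (letterIdx (i, l)) := by
  rw [diskLift, diskArc, RingQuot.liftAlgHom_mkAlgHom_apply, FreeAlgebra.lift_ι_apply]

theorem isArcFamily_diskArcZ (hq : q ^ 2 = (Nat.card k : K)) : IsArcFamily q (diskArcZ k q) := by
  intro j l hjl
  let g : ℤ → FreeAlgebra K (Fin 3 × ℤ) := fun j => FreeAlgebra.ι K (letterOf j)
  have hmk : ∀ j, RingQuot.mkAlgHom K (fun a b : FreeAlgebra K (Fin 3 × ℤ) =>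
      kappa k q stdFol a = kappa k q stdFol b) (g j) = diskArcZ k q j := fun j => rfl
  have key : kappa k q stdFol (g l * g j) =
      kappa k q stdFol (q ^ commExp (l - j) • (g j * g l) + commTail q g j l) := by
    rw [kappa_eq_iff hq]
    have hΛ : ∀ i, FreeAlgebra.lift K (fun p => MulOpposite.op (arcAct q (letterIdx p))) (g i) =
        MulOpposite.op (arcAct q i) := fun i => by
      rw [FreeAlgebra.lift_ι_apply, letterIdx_letterOf]
    have htail : FreeAlgebra.lift K (fun p => MulOpposite.op (arcAct q (letterIdx p)))
        (commTail q g j l) = commTail q (fun i => MulOpposite.op (arcAct q i)) j l := by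
      rw [commTail, commTail]
      split_ifs
      · rw [map_smul, hΛ]
      · rw [map_smul, map_one]
      · rw [map_zero]
    rw [map_mul, map_add, map_smul, map_mul, hΛ, hΛ, htail,
      isArcFamily_arcAct (q_ne_zero hq) (q_sq_sub_one_ne_zero hq) j l hjl]
  have h := RingQuot.mkAlgHom_rel K (s := fun a b : FreeAlgebra K (Fin 3 × ℤ) =>
      kappa k q stdFol a = kappa k q stdFol b) key
  have htail : RingQuot.mkAlgHom K (fun a b : FreeAlgebra K (Fin 3 × ℤ) =>
      kappa k q stdFol a = kappa k q stdFol b) (commTail q g j l) =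
      commTail q (diskArcZ k q) j l := by
    rw [commTail, commTail]
    split_ifs
    · rw [map_smul, hmk]
    · rw [map_smul, map_one]
    · rw [map_zero]
  rw [map_mul, map_add, map_smul, map_mul, hmk, hmk, htail] at h
  exact h

end

/-! ### The relations of a triangle -/

section TriangleRelations

variable {K : Type*} [Field K] {B : Type*} [Ring B] [Algebra K B]

/-- The relations of the presentation between the suspended sides of a triangle. -/
structure TriangleRel (q : K) (x : Fin 3 → ℤ → B) : Prop where
  selfExt (i : Fin 3) (k l : ℤ) (hk : 1 ≤ k) :
    qBracket (q ^ (2 * (k.negOnePow : ℤ))) (x i l) (x i (k + l)) =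
      if k = 1 then algebraMap K B (q⁻¹ / (q ^ 2 - 1)) else 0
  adjPos (i : Fin 3) (k l : ℤ) (hk : 1 ≤ k) :
    qBracket (q ^ ((k + 1).negOnePow : ℤ)) (x (i + 1) (k + l)) (x i (stdFol i + l)) =
      if k = 1 then x (i + 2) (1 - stdFol (i + 1) + l) else 0
  adjNonpos (i : Fin 3) (k l : ℤ) (hk : k < 1) :
    qBracket (q ^ (k.negOnePow : ℤ)) (x (i + 1) (k + l)) (x i (stdFol i + l)) = 0

/-- The suspension by `h(i)` in (R2) compensates the jump of the numbering from side `2` back to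
side `0`. -/
theorem letterIdx_add_one (i : Fin 3) (k l : ℤ) :
    letterIdx (i + 1, k + l) = letterIdx (i, stdFol i + l) + 1 - 3 * k := by
  fin_cases i <;> simp [letterIdx, stdFol] <;> ring

theorem letterIdx_add_two (i : Fin 3) (l : ℤ) :
    letterIdx (i + 2, 1 - stdFol (i + 1) + l) = letterIdx (i, stdFol i + l) - 1 := by
  fin_cases i <;> simp [letterIdx, stdFol] <;> ring

theorem exists_letterIdx_eq (j : ℤ) : ∃ i l, letterIdx (i, stdFol i + l) = j :=
  ⟨(letterOf j).1, (letterOf j).2 - stdFol (letterOf j).1, by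
    rw [add_sub_cancel, Prod.mk.eta, letterIdx_letterOf]⟩

theorem commExp_three_mul (k : ℤ) : commExp (3 * k) = 2 * (k.negOnePow : ℤ) := by
  rw [commExp, if_pos (by omega), show 3 * k / 3 = k by omega]

theorem commExp_three_mul_sub_one (k : ℤ) :
    commExp (3 * k - 1) = -((k + 1).negOnePow : ℤ) := by
  rw [commExp, if_neg (by omega), if_neg (by omega), show (3 * k - 1) / 3 = (k + 1) - 2 by omega,
    Int.negOnePow_sub, Int.negOnePow_even 2 (by decide), mul_one]

theorem commExp_one_sub (k : ℤ) : commExp (1 - 3 * k) = (k.negOnePow : ℤ) := by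
  rw [commExp, if_neg (by omega), if_pos (by omega), show (1 - 3 * k) / 3 = -k by omega,
    Int.negOnePow_neg]

/-- The residue of `l - j` modulo `3` selects the relation: (R1) for `0`, (R2) with `k < 1` for `1`,
and (R2) with `k ≥ 1` for `2`. Negating the generators changes only the linear term, and so matches
the sign of the third side in (R2). -/
theorem triangleRel_iff {q : K} (hq : q ≠ 0) (z : ℤ → B) :
    TriangleRel q (fun i l => z (letterIdx (i, l))) ↔ IsArcFamily q (fun j => -z j) := by
  have self_iff : ∀ j k : ℤ, 1 ≤ k →
      ((qBracket (q ^ (2 * (k.negOnePow : ℤ))) (z j) (z (j - 3 * k)) =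
        if k = 1 then algebraMap K B (q⁻¹ / (q ^ 2 - 1)) else 0) ↔
      -z j * -z (j - 3 * k) = q ^ commExp (j - (j - 3 * k)) • (-z (j - 3 * k) * -z j) +
        commTail q (fun j => -z j) (j - 3 * k) j) := by
    intro j k hk
    rw [sub_sub_cancel, commExp_three_mul, qBracket, neg_mul_neg, neg_mul_neg, sub_eq_iff_eq_add',
      commTail, if_neg (show ¬ j = j - 3 * k + 2 by omega), Algebra.algebraMap_eq_smul_one]
    simp only [show (j = j - 3 * k + 3) ↔ k = 1 by omega]
  have pos_iff : ∀ j k : ℤ, 1 ≤ k →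
      ((qBracket (q ^ ((k + 1).negOnePow : ℤ)) (z (j + 1 - 3 * k)) (z j) =
        if k = 1 then z (j - 1) else 0) ↔
      -z j * -z (j + 1 - 3 * k) = q ^ commExp (j - (j + 1 - 3 * k)) • (-z (j + 1 - 3 * k) * -z j) +
        commTail q (fun j => -z j) (j + 1 - 3 * k) j) := by
    intro j k hk
    have hc : q ^ ((k + 1).negOnePow : ℤ) ≠ 0 := zpow_ne_zero _ hq
    rw [show j - (j + 1 - 3 * k) = 3 * k - 1 by ring, commExp_three_mul_sub_one, qBracket,
      neg_mul_neg, neg_mul_neg, zpow_neg]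
    have htail : commTail q (fun j => -z j) (j + 1 - 3 * k) j =
        -((q ^ ((k + 1).negOnePow : ℤ))⁻¹ • if k = 1 then z (j - 1) else 0) := by
      rw [commTail]
      by_cases h : k = 1
      · subst h
        rw [if_pos (by ring), if_pos rfl, show j + 1 - 3 * 1 + 1 = j - 1 by ring, smul_neg,
          Int.negOnePow_even (1 + 1) (by decide)]
        simp
      · rw [if_neg (by omega), if_neg (by omega), if_neg h, smul_zero, neg_zero]
    rw [htail, ← sub_eq_add_neg, ← smul_sub, eq_inv_smul_iff₀ hc]
    constructor <;> intro h
    · rw [← h]; abel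
    · rw [h]; abel
  have nonpos_iff : ∀ j k : ℤ, k < 1 →
      ((qBracket (q ^ (k.negOnePow : ℤ)) (z (j + 1 - 3 * k)) (z j) = 0) ↔
      -z (j + 1 - 3 * k) * -z j = q ^ commExp (j + 1 - 3 * k - j) • (-z j * -z (j + 1 - 3 * k)) +
        commTail q (fun j => -z j) j (j + 1 - 3 * k)) := by
    intro j k hk
    rw [show j + 1 - 3 * k - j = 1 - 3 * k by ring, commExp_one_sub, qBracket, neg_mul_neg,
      neg_mul_neg, commTail, if_neg (by omega), if_neg (by omega), add_zero, sub_eq_zero]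
  have hself : ∀ (i : Fin 3) (k l : ℤ), letterIdx (i, k + l) = letterIdx (i, l) - 3 * k := by
    intro i k l; simp only [letterIdx]; ring
  constructor
  · rintro ⟨h1, h2, h3⟩ j l hjl
    simp only [letterIdx_add_one, letterIdx_add_two] at h2 h3
    simp only [hself] at h1
    have h3d : (l - j) % 3 = 0 ∨ (l - j) % 3 = 1 ∨ (l - j) % 3 = 2 := by omega
    rcases h3d with hd | hd | hd
    · obtain ⟨k, rfl⟩ : ∃ k, j = l - 3 * k := ⟨(l - j) / 3, by omega⟩
      obtain ⟨i, t, rfl⟩ : ∃ i t, letterIdx (i, t) = l := ⟨_, _, letterIdx_letterOf l⟩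
      exact (self_iff _ k (by omega)).1 (h1 i k t (by omega))
    · obtain ⟨k, rfl⟩ : ∃ k, l = j + 1 - 3 * k := ⟨-((l - j) / 3), by omega⟩
      obtain ⟨i, t, rfl⟩ := exists_letterIdx_eq j
      exact (nonpos_iff _ k (by omega)).1 (h3 i k t (by omega))
    · obtain ⟨k, rfl⟩ : ∃ k, j = l + 1 - 3 * k := ⟨(l - j) / 3 + 1, by omega⟩
      obtain ⟨i, t, rfl⟩ := exists_letterIdx_eq l
      exact (pos_iff _ k (by omega)).1 (h2 i k t (by omega))
  · intro h
    refine ⟨fun i k l hk => ?_, fun i k l hk => ?_, fun i k l hk => ?_⟩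
    · rw [hself]
      exact (self_iff _ _ hk).2 (h _ _ (by omega))
    · rw [letterIdx_add_one, letterIdx_add_two]
      exact (pos_iff _ _ hk).2 (h _ _ (by omega))
    · rw [letterIdx_add_one]
      exact (nonpos_iff _ _ hk).2 (h _ _ (by omega))

end TriangleRelations

/-! ### Marked intervals of the annulus -/

section Intervals

/-- The number `i ≤ m` of a marked interval, read modulo `m`. -/
def wrapIdx (m i : ℕ) : ℕ := if i = m then 0 else i

/-- The marked interval of the annulus containing a marked interval of a triangle. -/
def cornerLabel (m n : ℕ) : (Fin m ⊕ Fin n) × Fin 3 → ℕ ⊕ ℕ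
  | (Sum.inl j, i) => ![Sum.inr 0, Sum.inl (wrapIdx m (j + 1)), Sum.inl (j : ℕ)] i
  | (Sum.inr j, i) => ![Sum.inl 0, Sum.inr (wrapIdx n (j + 1)), Sum.inr (j : ℕ)] i

/-- The marked intervals containing the end points of an arc. -/
def AnnArc.ends {m n : ℕ} : AnnArc m n → Set (ℕ ⊕ ℕ)
  | .S => {Sum.inl 0, Sum.inr 0}
  | .T => {Sum.inl 0, Sum.inr 0}
  | .P i _ => {Sum.inl i, Sum.inr 0}
  | .Q i _ => {Sum.inl 0, Sum.inr i}
  | .E i _ => {Sum.inl (i - 1), Sum.inl (wrapIdx m i)}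
  | .F i _ => {Sum.inr (i - 1), Sum.inr (wrapIdx n i)}

variable {m n : ℕ}

theorem ends_P' (hm : 1 ≤ m) {i : ℕ} (hi : i ≤ m) :
    (AnnArc.P' m n i).ends = {Sum.inl (wrapIdx m i), Sum.inr 0} := by
  rw [AnnArc.P']
  split_ifs with h h'
  · rw [wrapIdx, if_neg (by omega), h]; rfl
  · rw [wrapIdx, if_neg (by omega)]; rfl
  · rw [wrapIdx, if_pos (by omega)]; rfl

theorem ends_Q' (hn : 1 ≤ n) {i : ℕ} (hi : i ≤ n) :
    (AnnArc.Q' m n i).ends = {Sum.inl 0, Sum.inr (wrapIdx n i)} := by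
  rw [AnnArc.Q']
  split_ifs with h h'
  · rw [wrapIdx, if_neg (by omega), h]; rfl
  · rw [wrapIdx, if_neg (by omega)]; rfl
  · rw [wrapIdx, if_pos (by omega)]; rfl

theorem wrapIdx_of_lt {m i : ℕ} (h : i < m) : wrapIdx m i = i := if_neg h.ne

theorem ends_annSide (hm : 1 ≤ m) (hn : 1 ≤ n) (v : Fin m ⊕ Fin n) (i : Fin 3) :
    (annSide m n v i).ends = {cornerLabel m n (v, i), cornerLabel m n (v, i - 1)} := by
  rcases v with j | j <;> fin_cases i
  · change (AnnArc.P' m n j).ends = {Sum.inr 0, Sum.inl (j : ℕ)}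
    rw [ends_P' hm j.2.le, wrapIdx_of_lt j.2, Set.pair_comm]
  · change (AnnArc.P' m n (j + 1)).ends = {Sum.inl (wrapIdx m (j + 1)), Sum.inr 0}
    exact ends_P' hm j.2
  · rfl
  · change (AnnArc.Q' m n j).ends = {Sum.inl 0, Sum.inr (j : ℕ)}
    rw [ends_Q' hn j.2.le, wrapIdx_of_lt j.2]
  · change (AnnArc.Q' m n (j + 1)).ends = {Sum.inr (wrapIdx n (j + 1)), Sum.inl 0}
    rw [ends_Q' hn j.2, Set.pair_comm]
  · rfl

theorem annSide_injective (v : Fin m ⊕ Fin n) : Function.Injective (annSide m n v) := by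
  intro i i' h
  rcases v with ⟨j, hj⟩ | ⟨j, hj⟩ <;> fin_cases i <;> fin_cases i' <;>
    simp [annSide, AnnArc.P', AnnArc.Q'] at h ⊢ <;> grind

theorem cornerLabel_eq_of_joined (hm : 1 ≤ m) (hn : 1 ≤ n) {c c' : (Fin m ⊕ Fin n) × Fin 3}
    (h : (annulus m n hm hn).Joined c c') : cornerLabel m n c = cornerLabel m n c' := by
  obtain ⟨v, i, w, j, hne, harc, rfl, rfl⟩ := h
  change annSide m n v i = annSide m n w j at harc
  rcases v with ⟨a, ha⟩ | ⟨a, ha⟩ <;> rcases w with ⟨b, hb⟩ | ⟨b, hb⟩ <;>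
    fin_cases i <;> fin_cases j <;>
    simp [annSide, cornerLabel, wrapIdx, AnnArc.P', AnnArc.Q'] at harc hne ⊢ <;> grind

/-- Corners `(d, 2)` serve as representatives: there is one for each marked interval, and their
labels are distinct. -/
theorem exists_sameInterval (hm : 1 ≤ m) (hn : 1 ≤ n) (c : (Fin m ⊕ Fin n) × Fin 3) :
    ∃ d : Fin m ⊕ Fin n, (annulus m n hm hn).SameInterval c (d, 2) ∧
      cornerLabel m n c = Sum.map Fin.val Fin.val d := by
  have glue : ∀ v i w j, (v, i) ≠ (w, j) → annSide m n v i = annSide m n w j →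
      (annulus m n hm hn).SameInterval (v, i) (w, j - 1) := fun v i w j h1 h2 =>
    Relation.EqvGen.rel _ _ ⟨v, i, w, j, h1, h2, rfl, rfl⟩
  -- The triangles `C_j` form a fan around one marked interval: crossing `P_j, …, P_1` leads to
  -- `C_0`, and crossing `S` leads to `D_0`. The fan of the `D_j` is treated in the same way.
  have hC : ∀ (j : ℕ) (hj : j < m),
      (annulus m n hm hn).SameInterval (Sum.inl ⟨j, hj⟩, 0) (Sum.inr ⟨0, hn⟩, 2) := by
    intro j
    induction j with
    | zero =>
      exact fun hj => glue _ _ (Sum.inr ⟨0, hn⟩) 0 (by simp)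
        (by simp [annSide, AnnArc.P', AnnArc.Q'])
    | succ j ih =>
      exact fun hj => (glue _ _ (Sum.inl ⟨j, by omega⟩) 1 (by simp) (by simp [annSide])).trans _ _ _
        (ih (by omega))
  have hD : ∀ (j : ℕ) (hj : j < n),
      (annulus m n hm hn).SameInterval (Sum.inr ⟨j, hj⟩, 0) (Sum.inl ⟨0, hm⟩, 2) := by
    intro j
    induction j with
    | zero =>
      exact fun hj => glue _ _ (Sum.inl ⟨0, hm⟩) 0 (by simp)
        (by simp [annSide, AnnArc.P', AnnArc.Q'])
    | succ j ih =>
      exact fun hj => (glue _ _ (Sum.inr ⟨j, by omega⟩) 1 (by simp) (by simp [annSide])).trans _ _ _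
        (ih (by omega))
  obtain ⟨⟨j, hj⟩ | ⟨j, hj⟩, i⟩ := c <;> fin_cases i
  · exact ⟨_, hC j hj, rfl⟩
  · by_cases h : j + 1 = m
    -- In the last triangle of the fan the corner wraps around: crossing `T` leads to the last
    -- `D`-triangle, and its fan leads back to label `0`.
    · refine ⟨_, (glue _ _ (Sum.inr ⟨n - 1, by omega⟩) 1 (by simp) ?_).trans _ _ _
        (hD (n - 1) (by omega)), ?_⟩
      · simp [annSide, AnnArc.P', AnnArc.Q', h, show n - 1 + 1 = n by omega]
        grind
      · simp [cornerLabel, wrapIdx, h]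
    · refine ⟨_, glue _ _ (Sum.inl ⟨j + 1, by omega⟩) 0 (by simp) (by simp [annSide]), ?_⟩
      simp [cornerLabel, wrapIdx, h]
  · exact ⟨_, Relation.EqvGen.refl _, rfl⟩
  · exact ⟨_, hD j hj, rfl⟩
  · by_cases h : j + 1 = n
    · refine ⟨_, (glue _ _ (Sum.inl ⟨m - 1, by omega⟩) 1 (by simp) ?_).trans _ _ _
        (hC (m - 1) (by omega)), ?_⟩
      · simp [annSide, AnnArc.P', AnnArc.Q', h, show m - 1 + 1 = m by omega]
        grind
      · simp [cornerLabel, wrapIdx, h]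
    · refine ⟨_, glue _ _ (Sum.inr ⟨j + 1, by omega⟩) 0 (by simp) (by simp [annSide]), ?_⟩
      simp [cornerLabel, wrapIdx, h]
  · exact ⟨_, Relation.EqvGen.refl _, rfl⟩

theorem sameInterval_iff (hm : 1 ≤ m) (hn : 1 ≤ n) (c c' : (Fin m ⊕ Fin n) × Fin 3) :
    (annulus m n hm hn).SameInterval c c' ↔ cornerLabel m n c = cornerLabel m n c' := by
  constructor
  · intro h
    induction h with
    | rel _ _ h => exact cornerLabel_eq_of_joined hm hn h
    | refl _ => rfl
    | symm _ _ _ ih => exact ih.symm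
    | trans _ _ _ _ _ ih ih' => exact ih.trans ih'
  · intro h
    obtain ⟨d, hd, hl⟩ := exists_sameInterval hm hn c
    obtain ⟨d', hd', hl'⟩ := exists_sameInterval hm hn c'
    rw [hl, hl', (Sum.map_injective.2 ⟨Fin.val_injective, Fin.val_injective⟩).eq_iff] at h
    subst h
    exact hd.trans _ _ _ (hd'.symm _ _)

/-- The condition depends only on the two arcs and not on the triangles in which they are seen. -/
theorem not_shareInterval_iff (hm : 1 ≤ m) (hn : 1 ≤ n) (v w : Fin m ⊕ Fin n) (i j : Fin 3) :
    ¬ (annulus m n hm hn).ShareInterval v i w j ↔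
      Disjoint (annSide m n v i).ends (annSide m n w j).ends := by
  rw [ends_annSide hm hn, ends_annSide hm hn, TriSurface.ShareInterval, sameInterval_iff,
    sameInterval_iff, sameInterval_iff, sameInterval_iff]
  simp only [Set.disjoint_insert_left, Set.disjoint_singleton_left, Set.mem_insert_iff,
    Set.mem_singleton_iff]
  tauto

/-- Any two sides of one triangle meet at a corner, so the requirement of distinct triangles in the
far relation is automatic. -/
theorem ne_of_disjoint_ends (hm : 1 ≤ m) (hn : 1 ≤ n) {v w : Fin m ⊕ Fin n} {i j : Fin 3}
    (h : Disjoint (annSide m n v i).ends (annSide m n w j).ends) : v ≠ w := by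
  rintro rfl
  rw [ends_annSide hm hn, ends_annSide hm hn] at h
  simp only [Set.disjoint_insert_left, Set.disjoint_singleton_left, Set.mem_insert_iff,
    Set.mem_singleton_iff, not_or] at h
  obtain ⟨⟨h1, h2⟩, h3, h4⟩ := h
  have : i = j ∨ i = j - 1 ∨ i - 1 = j := by
    clear h1 h2 h3 h4; revert i j; decide
  rcases this with rfl | rfl | rfl
  exacts [h1 rfl, h2 rfl, h3 rfl]

end Intervals

/-! ### Commuting arcs in the presented algebra -/

section Commute

variable {K : Type*} [Field K] {q : K} {m n : ℕ}

theorem natCast_zmod_eq_iff {a b : ℕ} (hm : 1 ≤ m) (h : a ≤ b + m) (h' : b ≤ a + m) :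
    (a : ZMod m) = b ↔ a = b ∨ a = b + m ∨ b = a + m := by
  constructor
  · intro hab
    rw [ZMod.natCast_eq_natCast_iff, Nat.modEq_iff_dvd] at hab
    obtain ⟨c, hc⟩ := hab
    have h1 : c ≤ 1 := by
      by_contra hlt
      have : (m : ℤ) * 2 ≤ m * c := mul_le_mul_of_nonneg_left (by omega) (by omega)
      omega
    have h2 : -1 ≤ c := by
      by_contra hlt
      have : (m : ℤ) * c ≤ m * (-2) := mul_le_mul_of_nonneg_left (by omega) (by omega)
      omega
    obtain rfl | rfl | rfl : c = -1 ∨ c = 0 ∨ c = 1 := by omega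
    all_goals omega
  · rintro (rfl | rfl | rfl) <;> simp

/-- A boundary arc numbered `i` joins the marked intervals `i - 1` and `i` modulo `m`, so two of
them are disjoint exactly when they are neither equal nor cyclic neighbours. For small `m` both
sides are false. -/
theorem cyclically_far_iff {i j : ℕ} (hi : 1 ≤ i ∧ i ≤ m) (hj : 1 ≤ j ∧ j ≤ m) :
    ((j : ZMod m) ≠ i - 1 ∧ (j : ZMod m) ≠ i ∧ (j : ZMod m) ≠ i + 1) ↔
      (i - 1 ≠ j - 1 ∧ i - 1 ≠ wrapIdx m j) ∧ wrapIdx m i ≠ j - 1 ∧ wrapIdx m i ≠ wrapIdx m j := by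
  have h1 := natCast_zmod_eq_iff (m := m) (a := j + 1) (b := i) (by omega) (by omega) (by omega)
  have h2 := natCast_zmod_eq_iff (m := m) (a := j) (b := i) (by omega) (by omega) (by omega)
  have h3 := natCast_zmod_eq_iff (m := m) (a := j) (b := i + 1) (by omega) (by omega) (by omega)
  push_cast at h1 h3
  rw [Ne, Ne, Ne, eq_sub_iff_add_eq, h1, h2, h3, wrapIdx, wrapIdx]
  split_ifs <;> omega

theorem commute_presArc {X Y : AnnArc m n} (h : Disjoint X.ends Y.ends) (s t : ℤ) :
    presArc q m n X s * presArc q m n Y t = presArc q m n Y t * presArc q m n X s := by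
  have key : ∀ (X Y : AnnArc m n) (s t : ℤ),
      AnnRel q m n (qBracket (1 : K) (arcGen m n X s) (arcGen m n Y t)) 0 →
      presArc q m n X s * presArc q m n Y t = presArc q m n Y t * presArc q m n X s := by
    intro X Y s t hr
    have := RingQuot.mkAlgHom_rel K hr
    rw [qBracket, one_smul, map_sub, map_mul, map_mul, map_zero, sub_eq_zero] at this
    exact this
  -- Pairs of types that always share an end are discarded by simplification. What is left is one
  -- goal for each commutation family and, for mixed types, one for its reversal.
  rcases X with _ | _ | ⟨i, hi⟩ | ⟨i, hi⟩ | ⟨i, hi⟩ | ⟨i, hi⟩ <;>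
    rcases Y with _ | _ | ⟨j, hj⟩ | ⟨j, hj⟩ | ⟨j, hj⟩ | ⟨j, hj⟩ <;>
    simp only [AnnArc.ends, Set.disjoint_insert_left, Set.disjoint_singleton_left,
      Set.mem_insert_iff, Set.mem_singleton_iff, not_or, reduceCtorEq, Sum.inl.injEq,
      Sum.inr.injEq, not_true_eq_false, not_false_eq_true, true_and, and_true, false_and,
      and_false] at h
  · exact key _ _ s t (AnnRel.SE j hj s t (by rw [wrapIdx] at h; split_ifs at h <;> omega))
  · exact key _ _ s t (AnnRel.SF j hj s t (by rw [wrapIdx] at h; split_ifs at h <;> omega))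
  · exact key _ _ s t (AnnRel.TE j hj s t (by rw [wrapIdx] at h; split_ifs at h <;> omega))
  · exact key _ _ s t (AnnRel.TF j hj s t (by rw [wrapIdx] at h; split_ifs at h <;> omega))
  · exact key _ _ s t (AnnRel.PQ i j hi hj s t)
  · exact key _ _ s t (AnnRel.PE i j hi hj s t (by rw [wrapIdx] at h; split_ifs at h <;> omega))
  · exact key _ _ s t (AnnRel.PF i j hi hj s t (by rw [wrapIdx] at h; split_ifs at h <;> omega))
  · exact (key _ _ t s (AnnRel.PQ j i hj hi t s)).symm
  · exact key _ _ s t (AnnRel.QE i j hi hj s t (by rw [wrapIdx] at h; split_ifs at h <;> omega))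
  · exact key _ _ s t (AnnRel.QF i j hi hj s t (by rw [wrapIdx] at h; split_ifs at h <;> omega))
  · exact (key _ _ t s (AnnRel.SE i hi t s (by rw [wrapIdx] at h; split_ifs at h <;> omega))).symm
  · exact (key _ _ t s (AnnRel.TE i hi t s (by rw [wrapIdx] at h; split_ifs at h <;> omega))).symm
  · exact (key _ _ t s (AnnRel.PE j i hj hi t s (by rw [wrapIdx] at h; split_ifs at h <;> omega))).symm
  · exact (key _ _ t s (AnnRel.QE j i hj hi t s (by rw [wrapIdx] at h; split_ifs at h <;> omega))).symm
  · exact key _ _ s t (AnnRel.EE i j hi hj s t ((cyclically_far_iff hi hj).2 h))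
  · exact key _ _ s t (AnnRel.EF i j hi hj s t)
  · exact (key _ _ t s (AnnRel.SF i hi t s (by rw [wrapIdx] at h; split_ifs at h <;> omega))).symm
  · exact (key _ _ t s (AnnRel.TF i hi t s (by rw [wrapIdx] at h; split_ifs at h <;> omega))).symm
  · exact (key _ _ t s (AnnRel.PF j i hj hi t s (by rw [wrapIdx] at h; split_ifs at h <;> omega))).symm
  · exact (key _ _ t s (AnnRel.QF j i hj hi t s (by rw [wrapIdx] at h; split_ifs at h <;> omega))).symm
  · exact (key _ _ t s (AnnRel.EF j i hj hi t s)).symm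
  · exact key _ _ s t (AnnRel.FF i j hi hj s t ((cyclically_far_iff hi hj).2 h))

end Commute

/-! ### Homomorphisms from the presented algebra -/

section Presentation

variable {K : Type*} [Field K] {q : K} {m n : ℕ}

theorem annPres_hom_ext {B : Type*} [Semiring B] [Algebra K B] {f g : AnnPres q m n →ₐ[K] B}
    (h : ∀ X l, f (presArc q m n X l) = g (presArc q m n X l)) : f = g :=
  RingQuot.ringQuot_ext' K _ _ (FreeAlgebra.hom_ext (funext fun p => h p.1 p.2))

theorem map_qBracket {B C : Type*} [Ring B] [Algebra K B] [Ring C] [Algebra K C] (f : B →ₐ[K] C)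
    (c : K) (x y : B) : f (qBracket c x y) = qBracket c (f x) (f y) := by
  rw [qBracket, qBracket, map_sub, map_smul, map_mul, map_mul]

theorem triangleRel_presArc (v : Fin m ⊕ Fin n) :
    TriangleRel q (fun i l => presArc q m n (annSide m n v i) l) where
  selfExt i k l hk := by
    have := RingQuot.mkAlgHom_rel K (AnnRel.selfExt (q := q) v i k l hk)
    rw [map_qBracket, apply_ite (RingQuot.mkAlgHom K _), map_zero, AlgHom.commutes] at this
    exact this
  adjPos i k l hk := by
    have := RingQuot.mkAlgHom_rel K (AnnRel.adjPos (q := q) v i k l hk)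
    rw [map_qBracket, apply_ite (RingQuot.mkAlgHom K _), map_zero] at this
    exact this
  adjNonpos i k l hk := by
    have := RingQuot.mkAlgHom_rel K (AnnRel.adjNonpos (q := q) v i k l hk)
    rw [map_qBracket, map_zero] at this
    exact this

theorem IsArcFamily.map {B C : Type*} [Ring B] [Algebra K B] [Ring C] [Algebra K C] {x : ℤ → B}
    (hx : IsArcFamily q x) (f : B →ₐ[K] C) : IsArcFamily q fun j => f (x j) := by
  intro j l hjl
  have htail : f (commTail q x j l) = commTail q (fun j => f (x j)) j l := by
    rw [commTail, commTail]
    split_ifs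
    · rw [map_smul]
    · rw [map_smul, map_one]
    · rw [map_zero]
  rw [← map_mul, hx j l hjl, map_add, map_smul, map_mul, htail]

/-- The homomorphism from the presented algebra given by elements satisfying its relations. -/
def presLift {B : Type*} [Ring B] [Algebra K B] (x : AnnArc m n → ℤ → B)
    (htri : ∀ v, TriangleRel q fun i l => x (annSide m n v i) l)
    (hcomm : ∀ X Y s t, Disjoint X.ends Y.ends → x X s * x Y t = x Y t * x X s) :
    AnnPres q m n →ₐ[K] B :=
  RingQuot.liftAlgHom K ⟨FreeAlgebra.lift K fun p => x p.1 p.2, by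
    have hgen : ∀ X l, FreeAlgebra.lift K (fun p : AnnArc m n × ℤ => x p.1 p.2)
        (arcGen m n X l) = x X l := fun X l => FreeAlgebra.lift_ι_apply _ _
    have hbr : ∀ {X Y : AnnArc m n} (s t : ℤ), Disjoint X.ends Y.ends →
        FreeAlgebra.lift K (fun p : AnnArc m n × ℤ => x p.1 p.2)
          (qBracket (1 : K) (arcGen m n X s) (arcGen m n Y t)) =
        FreeAlgebra.lift K (fun p : AnnArc m n × ℤ => x p.1 p.2) 0 := by
      intro X Y s t h
      rw [map_qBracket, hgen, hgen, map_zero, qBracket, one_smul, hcomm _ _ _ _ h, sub_self]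
    intro a b hab
    cases hab with
    | selfExt v i k l hk =>
      rw [map_qBracket, apply_ite (FreeAlgebra.lift K _), map_zero, AlgHom.commutes, hgen, hgen]
      exact (htri v).selfExt i k l hk
    | adjPos v i k l hk =>
      rw [map_qBracket, apply_ite (FreeAlgebra.lift K _), map_zero, hgen, hgen, hgen]
      exact (htri v).adjPos i k l hk
    | adjNonpos v i k l hk =>
      rw [map_qBracket, map_zero, hgen, hgen]
      exact (htri v).adjNonpos i k l hk
    | EE i j hi hj s t h =>
      refine hbr s t (Disjoint.symm ?_)
      simpa [AnnArc.ends, not_or] using (cyclically_far_iff hi hj).1 h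
    | FF i j hi hj s t h =>
      refine hbr s t (Disjoint.symm ?_)
      simpa [AnnArc.ends, not_or] using (cyclically_far_iff hi hj).1 h
    | _ =>
      refine hbr _ _ ?_
      simp only [AnnArc.ends, wrapIdx, Set.disjoint_insert_left, Set.disjoint_singleton_left,
        Set.mem_insert_iff, Set.mem_singleton_iff, not_or, reduceCtorEq, Sum.inl.injEq,
        Sum.inr.injEq, not_false_eq_true, true_and, and_true]
      try split_ifs
      all_goals first | trivial | omega⟩

theorem presLift_presArc {B : Type*} [Ring B] [Algebra K B] (x : AnnArc m n → ℤ → B)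
    (htri : ∀ v, TriangleRel q fun i l => x (annSide m n v i) l)
    (hcomm : ∀ X Y s t, Disjoint X.ends Y.ends → x X s * x Y t = x Y t * x X s)
    (X : AnnArc m n) (l : ℤ) : presLift x htri hcomm (presArc q m n X l) = x X l := by
  rw [presLift, presArc, RingQuot.liftAlgHom_mkAlgHom_apply, arcGen, FreeAlgebra.lift_ι_apply]

theorem neg_mul_neg_comm {B : Type*} [Ring B] {x y : B} (h : x * y = y * x) :
    -x * -y = -y * -x := by
  rw [neg_mul_neg, neg_mul_neg, h]

theorem map_neg_of_eq_neg {B C : Type*} [Ring B] [Algebra K B] [Ring C] [Algebra K C]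
    (f : B →ₐ[K] C) {x : B} {y : C} (h : f x = -y) : f (-x) = y := by
  rw [map_neg, h, neg_neg]

end Presentation

/-! ### The naive algebra of the annulus -/

section Annulus

variable {k : Type*} [Field k] {K : Type*} [Field K] {q : K} {m n : ℕ} (hm : 1 ≤ m) (hn : 1 ≤ n)

/-- The gluing relations are imposed only for distinct triangles; within one triangle the sides are
distinct arcs, so nothing is missing. -/
theorem naiveArc_congr {v w : Fin m ⊕ Fin n} {i j : Fin 3}
    (h : annSide m n v i = annSide m n w j) (l : ℤ) :
    (annulus m n hm hn).naiveArc k q v i l = (annulus m n hm hn).naiveArc k q w j l := by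
  by_cases hvw : v = w
  · subst hvw
    rw [annSide_injective v h]
  · exact RingQuot.mkAlgHom_rel K (TriSurface.NaiveRel.glue v w i j l hvw h)

theorem naiveArc_commute {v w : Fin m ⊕ Fin n} {i j : Fin 3}
    (h : Disjoint (annSide m n v i).ends (annSide m n w j).ends) (s t : ℤ) :
    (annulus m n hm hn).naiveArc k q v i s * (annulus m n hm hn).naiveArc k q w j t =
      (annulus m n hm hn).naiveArc k q w j t * (annulus m n hm hn).naiveArc k q v i s := by
  have := RingQuot.mkAlgHom_rel K (TriSurface.NaiveRel.far (S := annulus m n hm hn) (k := k)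
    (q := q) v w i j s t (ne_of_disjoint_ends hm hn h) ((not_shareInterval_iff hm hn v w i j).2 h))
  rwa [map_mul, map_mul] at this

variable (k q) in
/-- A suspended arc as an element of the naive algebra. -/
def naiveElt (X : AnnArc m n) (l : ℤ) : (annulus m n hm hn).Naive k q :=
  (annulus m n hm hn).naiveArc k q ((annulus m n hm hn).arc_surj X).choose
    ((annulus m n hm hn).arc_surj X).choose_spec.choose l

theorem naiveElt_annSide (v : Fin m ⊕ Fin n) (i : Fin 3) (l : ℤ) :
    naiveElt k q hm hn (annSide m n v i) l = (annulus m n hm hn).naiveArc k q v i l :=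
  naiveArc_congr hm hn ((annulus m n hm hn).arc_surj (annSide m n v i)).choose_spec.choose_spec l

theorem naiveElt_commute {X Y : AnnArc m n} (h : Disjoint X.ends Y.ends) (s t : ℤ) :
    naiveElt k q hm hn X s * naiveElt k q hm hn Y t =
      naiveElt k q hm hn Y t * naiveElt k q hm hn X s := by
  obtain ⟨v, i, rfl⟩ := (annulus m n hm hn).arc_surj X
  obtain ⟨w, j, rfl⟩ := (annulus m n hm hn).arc_surj Y
  change Disjoint (annSide m n v i).ends (annSide m n w j).ends at h
  change naiveElt k q hm hn (annSide m n v i) s * naiveElt k q hm hn (annSide m n w j) t =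
    naiveElt k q hm hn (annSide m n w j) t * naiveElt k q hm hn (annSide m n v i) s
  rw [naiveElt_annSide, naiveElt_annSide]
  exact naiveArc_commute hm hn h s t

variable (k q) in
/-- The map from the disk algebra of a triangle to the naive algebra. -/
def diskToNaive (v : Fin m ⊕ Fin n) : DiskAlg k q stdFol →ₐ[K] (annulus m n hm hn).Naive k q :=
  (RingQuot.mkAlgHom K ((annulus m n hm hn).NaiveRel k q)).comp
    (LinearAlgebra.FreeProduct.ι K
      (fun v : Fin m ⊕ Fin n => DiskAlg k q ((annulus m n hm hn).fol v)) v)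

theorem naive_hom_ext {B : Type*} [Semiring B] [Algebra K B]
    {f g : (annulus m n hm hn).Naive k q →ₐ[K] B}
    (h : ∀ v i l, f ((annulus m n hm hn).naiveArc k q v i l) =
      g ((annulus m n hm hn).naiveArc k q v i l)) : f = g := by
  refine RingQuot.ringQuot_ext' K _ _ ((LinearAlgebra.FreeProduct.lift K _).symm.injective ?_)
  funext v
  exact diskAlg_hom_ext fun i l => h v i l

variable [CharZero K] [Finite k]

theorem isArcFamily_of_triangleRel (hq : q ^ 2 = (Nat.card k : K)) {B : Type*} [Ring B]
    [Algebra K B] {x : Fin 3 → ℤ → B} (hx : TriangleRel q x) :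
    IsArcFamily q fun j => -x (letterOf j).1 (letterOf j).2 := by
  refine (triangleRel_iff (q_ne_zero hq) fun j => x (letterOf j).1 (letterOf j).2).1 ?_
  simpa only [letterOf_letterIdx] using hx

/-- The commutation rules hold in the disk algebra and pass to any image; the sign turns them into
(R1) and (R2). -/
theorem triangleRel_of_hom (hq : q ^ 2 = (Nat.card k : K)) {B : Type*} [Ring B] [Algebra K B]
    (f : DiskAlg k q stdFol →ₐ[K] B) :
    TriangleRel q fun i l => -f (diskArc k q stdFol i l) := by
  have h := (triangleRel_iff (q_ne_zero hq) fun j => -f (diskArcZ k q j)).2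
    (by simpa only [neg_neg] using (isArcFamily_diskArcZ hq).map f)
  simpa only [← diskArc_eq] using h

/-- The homomorphism from the free product of the disk algebras given by elements satisfying the
relations of the triangles. -/
def prodLift (hq : q ^ 2 = (Nat.card k : K)) {B : Type*} [Ring B] [Algebra K B]
    (x : AnnArc m n → ℤ → B) (htri : ∀ v, TriangleRel q fun i l => x (annSide m n v i) l) :
    (annulus m n hm hn).DiskProduct k q →ₐ[K] B :=
  LinearAlgebra.FreeProduct.lift K _ fun {v} => diskLift hq (isArcFamily_of_triangleRel hq (htri v))

theorem prodLift_prodArc (hq : q ^ 2 = (Nat.card k : K)) {B : Type*} [Ring B] [Algebra K B]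
    (x : AnnArc m n → ℤ → B) (htri : ∀ v, TriangleRel q fun i l => x (annSide m n v i) l)
    (v : Fin m ⊕ Fin n) (i : Fin 3) (l : ℤ) :
    prodLift hm hn hq x htri ((annulus m n hm hn).prodArc k q v i l) =
      -x (annSide m n v i) l := by
  have h := DFunLike.congr_fun (LinearAlgebra.FreeProduct.lift_comp_ι K
    (fun v : Fin m ⊕ Fin n => DiskAlg k q ((annulus m n hm hn).fol v))
    (maps := fun {v} => diskLift hq (isArcFamily_of_triangleRel hq (htri v)))
    (i := v)) (diskArc k q stdFol i l)
  refine h.trans ((diskLift_diskArc hq (isArcFamily_of_triangleRel hq (htri v)) i l).trans ?_)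
  rw [letterOf_letterIdx]

/-- The homomorphism from the naive algebra given by elements satisfying the relations of the
presentation. -/
def naiveLift (hq : q ^ 2 = (Nat.card k : K)) {B : Type*} [Ring B] [Algebra K B]
    (x : AnnArc m n → ℤ → B) (htri : ∀ v, TriangleRel q fun i l => x (annSide m n v i) l)
    (hcomm : ∀ X Y s t, Disjoint X.ends Y.ends → x X s * x Y t = x Y t * x X s) :
    (annulus m n hm hn).Naive k q →ₐ[K] B :=
  RingQuot.liftAlgHom K ⟨prodLift hm hn hq x htri, by
    intro a b hab
    cases hab with
    | glue v w i j l hvw harc =>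
      rw [prodLift_prodArc, prodLift_prodArc]
      exact congrArg (fun X => -x X l) harc
    | far v w i j s t hvw hfar =>
      rw [map_mul, map_mul, prodLift_prodArc, prodLift_prodArc, neg_mul_neg, neg_mul_neg,
        hcomm _ _ _ _ ((not_shareInterval_iff hm hn v w i j).1 hfar)]⟩

theorem naiveLift_naiveArc (hq : q ^ 2 = (Nat.card k : K)) {B : Type*} [Ring B] [Algebra K B]
    (x : AnnArc m n → ℤ → B) (htri : ∀ v, TriangleRel q fun i l => x (annSide m n v i) l)
    (hcomm : ∀ X Y s t, Disjoint X.ends Y.ends → x X s * x Y t = x Y t * x X s)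
    (v : Fin m ⊕ Fin n) (i : Fin 3) (l : ℤ) :
    naiveLift hm hn hq x htri hcomm ((annulus m n hm hn).naiveArc k q v i l) =
      -x (annSide m n v i) l := by
  rw [naiveLift, TriSurface.naiveArc, RingQuot.liftAlgHom_mkAlgHom_apply, prodLift_prodArc]

theorem triangleRel_naiveElt (hq : q ^ 2 = (Nat.card k : K)) (v : Fin m ⊕ Fin n) :
    TriangleRel q fun i l => -naiveElt k q hm hn (annSide m n v i) l := by
  simp only [naiveElt_annSide]
  exact triangleRel_of_hom hq (B := (annulus m n hm hn).Naive k q) (diskToNaive k q hm hn v)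

/-- The homomorphism from the presented algebra to the naive algebra. -/
def presToNaive (hq : q ^ 2 = (Nat.card k : K)) :
    AnnPres q m n →ₐ[K] (annulus m n hm hn).Naive k q :=
  presLift (fun X l => -naiveElt k q hm hn X l) (triangleRel_naiveElt hm hn hq)
    fun _ _ s t h => neg_mul_neg_comm (B := (annulus m n hm hn).Naive k q)
      (naiveElt_commute hm hn h s t)

theorem presToNaive_presArc (hq : q ^ 2 = (Nat.card k : K)) (v : Fin m ⊕ Fin n) (i : Fin 3)
    (l : ℤ) : presToNaive hm hn hq (presArc q m n (annSide m n v i) l) =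
      -(annulus m n hm hn).naiveArc k q v i l := by
  rw [← naiveElt_annSide]
  exact presLift_presArc (fun X l => -naiveElt k q hm hn X l) _ _ _ _

/-- The homomorphism from the naive algebra to the presented algebra. -/
def naiveToPres (hq : q ^ 2 = (Nat.card k : K)) :
    (annulus m n hm hn).Naive k q →ₐ[K] AnnPres q m n :=
  naiveLift hm hn hq (presArc q m n) triangleRel_presArc fun _ _ s t h => commute_presArc h s t

theorem naiveToPres_naiveArc (hq : q ^ 2 = (Nat.card k : K)) (v : Fin m ⊕ Fin n) (i : Fin 3)
    (l : ℤ) : naiveToPres hm hn hq ((annulus m n hm hn).naiveArc k q v i l) =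
      -presArc q m n (annSide m n v i) l :=
  naiveLift_naiveArc hm hn hq (presArc q m n) _ _ v i l

/-- The presented algebra is the naive algebra of the annulus. -/
def presEquivNaive (hq : q ^ 2 = (Nat.card k : K)) :
    AnnPres q m n ≃ₐ[K] (annulus m n hm hn).Naive k q :=
  AlgEquiv.ofAlgHom (presToNaive hm hn hq) (naiveToPres hm hn hq)
    (naive_hom_ext hm hn (f := (presToNaive hm hn hq).comp (naiveToPres hm hn hq))
      (g := AlgHom.id K _) fun v i l => by
        rw [AlgHom.comp_apply, naiveToPres_naiveArc]
        exact map_neg_of_eq_neg (B := AnnPres q m n) (C := (annulus m n hm hn).Naive k q)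
          (presToNaive hm hn hq) (presToNaive_presArc hm hn hq v i l))
    (annPres_hom_ext (f := (naiveToPres hm hn hq).comp (presToNaive hm hn hq))
      (g := AlgHom.id K _) fun X l => by
        obtain ⟨v, i, rfl⟩ := (annulus m n hm hn).arc_surj X
        change naiveToPres hm hn hq (presToNaive hm hn hq (presArc q m n (annSide m n v i) l)) =
          presArc q m n (annSide m n v i) l
        rw [presToNaive_presArc]
        exact map_neg_of_eq_neg (B := (annulus m n hm hn).Naive k q) (C := AnnPres q m n)
          (naiveToPres hm hn hq) (naiveToPres_naiveArc hm hn hq v i l))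

theorem presEquivNaive_presArc (hq : q ^ 2 = (Nat.card k : K)) (v : Fin m ⊕ Fin n) (i : Fin 3)
    (l : ℤ) : presEquivNaive hm hn hq (presArc q m n ((annulus m n hm hn).arc v i) l) =
      (-1 : K) • (annulus m n hm hn).naiveArc k q v i l :=
  (presToNaive_presArc hm hn hq v i l).trans (neg_one_smul K (M := (annulus m n hm hn).Naive k q) _).symm

end Annulus

end FukayaHall

end

theorem mainTheorem7 {k : Type*} [Field k] [Finite k] {K : Type*} [Field K] [CharZero K]
    (q : K) (hq : q ^ 2 = (Nat.card k : K)) (m n : ℕ) (hm : 1 ≤ m) (hn : 1 ≤ n) :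
    ∃ Φ : FukayaHall.AnnPres q m n ≃ₐ[K] (FukayaHall.annulus m n hm hn).Naive k q,
      ∀ (v : Fin m ⊕ Fin n) (i : Fin 3) (l : ℤ),
        Φ (FukayaHall.presArc q m n ((FukayaHall.annulus m n hm hn).arc v i) l) =
          (-1 : K) • (FukayaHall.annulus m n hm hn).naiveArc k q v i l :=
  ⟨FukayaHall.presEquivNaive hm hn hq, FukayaHall.presEquivNaive_presArc hm hn hq⟩
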